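/- **Setting.** For $c=(c_1,c_2,c_3)\in\mathbb R^3$ let $P_c(x)=c_1(1-x)+c_2(1+x)+c_3(1-x^2)$, and consider on $(-1,1)$ the equation $$(1-x^2)u'+2xu+\tfrac12u^2=P_c(x).\qquad(1)$$ Let $\gamma^-(c)$ and $\gamma^+(c)$ be the infimum and the supremum of the values $u(0)$ of the $C^1$ solutions $u$ of (1) on all of $(-1,1)$, let $\bar c_3(c_1,c_2)=-\frac12\big(\sqrt{1+c_1}+\sqrt{1+c_2}\big)\big(\sqrt{1+c_1}+\sqrt{1+c_2}+2\big)$, and $$I_{1,1}=\{(c,\gamma)\in\mathbb R^4: c_1>-1,\ c_2>-1,\ c_3>\bar c_3(c_1,c_2),\ \gamma^-(c)<\gamma<\gamma^+(c)\}.$$ For $(c,\gamma)\in I_{1,1}$ let $\bar U_\theta=U^{c,\gamma}_\theta$ be the solution of (1) with $\bar U_\theta(0)=\gamma$, let $\bar U_\theta(\pm1)$ be its limits at $\pm1$, and let $U^{c,\gamma}=(U_\theta^{c,\gamma},0)$. For functions on $(-1,1)$ put $$\psi[f](x)=\int_0^x\!\int_0^l\!\int_0^t\frac{2f(s)f'(s)}{1-s^2}\,ds\,dt\,dl,\qquad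 \varphi_{c,\gamma}[u]=(1-x^2)u'+(2x+\bar U_\theta)u+\tfrac12u^2 .$$ A pair $U=(U_\theta,U_\phi)$ with $U_\theta\in C^1(-1,1)$, $U_\phi\in C^2(-1,1)$ solves the reduced system with constants $\hat c=(\hat c_1,\hat c_2,\hat c_3)$ if on $(-1,1)$ $$(1-x^2)U_\theta'+2xU_\theta+\tfrac12U_\theta^2+\psi[U_\phi]=P_{\hat c},\qquad (1-x^2)U_\phi''+U_\theta U_\phi'=0.\qquad(2)$$ With $a(x)=\int_0^x\frac{2s+\bar U_\theta(s)}{1-s^2}ds$ and $b(x)=\int_0^x\frac{\bar U_\theta(s)}{1-s^2}ds$ let $$V^1_{c,\gamma}=(e^{-a},0),\quad V^2_{c,\gamma}=\Big(e^{-a}\int_0^xe^{a(s)}ds,\,0\Big),\quad V^3_{c,\gamma}=\Big(0,\int_0^xe^{-b(t)}dt\Big),\quad V^4_{c,\gamma}=(0,1).$$ For $0<\epsilon<\frac12$ let $\mathbf M_1$ be the space of $u\in C^3(-\frac12,\frac12)\cap C^1(-1,1)\cap C[-1,1]$ with $u(\pm1)=0$ and finite norm $$\|(1-x^2)^{-1+2\epsilon}u\|_{L^\infty(-1,1)}+\|(1-x^2)^{2\epsilon}u'\|_{L^\infty(-1,1)}+\|u''\|_{L^\infty(-\frac12,\frac12)}+\|u'''\|_{L^\infty(-\frac12,\frac12)},$$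 let $\mathbf M_2$ be the space of $v\in C^2(-1,1)$ with finite norm $$\|(1-x^2)^{\epsilon}v\|_{L^\infty(-1,1)}+\|(1-x^2)^{1+\epsilon}v'\|_{L^\infty(-1,1)}+\|(1-x^2)^{2+\epsilon}v''\|_{L^\infty(-1,1)},$$ let $\mathbf X=\mathbf M_1\times\mathbf M_2$ with the sum of the norms, and let $\mathbf X_1=\{V\in\mathbf X: V_\theta(0)=V_\theta'(0)=V_\phi'(0)=V_\phi(0)=0\}$. **Theorem.** Let $K\subset I_{1,1}$ be compact, and let $0<\epsilon<\frac12$ be such that for all $(c,\gamma)\in K$: $\epsilon>\frac14\bar U_\theta(-1)$ if $\bar U_\theta(-1)<2$ and $\epsilon>\frac12\bar U_\theta(-1)-1$ otherwise; $\epsilon>-\frac14\bar U_\theta(1)$ if $\bar U_\theta(1)>-2$ and $\epsilon>-\frac12\bar U_\theta(1)-1$ otherwise. Let $B_\delta(0)$ denote the open ball of radius $\delta$ in $\mathbb R^4$. Then there exist $\delta>0$ and $V\in C^\infty(K\times B_\delta(0),\mathbf X_1)$ (that is, $V$ is $C^\infty$ on $\Omega\times B_\delta(0)$ for some open $\Omega\supset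 K$) such that for all $(c,\gamma)\in K$ $$V(c,\gamma,0)=0,\qquad \frac{\partial V}{\partial\beta_i}(c,\gamma,0)=0,\quad 1\le i\le4,$$ and for all $(c,\gamma)\in K$ and $\beta=(\beta_1,\beta_2,\beta_3,\beta_4)$ with $|\beta|<\delta$ the pair $$U=U^{c,\gamma}+\sum_{i=1}^4\beta_iV^i_{c,\gamma}+V(c,\gamma,\beta)\qquad(3)$$ solves (2) with $$\hat c_1=c_1+\tfrac12\psi[\tilde U_\phi](-1),\quad \hat c_2=c_2+\tfrac12\psi[\tilde U_\phi](1),\quad \hat c_3=c_3-\tfrac12\big(\varphi_{c,\gamma}[\tilde U_\theta]\big)''(0),\qquad \tilde U=U-U^{c,\gamma}.$$ Moreover, there exists $\delta'>0$ such that if $(c,\gamma)\in K$, $U-U^{c,\gamma}\in\mathbf X$, $\|U-U^{c,\gamma}\|_{\mathbf X}<\delta'$ and $U$ solves (2) with some constants $\hat c_1,\hat c_2,\hat c_3$, then (3) holds for some $\beta$ with $|\beta|<\delta$. -/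

import Mathlib

open Set Filter Topology
open scoped ContDiff

noncomputable section

namespace SwirlNS

/-! ### Axisymmetric no-swirl solutions

Functions on `(-1,1)` are represented by functions `ℝ → ℝ`, of which only the values on the open
interval `(-1,1)` are used. A parameter is a pair `p = (c, γ)` with `c = (c₁, c₂, c₃)`, written
`p.1 0`, `p.1 1`, `p.1 2`. -/

/-- The parameter space of the pairs `(c, γ)`. -/
abbrev Param : Type := (Fin 3 → ℝ) × ℝ

/-- `P_c(x) = c₁ (1 - x) + c₂ (1 + x) + c₃ (1 - x²)`. -/
def P (c : Fin 3 → ℝ) (x : ℝ) : ℝ :=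
  c 0 * (1 - x) + c 1 * (1 + x) + c 2 * (1 - x ^ 2)

/-- `u` is a `C¹` solution on `(-1,1)` of `(1 - x²) u' + 2 x u + u² / 2 = P_c`. -/
def IsNoSwirlSolution (c : Fin 3 → ℝ) (u : ℝ → ℝ) : Prop :=
  ContDiffOn ℝ 1 u (Ioo (-1) 1) ∧
    ∀ x ∈ Ioo (-1 : ℝ) 1,
      (1 - x ^ 2) * deriv u x + 2 * x * u x + 1 / 2 * u x ^ 2 = P c x

/-- The values at `0` of the solutions on the whole interval `(-1,1)`. -/
def gammaSet (c : Fin 3 → ℝ) : Set ℝ :=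
  {γ | ∃ u : ℝ → ℝ, IsNoSwirlSolution c u ∧ u 0 = γ}

/-- `γ⁻(c)`, the least value at `0` of a solution on `(-1,1)`. -/
def gammaMinus (c : Fin 3 → ℝ) : ℝ := sInf (gammaSet c)

/-- `γ⁺(c)`, the largest value at `0` of a solution on `(-1,1)`. -/
def gammaPlus (c : Fin 3 → ℝ) : ℝ := sSup (gammaSet c)

/-- `c̄₃(c₁, c₂)`. -/
def cbar3 (c₁ c₂ : ℝ) : ℝ :=
  -(1 / 2) * (√(1 + c₁) + √(1 + c₂)) * (√(1 + c₁) + √(1 + c₂) + 2)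

/-- The set `I_{1,1}`. -/
def I11 : Set Param :=
  {p | -1 < p.1 0 ∧ -1 < p.1 1 ∧ cbar3 (p.1 0) (p.1 1) < p.1 2 ∧
    gammaMinus p.1 < p.2 ∧ p.2 < gammaPlus p.1}

open Classical in
/-- `U_θ^{c,γ}`: the solution on `(-1,1)` with value `γ` at `0` (zero if there is none). -/
def Ubar (p : Param) : ℝ → ℝ :=
  if h : ∃ u : ℝ → ℝ, IsNoSwirlSolution p.1 u ∧ u 0 = p.2 then h.choose else 0

/-- `U_θ^{c,γ}(-1)`, the limit at the left end point. -/
def UbarLeft (p : Param) : ℝ := limUnder (𝓝[>] (-1 : ℝ)) (Ubar p)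

/-- `U_θ^{c,γ}(1)`, the limit at the right end point. -/
def UbarRight (p : Param) : ℝ := limUnder (𝓝[<] (1 : ℝ)) (Ubar p)

/-- The weight exponents allowed for the set `K` of parameters. -/
def AdmissibleExponent (K : Set Param) (ε : ℝ) : Prop :=
  0 < ε ∧ ε < 1 / 2 ∧ ∀ p ∈ K,
    (if UbarLeft p < 2 then UbarLeft p / 4 else UbarLeft p / 2 - 1) < ε ∧
    (if -2 < UbarRight p then -UbarRight p / 4 else -UbarRight p / 2 - 1) < ε

/-! ### The reduced system -/

/-- `ψ[f, g](x) = ∫₀ˣ ∫₀ˡ ∫₀ᵗ 2 f(s) g'(s) / (1 - s²) ds dt dl`. -/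
def psi (f g : ℝ → ℝ) (x : ℝ) : ℝ :=
  ∫ l in (0 : ℝ)..x, ∫ t in (0 : ℝ)..l, ∫ s in (0 : ℝ)..t, 2 * f s * deriv g s / (1 - s ^ 2)

/-- `φ_{c,γ}[u](x) = (1 - x²) u' + (2 x + U_θ^{c,γ}) u + u² / 2`. -/
def phi (p : Param) (u : ℝ → ℝ) (x : ℝ) : ℝ :=
  (1 - x ^ 2) * deriv u x + (2 * x + Ubar p x) * u x + 1 / 2 * u x ^ 2

/-- `(Uθ, Uφ)` is a classical solution on `(-1,1)` of the reduced system with constants `ĉ`. -/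
def SolvesReduced (chat : Fin 3 → ℝ) (Uθ Uφ : ℝ → ℝ) : Prop :=
  ContDiffOn ℝ 1 Uθ (Ioo (-1) 1) ∧ ContDiffOn ℝ 2 Uφ (Ioo (-1) 1) ∧
    ∀ x ∈ Ioo (-1 : ℝ) 1,
      (1 - x ^ 2) * deriv Uθ x + 2 * x * Uθ x + 1 / 2 * Uθ x ^ 2 + psi Uφ Uφ x = P chat x ∧
      (1 - x ^ 2) * iteratedDeriv 2 Uφ x + Uθ x * deriv Uφ x = 0

/-! ### The kernel of the linearized operator -/

/-- `a_{c,γ}`. -/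
def aFun (p : Param) (x : ℝ) : ℝ := ∫ s in (0 : ℝ)..x, (2 * s + Ubar p s) / (1 - s ^ 2)

/-- `b_{c,γ}`. -/
def bFun (p : Param) (x : ℝ) : ℝ := ∫ s in (0 : ℝ)..x, Ubar p s / (1 - s ^ 2)

/-- The `θ`-components of `V¹, V², V³, V⁴`. -/
def kerθ (p : Param) : Fin 4 → ℝ → ℝ :=
  ![fun x => Real.exp (-aFun p x),
    fun x => Real.exp (-aFun p x) * ∫ s in (0 : ℝ)..x, Real.exp (aFun p s),
    fun _ => 0,
    fun _ => 0]

/-- The `φ`-components of `V¹, V², V³, V⁴`. -/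
def kerφ (p : Param) : Fin 4 → ℝ → ℝ :=
  ![fun _ => 0,
    fun _ => 0,
    fun x => ∫ t in (0 : ℝ)..x, Real.exp (-bFun p t),
    fun _ => 1]

/-! ### The weighted function spaces -/

/-- The weight `(1 - x²) ^ r`. -/
def weight (r x : ℝ) : ℝ := (1 - x ^ 2) ^ r

/-- `‖w f^{(k)}‖_{L^∞(s)}`. It is used for functions in `C^k(s)`, `s` an open interval, `w`
continuous on `s`, so that it is the supremum. -/
def wSup (s : Set ℝ) (w : ℝ → ℝ) (k : ℕ) (f : ℝ → ℝ) : ℝ :=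
  ⨆ x : s, |w x * iteratedDeriv k f x|

/-- `‖w f^{(k)}‖_{L^∞(s)} < ∞`. -/
def WBdd (s : Set ℝ) (w : ℝ → ℝ) (k : ℕ) (f : ℝ → ℝ) : Prop :=
  ∃ C : ℝ, ∀ x ∈ s, |w x * iteratedDeriv k f x| ≤ C

section aux

variable {s : Set ℝ} {w f g : ℝ → ℝ} {k : ℕ}

theorem iteratedDeriv_add_on (hs : IsOpen s) (hf : ContDiffOn ℝ k f s) (hg : ContDiffOn ℝ k g s)
    {x : ℝ} (hx : x ∈ s) :
    iteratedDeriv k (f + g) x = iteratedDeriv k f x + iteratedDeriv k g x :=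
  iteratedDeriv_add (hf.contDiffAt (hs.mem_nhds hx)) (hg.contDiffAt (hs.mem_nhds hx))

theorem iteratedDeriv_smul_eq (a x : ℝ) :
    iteratedDeriv k (a • f) x = a * iteratedDeriv k f x := by
  simp

theorem WBdd.zero : WBdd s w k (0 : ℝ → ℝ) :=
  ⟨0, fun x _ => by
    have : iteratedDeriv k (0 : ℝ → ℝ) x = 0 := by
      simp
    simp [this]⟩

theorem WBdd.add (hs : IsOpen s) (hf : ContDiffOn ℝ k f s) (hg : ContDiffOn ℝ k g s)
    (bf : WBdd s w k f) (bg : WBdd s w k g) : WBdd s w k (f + g) := by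
  obtain ⟨C, hC⟩ := bf
  obtain ⟨D, hD⟩ := bg
  refine ⟨C + D, fun x hx => ?_⟩
  rw [iteratedDeriv_add_on hs hf hg hx, mul_add]
  exact (abs_add_le _ _).trans (add_le_add (hC x hx) (hD x hx))

theorem WBdd.smul (a : ℝ) (bf : WBdd s w k f) : WBdd s w k (a • f) := by
  obtain ⟨C, hC⟩ := bf
  refine ⟨|a| * C, fun x hx => ?_⟩
  rw [iteratedDeriv_smul_eq, mul_left_comm, abs_mul]
  exact mul_le_mul_of_nonneg_left (hC x hx) (abs_nonneg a)

theorem WBdd.bddAbove (bf : WBdd s w k f) :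
    BddAbove (range fun x : s => |w x * iteratedDeriv k f x|) := by
  obtain ⟨C, hC⟩ := bf
  exact ⟨C, by rintro _ ⟨x, rfl⟩; exact hC x x.2⟩

theorem wSup_nonneg : 0 ≤ wSup s w k f := Real.iSup_nonneg fun _ => abs_nonneg _

theorem wSup_zero : wSup s w k (0 : ℝ → ℝ) = 0 := by
  have h : ∀ x : ℝ, iteratedDeriv k (0 : ℝ → ℝ) x = 0 := fun x => by
    simp
  simp [wSup, h]

theorem wSup_add_le (hs : IsOpen s) (hf : ContDiffOn ℝ k f s) (hg : ContDiffOn ℝ k g s)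
    (bf : WBdd s w k f) (bg : WBdd s w k g) :
    wSup s w k (f + g) ≤ wSup s w k f + wSup s w k g := by
  refine Real.iSup_le (fun x => ?_) (add_nonneg wSup_nonneg wSup_nonneg)
  rw [iteratedDeriv_add_on hs hf hg x.2, mul_add]
  exact (abs_add_le _ _).trans
    (add_le_add (le_ciSup bf.bddAbove x) (le_ciSup bg.bddAbove x))

theorem wSup_smul (a : ℝ) :
    wSup s w k (a • f) = |a| * wSup s w k f := by
  unfold wSup
  rw [Real.mul_iSup_of_nonneg (abs_nonneg a)]
  congr 1
  funext x
  rw [iteratedDeriv_smul_eq, mul_left_comm, abs_mul]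

theorem le_wSup (bf : WBdd s w k f) {x : ℝ} (hx : x ∈ s) :
    |w x * iteratedDeriv k f x| ≤ wSup s w k f := le_ciSup bf.bddAbove ⟨x, hx⟩

theorem weight_pos (r : ℝ) {x : ℝ} (hx : x ∈ Ioo (-1 : ℝ) 1) : 0 < weight r x :=
  Real.rpow_pos_of_pos (by nlinarith [hx.1, hx.2]) r

theorem eq_zero_of_wSup {r : ℝ} (h0 : ∀ x ∉ Ioo (-1 : ℝ) 1, f x = 0)
    (bf : WBdd (Ioo (-1) 1) (weight r) 0 f) (h : wSup (Ioo (-1) 1) (weight r) 0 f ≤ 0) :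
    f = 0 := by
  funext x
  by_cases hx : x ∈ Ioo (-1 : ℝ) 1
  · have h1 := abs_eq_zero.mp (le_antisymm ((le_wSup bf hx).trans h) (abs_nonneg _))
    simpa [(weight_pos r hx).ne'] using h1
  · exact h0 x hx

end aux

/-- The vector space underlying `M₁(ε)`. Its elements vanish at `±1`; their representatives are
extended by zero outside `(-1,1)`. -/
def M1Sub (ε : ℝ) : Submodule ℝ (ℝ → ℝ) where
  carrier := {f | (∀ x ∉ Ioo (-1 : ℝ) 1, f x = 0) ∧
    ContDiffOn ℝ 3 f (Ioo (-1 / 2) (1 / 2)) ∧ ContDiffOn ℝ 1 f (Ioo (-1) 1) ∧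
    ContinuousOn f (Icc (-1) 1) ∧
    WBdd (Ioo (-1) 1) (weight (-1 + 2 * ε)) 0 f ∧
    WBdd (Ioo (-1) 1) (weight (2 * ε)) 1 f ∧
    WBdd (Ioo (-1 / 2) (1 / 2)) 1 2 f ∧
    WBdd (Ioo (-1 / 2) (1 / 2)) 1 3 f}
  zero_mem' := ⟨fun _ _ => rfl, contDiffOn_const, contDiffOn_const, continuousOn_const,
    WBdd.zero, WBdd.zero, WBdd.zero, WBdd.zero⟩
  add_mem' := by
    rintro f g ⟨f0, f3, f1, fc, b0, b1, b2, b3⟩ ⟨g0, g3, g1, gc, d0, d1, d2, d3⟩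
    exact ⟨fun x hx => by simp [f0 x hx, g0 x hx], f3.add g3, f1.add g1, fc.add gc,
      b0.add isOpen_Ioo (f1.of_le (by norm_num)) (g1.of_le (by norm_num)) d0,
      b1.add isOpen_Ioo f1 g1 d1,
      b2.add isOpen_Ioo (f3.of_le (by norm_num)) (g3.of_le (by norm_num)) d2,
      b3.add isOpen_Ioo f3 g3 d3⟩
  smul_mem' := by
    rintro a f ⟨f0, f3, f1, fc, b0, b1, b2, b3⟩
    exact ⟨fun x hx => by simp [f0 x hx], f3.const_smul a, f1.const_smul a, fc.const_smul a,
      b0.smul a, b1.smul a,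
      b2.smul a, b3.smul a⟩

/-- The vector space underlying `M₂(ε)`; representatives are extended by zero outside `(-1,1)`. -/
def M2Sub (ε : ℝ) : Submodule ℝ (ℝ → ℝ) where
  carrier := {f | (∀ x ∉ Ioo (-1 : ℝ) 1, f x = 0) ∧ ContDiffOn ℝ 2 f (Ioo (-1) 1) ∧
    WBdd (Ioo (-1) 1) (weight ε) 0 f ∧
    WBdd (Ioo (-1) 1) (weight (1 + ε)) 1 f ∧
    WBdd (Ioo (-1) 1) (weight (2 + ε)) 2 f}
  zero_mem' := ⟨fun _ _ => rfl, contDiffOn_const, WBdd.zero, WBdd.zero, WBdd.zero⟩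
  add_mem' := by
    rintro f g ⟨f0, f2, b0, b1, b2⟩ ⟨g0, g2, d0, d1, d2⟩
    exact ⟨fun x hx => by simp [f0 x hx, g0 x hx], f2.add g2,
      b0.add isOpen_Ioo (f2.of_le (by norm_num)) (g2.of_le (by norm_num)) d0,
      b1.add isOpen_Ioo (f2.of_le (by norm_num)) (g2.of_le (by norm_num)) d1,
      b2.add isOpen_Ioo f2 g2 d2⟩
  smul_mem' := by
    rintro a f ⟨f0, f2, b0, b1, b2⟩
    exact ⟨fun x hx => by simp [f0 x hx], f2.const_smul a,
      b0.smul a,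
      b1.smul a, b2.smul a⟩

/-- The space `M₁(ε)`. -/
def M1 (ε : ℝ) : Type := M1Sub ε

/-- The space `M₂(ε)`. -/
def M2 (ε : ℝ) : Type := M2Sub ε

instance (ε : ℝ) : AddCommGroup (M1 ε) := inferInstanceAs (AddCommGroup (M1Sub ε))
instance (ε : ℝ) : Module ℝ (M1 ε) := inferInstanceAs (Module ℝ (M1Sub ε))
instance (ε : ℝ) : AddCommGroup (M2 ε) := inferInstanceAs (AddCommGroup (M2Sub ε))
instance (ε : ℝ) : Module ℝ (M2 ε) := inferInstanceAs (Module ℝ (M2Sub ε))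

/-- The function on the line that represents an element of `M₁(ε)`. -/
def M1.fn {ε : ℝ} (u : M1 ε) : ℝ → ℝ := Subtype.val (p := fun f => f ∈ M1Sub ε) u

/-- The function on the line that represents an element of `M₂(ε)`. -/
def M2.fn {ε : ℝ} (u : M2 ε) : ℝ → ℝ := Subtype.val (p := fun f => f ∈ M2Sub ε) u

theorem M1.mem {ε : ℝ} (u : M1 ε) : u.fn ∈ M1Sub ε := Subtype.property (p := fun f => f ∈ M1Sub ε) u
theorem M2.mem {ε : ℝ} (u : M2 ε) : u.fn ∈ M2Sub ε := Subtype.property (p := fun f => f ∈ M2Sub ε) u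
theorem M1.fn_add {ε : ℝ} (u v : M1 ε) : (u + v).fn = u.fn + v.fn := rfl
theorem M2.fn_add {ε : ℝ} (u v : M2 ε) : (u + v).fn = u.fn + v.fn := rfl
theorem M1.fn_smul {ε : ℝ} (a : ℝ) (u : M1 ε) : (a • u).fn = a • u.fn := rfl
theorem M2.fn_smul {ε : ℝ} (a : ℝ) (u : M2 ε) : (a • u).fn = a • u.fn := rfl
theorem M1.fn_zero {ε : ℝ} : (0 : M1 ε).fn = 0 := rfl
theorem M2.fn_zero {ε : ℝ} : (0 : M2 ε).fn = 0 := rfl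
theorem M1.ext {ε : ℝ} {u v : M1 ε} (h : u.fn = v.fn) : u = v := Subtype.ext h
theorem M2.ext {ε : ℝ} {u v : M2 ε} (h : u.fn = v.fn) : u = v := Subtype.ext h

instance (ε : ℝ) : Norm (M1 ε) where
  norm u := wSup (Ioo (-1) 1) (weight (-1 + 2 * ε)) 0 u.fn +
    wSup (Ioo (-1) 1) (weight (2 * ε)) 1 u.fn +
    wSup (Ioo (-1 / 2) (1 / 2)) 1 2 u.fn +
    wSup (Ioo (-1 / 2) (1 / 2)) 1 3 u.fn

instance (ε : ℝ) : Norm (M2 ε) where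
  norm u := wSup (Ioo (-1) 1) (weight ε) 0 u.fn +
    wSup (Ioo (-1) 1) (weight (1 + ε)) 1 u.fn +
    wSup (Ioo (-1) 1) (weight (2 + ε)) 2 u.fn

theorem M1.norm_def {ε : ℝ} (u : M1 ε) :
    ‖u‖ = wSup (Ioo (-1) 1) (weight (-1 + 2 * ε)) 0 u.fn +
      wSup (Ioo (-1) 1) (weight (2 * ε)) 1 u.fn +
      wSup (Ioo (-1 / 2) (1 / 2)) 1 2 u.fn +
      wSup (Ioo (-1 / 2) (1 / 2)) 1 3 u.fn := rfl

theorem M2.norm_def {ε : ℝ} (u : M2 ε) :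
    ‖u‖ = wSup (Ioo (-1) 1) (weight ε) 0 u.fn +
      wSup (Ioo (-1) 1) (weight (1 + ε)) 1 u.fn +
      wSup (Ioo (-1) 1) (weight (2 + ε)) 2 u.fn := rfl

theorem M1.core (ε : ℝ) : NormedSpace.Core ℝ (M1 ε) where
  norm_nonneg u := add_nonneg (add_nonneg (add_nonneg wSup_nonneg wSup_nonneg) wSup_nonneg)
    wSup_nonneg
  norm_smul a u := by
    obtain ⟨f0, f3, f1, fc, b0, b1, b2, b3⟩ := u.mem
    rw [M1.norm_def, M1.norm_def, M1.fn_smul, wSup_smul,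
      wSup_smul, wSup_smul,
      wSup_smul, Real.norm_eq_abs]
    ring
  norm_triangle u v := by
    obtain ⟨f0, f3, f1, fc, b0, b1, b2, b3⟩ := u.mem
    obtain ⟨g0, g3, g1, gc, d0, d1, d2, d3⟩ := v.mem
    rw [M1.norm_def, M1.norm_def, M1.norm_def, M1.fn_add]
    linarith [wSup_add_le isOpen_Ioo (f1.of_le (by norm_num)) (g1.of_le (by norm_num)) b0 d0,
      wSup_add_le isOpen_Ioo f1 g1 b1 d1,
      wSup_add_le isOpen_Ioo (f3.of_le (by norm_num)) (g3.of_le (by norm_num)) b2 d2,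
      wSup_add_le isOpen_Ioo f3 g3 b3 d3]
  norm_eq_zero_iff u := by
    constructor
    · intro h
      obtain ⟨f0, f3, f1, fc, b0, b1, b2, b3⟩ := u.mem
      refine M1.ext (eq_zero_of_wSup f0 b0 ?_)
      rw [M1.norm_def] at h
      linarith [wSup_nonneg (s := Ioo (-1) 1) (w := weight (2 * ε)) (k := 1) (f := u.fn),
        wSup_nonneg (s := Ioo (-1 / 2) (1 / 2)) (w := 1) (k := 2) (f := u.fn),
        wSup_nonneg (s := Ioo (-1 / 2) (1 / 2)) (w := 1) (k := 3) (f := u.fn)]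
    · rintro rfl
      simp [M1.norm_def, M1.fn_zero, wSup_zero]

theorem M2.core (ε : ℝ) : NormedSpace.Core ℝ (M2 ε) where
  norm_nonneg u := add_nonneg (add_nonneg wSup_nonneg wSup_nonneg) wSup_nonneg
  norm_smul a u := by
    obtain ⟨f0, f2, b0, b1, b2⟩ := u.mem
    rw [M2.norm_def, M2.norm_def, M2.fn_smul, wSup_smul,
      wSup_smul, wSup_smul,
      Real.norm_eq_abs]
    ring
  norm_triangle u v := by
    obtain ⟨f0, f2, b0, b1, b2⟩ := u.mem
    obtain ⟨g0, g2, d0, d1, d2⟩ := v.mem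
    rw [M2.norm_def, M2.norm_def, M2.norm_def, M2.fn_add]
    linarith [wSup_add_le isOpen_Ioo (f2.of_le (by norm_num)) (g2.of_le (by norm_num)) b0 d0,
      wSup_add_le isOpen_Ioo (f2.of_le (by norm_num)) (g2.of_le (by norm_num)) b1 d1,
      wSup_add_le isOpen_Ioo f2 g2 b2 d2]
  norm_eq_zero_iff u := by
    constructor
    · intro h
      obtain ⟨f0, f2, b0, b1, b2⟩ := u.mem
      refine M2.ext (eq_zero_of_wSup f0 b0 ?_)
      rw [M2.norm_def] at h
      linarith [wSup_nonneg (s := Ioo (-1) 1) (w := weight (1 + ε)) (k := 1) (f := u.fn),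
        wSup_nonneg (s := Ioo (-1) 1) (w := weight (2 + ε)) (k := 2) (f := u.fn)]
    · rintro rfl
      simp [M2.norm_def, M2.fn_zero, wSup_zero]

instance (ε : ℝ) : NormedAddCommGroup (M1 ε) := NormedAddCommGroup.ofCore (M1.core ε)
instance (ε : ℝ) : NormedSpace ℝ (M1 ε) := NormedSpace.ofCore (M1.core ε)
instance (ε : ℝ) : NormedAddCommGroup (M2 ε) := NormedAddCommGroup.ofCore (M2.core ε)
instance (ε : ℝ) : NormedSpace ℝ (M2 ε) := NormedSpace.ofCore (M2.core ε)

/-- `X = M₁ × M₂` with the norm `‖(u, v)‖ = ‖u‖ + ‖v‖`. -/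
abbrev X (ε : ℝ) : Type := WithLp 1 (M1 ε × M2 ε)

/-- The `θ`-component of an element of `X`. -/
def X.θ {ε : ℝ} (u : X ε) : ℝ → ℝ := u.fst.fn

/-- The `φ`-component of an element of `X`. -/
def X.φ {ε : ℝ} (u : X ε) : ℝ → ℝ := u.snd.fn

theorem M1.differentiableAt {ε : ℝ} (u : M1 ε) : DifferentiableAt ℝ u.fn 0 :=
  (u.mem.2.2.1.contDiffAt (Ioo_mem_nhds (by norm_num) (by norm_num))).differentiableAt (by norm_num)

theorem M2.differentiableAt {ε : ℝ} (u : M2 ε) : DifferentiableAt ℝ u.fn 0 :=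
  (u.mem.2.1.contDiffAt (Ioo_mem_nhds (by norm_num) (by norm_num))).differentiableAt (by norm_num)

/-- `X₁ = {V ∈ X | V_θ(0) = V_θ'(0) = V_φ'(0) = V_φ(0) = 0}`. -/
def X1 (ε : ℝ) : Submodule ℝ (X ε) where
  carrier := {u | X.θ u 0 = 0 ∧ deriv (X.θ u) 0 = 0 ∧ deriv (X.φ u) 0 = 0 ∧ X.φ u 0 = 0}
  zero_mem' := by
    have h1 : X.θ (0 : X ε) = fun _ => 0 := rfl
    have h2 : X.φ (0 : X ε) = fun _ => 0 := rfl
    simp [h1, h2]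
  add_mem' := by
    rintro u v ⟨h1, h2, h3, h4⟩ ⟨k1, k2, k3, k4⟩
    have e1 : X.θ (u + v) = X.θ u + X.θ v := rfl
    have e2 : X.φ (u + v) = X.φ u + X.φ v := rfl
    refine ⟨by simp [e1, h1, k1], ?_, ?_, by simp [e2, h4, k4]⟩
    · rw [e1, deriv_add (f := X.θ u) (g := X.θ v) u.fst.differentiableAt v.fst.differentiableAt, h2, k2, add_zero]
    · rw [e2, deriv_add (f := X.φ u) (g := X.φ v) u.snd.differentiableAt v.snd.differentiableAt, h3, k3, add_zero]
  smul_mem' := by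
    rintro a u ⟨h1, h2, h3, h4⟩
    have e1 : X.θ (a • u) = a • X.θ u := rfl
    have e2 : X.φ (a • u) = a • X.φ u := rfl
    refine ⟨by simp [e1, h1], ?_, ?_, by simp [e2, h4]⟩
    · rw [e1, deriv_const_smul (f := X.θ u) a u.fst.differentiableAt, h2, smul_zero]
    · rw [e2, deriv_const_smul (f := X.φ u) a u.snd.differentiableAt, h3, smul_zero]

/-- The `θ`-component of `∑ βᵢ Vⁱ_{c,γ} + V`. -/
def perturbθ {ε : ℝ} (p : Param) (β : EuclideanSpace ℝ (Fin 4)) (V : X ε) (x : ℝ) : ℝ :=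
  ∑ i, β i * kerθ p i x + X.θ V x

/-- The `φ`-component of `∑ βᵢ Vⁱ_{c,γ} + V`. -/
def perturbφ {ε : ℝ} (p : Param) (β : EuclideanSpace ℝ (Fin 4)) (V : X ε) (x : ℝ) : ℝ :=
  ∑ i, β i * kerφ p i x + X.φ V x

end SwirlNS

end

open SwirlNS

/-! The singular end points are removed by a normal form. A solution of the Riccati equation (1)
that lies strictly between two others tends to 2 - 2√(1+c₁) at -1 and to -2 + 2√(1+c₂) at 1
(`IsNoSwirlSolution.tendsto_one` and its reflection). Hence on K only the first alternatives of the
conditions on ε occur, and they say that the end values m₁, m₂ satisfy m₁ < 4ε and -m₂ < 4ε. Write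
U_θ = aff + w, where aff is the affine function with these end values and w lies in M₁, put v = U_φ,
and subtract from ψ[v] a quadratic polynomial so that the result Ψ₀[v,v] vanishes at ±1. A
polynomial of degree at most 2 that vanishes at ±1 is a multiple of 1 - x², so the system becomes
(1-x²)w' + (2x + aff)w + w²/2 + Ψ₀[v,v] = f(1-x²), (1-x²)v'' + (aff + w)v' = 0. Its solutions are to
be parametrized by the data q = (m, f, w(0), v(0), v'(0)) (`IsSol`).

Fix a solution (w₀, 0) without swirl and put A = aff + w₀. The initial value problems for (1-x²)u' +
(2x+A)u = g and (1-x²)z' + Az = h are solved by integrating factors. The bounds on the end values of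
A make these solutions bounded operators into M₁ and M₂ (`Grows.bounds`, `Good.exists_M1Data`,
`Good.exists_M2Data`). The remaining terms are bounded bilinear expressions; for Ψ₀ this rests on
the fact that two of the three integrations reduce the singularity of 2vv'/(1-x²) to the integrable
order (1-x²)^(-2ε) (`exists_Srcθ_triple0`). So the system is a fixed point problem y = T(q, y) with
T a polynomial of degree 2 whose derivative in y vanishes at the base point. The implicit function
theorem gives a unique small solution, analytic in q (`exists_fixedPoint`, `exists_local`).

The parameters (c,γ) and β enter only through the data `datum p β`, which depend analytically on
them while c₁, c₂ > -1. The perturbation S(p,β) is the solution with data `datum p β` minus the one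
with data `datum p 0`; thus the smooth dependence of U^{c,γ} on (c,γ) needs no separate proof. Local
uniqueness and compactness of K glue the local families (`exists_glued_family`).

The derivative of S in β at 0 is β ↦ ∑ βᵢ Vⁱ, because the explicit solutions of the linear problems
are the kernel functions (`sum_kerθ`, `sum_kerφ`). Subtracting this linear part from S gives V. The
data are arranged so that S and its linear part have the same values and first derivatives at 0,
which puts V into X₁. Conversely, a solution near U^{c,γ} is in normal form with β read off from its
initial values (`isSol_of_solvesReduced`), and local uniqueness identifies it with S(p,β). -/

namespace SwirlNS

/-! ### Elementary calculus on `(-1,1)` -/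

/-- The interval `(-1,1)`. -/
abbrev Dom : Set ℝ := Ioo (-1 : ℝ) 1

/-- The interval `(-1/2,1/2)`. -/
abbrev Mid : Set ℝ := Ioo (-1 / 2 : ℝ) (1 / 2)

theorem zero_mem_Dom : (0 : ℝ) ∈ Dom := by constructor <;> norm_num

theorem zero_mem_Mid : (0 : ℝ) ∈ Mid := by constructor <;> norm_num

theorem Mid_subset_Dom : Mid ⊆ Dom := fun x hx => ⟨by linarith [hx.1], by linarith [hx.2]⟩

theorem one_sub_sq_pos {x : ℝ} (hx : x ∈ Dom) : 0 < 1 - x ^ 2 := by nlinarith [hx.1, hx.2]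

theorem neg_mem_Dom {x : ℝ} (hx : x ∈ Dom) : -x ∈ Dom :=
  ⟨by linarith [hx.2], by linarith [hx.1]⟩

theorem uIcc_zero_subset_Dom {x : ℝ} (hx : x ∈ Dom) : uIcc 0 x ⊆ Dom :=
  (convex_Ioo (-1 : ℝ) 1).ordConnected.uIcc_subset zero_mem_Dom hx

theorem intervalIntegrable_of_continuousOn_Dom {f : ℝ → ℝ} (hf : ContinuousOn f Dom) {x : ℝ}
    (hx : x ∈ Dom) : IntervalIntegrable f MeasureTheory.volume 0 x :=
  (hf.mono (uIcc_zero_subset_Dom hx)).intervalIntegrable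

theorem hasDerivAt_integral {f : ℝ → ℝ} (hf : ContinuousOn f Dom) {x : ℝ} (hx : x ∈ Dom) :
    HasDerivAt (fun x => ∫ s in (0 : ℝ)..x, f s) (f x) x :=
  intervalIntegral.integral_hasDerivAt_right (intervalIntegrable_of_continuousOn_Dom hf hx)
    (hf.stronglyMeasurableAtFilter isOpen_Ioo x hx) (hf.continuousAt (isOpen_Ioo.mem_nhds hx))

theorem continuousOn_integral {f : ℝ → ℝ} (hf : ContinuousOn f Dom) :
    ContinuousOn (fun x => ∫ s in (0 : ℝ)..x, f s) Dom := fun _ hx =>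
  (hasDerivAt_integral hf hx).continuousAt.continuousWithinAt

theorem continuousOn_of_hasDerivAt {f f' : ℝ → ℝ} {s : Set ℝ}
    (h : ∀ x ∈ s, HasDerivAt f (f' x) x) : ContinuousOn f s := fun x hx =>
  (h x hx).continuousAt.continuousWithinAt

theorem eq_of_hasDerivAt_zero {f : ℝ → ℝ} (h : ∀ x ∈ Dom, HasDerivAt f 0 x) {x : ℝ}
    (hx : x ∈ Dom) : f x = f 0 := by
  refine (convex_Ioo (-1 : ℝ) 1).is_const_of_fderivWithin_eq_zero (𝕜 := ℝ)
    (fun y hy => (h y hy).differentiableAt.differentiableWithinAt) (fun y hy => ?_) hx zero_mem_Dom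
  rw [fderivWithin_of_isOpen isOpen_Ioo hy]
  ext
  simp [(h y hy).deriv]

theorem eq_of_hasDerivAt_eq {f g f' : ℝ → ℝ} (hf : ∀ x ∈ Dom, HasDerivAt f (f' x) x)
    (hg : ∀ x ∈ Dom, HasDerivAt g (f' x) x) (h0 : f 0 = g 0) {x : ℝ} (hx : x ∈ Dom) :
    f x = g x := by
  have := eq_of_hasDerivAt_zero (f := fun x => f x - g x)
    (fun y hy => ((hf y hy).sub (hg y hy)).congr_deriv (sub_self _)) hx
  linarith

/-- Solutions of a homogeneous linear equation on `(-1,1)`. -/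
theorem eq_mul_exp_of_hasDerivAt {w k : ℝ → ℝ} (hk : ContinuousOn k Dom)
    (h : ∀ x ∈ Dom, HasDerivAt w (k x * w x) x) {x : ℝ} (hx : x ∈ Dom) :
    w x = w 0 * Real.exp (∫ s in (0 : ℝ)..x, k s) := by
  have := eq_of_hasDerivAt_zero
    (f := fun x => w x * Real.exp (-∫ s in (0 : ℝ)..x, k s))
    (fun y hy => ((h y hy).mul (hasDerivAt_integral hk hy).neg.exp).congr_deriv (by ring)) hx
  simp only [intervalIntegral.integral_same, neg_zero, Real.exp_zero, mul_one] at this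
  rw [← this, mul_assoc, ← Real.exp_add]
  simp

theorem eq_of_linear {u v k g : ℝ → ℝ} (hk : ContinuousOn k Dom)
    (hu : ∀ x ∈ Dom, HasDerivAt u (g x + k x * u x) x)
    (hv : ∀ x ∈ Dom, HasDerivAt v (g x + k x * v x) x) (h0 : u 0 = v 0) {x : ℝ} (hx : x ∈ Dom) :
    u x = v x := by
  have := eq_mul_exp_of_hasDerivAt (w := fun x => u x - v x) hk
    (fun y hy => ((hu y hy).sub (hv y hy)).congr_deriv (by ring)) hx
  simp only [h0, sub_self, zero_mul] at this
  linarith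

theorem abs_le_of_deriv_le {F G F' G' : ℝ → ℝ} (hF : ∀ x ∈ Ico (0 : ℝ) 1, HasDerivAt F (F' x) x)
    (hG : ∀ x ∈ Ico (0 : ℝ) 1, HasDerivAt G (G' x) x) (h0 : |F 0| ≤ G 0)
    (h : ∀ x ∈ Ico (0 : ℝ) 1, |F' x| ≤ G' x) {x : ℝ} (hx : x ∈ Ico (0 : ℝ) 1) : |F x| ≤ G x := by
  have key : ∀ y ∈ Icc (0 : ℝ) x, y ∈ Ico (0 : ℝ) 1 := fun y hy => ⟨hy.1, hy.2.trans_lt hx.2⟩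
  have key' : ∀ y ∈ Ico (0 : ℝ) x, y ∈ Ico (0 : ℝ) 1 := fun y hy => ⟨hy.1, hy.2.trans hx.2⟩
  exact image_norm_le_of_norm_deriv_right_le_deriv_boundary' (f := F) (B := G)
    (continuousOn_of_hasDerivAt fun y hy => hF y (key y hy))
    (fun y hy => (hF y (key' y hy)).hasDerivWithinAt) h0
    (continuousOn_of_hasDerivAt fun y hy => hG y (key y hy))
    (fun y hy => (hG y (key' y hy)).hasDerivWithinAt) (fun y hy => h y (key' y hy))
    ⟨hx.1, le_rfl⟩

/-! ### Powers of 1 - x² and growth estimates for integrating factors. -/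

theorem hasDerivAt_weight (r : ℝ) {x : ℝ} (hx : x ∈ Dom) :
    HasDerivAt (weight r) (-(2 * r * x) * weight (r - 1) x) x := by
  have h : HasDerivAt (fun x : ℝ => 1 - x ^ 2) (-(2 * x)) x := by
    simpa using ((hasDerivAt_id x).pow 2).const_sub 1
  exact (h.rpow_const (p := r) (Or.inl (one_sub_sq_pos hx).ne')).congr_deriv
    (by simp only [weight]; ring)

theorem continuousOn_weight (r : ℝ) : ContinuousOn (weight r) Dom :=
  continuousOn_of_hasDerivAt fun _ hx => hasDerivAt_weight r hx

theorem weight_add (r t : ℝ) {x : ℝ} (hx : x ∈ Dom) :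
    weight (r + t) x = weight r x * weight t x := Real.rpow_add (one_sub_sq_pos hx) r t

theorem weight_one (x : ℝ) : weight 1 x = 1 - x ^ 2 := Real.rpow_one _

theorem weight_zero (x : ℝ) : weight 0 x = 1 := Real.rpow_zero _

theorem weight_at_zero (r : ℝ) : weight r 0 = 1 := by simp [weight]

theorem weight_neg (r x : ℝ) : weight r (-x) = weight r x := by simp [weight]

theorem weight_mul_neg (r : ℝ) {x : ℝ} (hx : x ∈ Dom) : weight r x * weight (-r) x = 1 := by
  rw [← weight_add _ _ hx]; simp [weight_zero]

theorem one_sub_sq_mul_weight (r : ℝ) {x : ℝ} (hx : x ∈ Dom) :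
    (1 - x ^ 2) * weight r x = weight (1 + r) x := by
  rw [weight_add _ _ hx, weight_one]

theorem weight_le_weight {r t : ℝ} (h : r ≤ t) {x : ℝ} (hx : x ∈ Dom) :
    weight t x ≤ weight r x :=
  Real.rpow_le_rpow_of_exponent_ge (one_sub_sq_pos hx) (by nlinarith [sq_nonneg x]) h

theorem one_le_weight {r : ℝ} (h : r ≤ 0) {x : ℝ} (hx : x ∈ Dom) : 1 ≤ weight r x := by
  simpa [weight_zero] using weight_le_weight h hx

theorem weight_le_one {r : ℝ} (h : 0 ≤ r) {x : ℝ} (hx : x ∈ Dom) : weight r x ≤ 1 := by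
  simpa [weight_zero] using weight_le_weight h hx

/-- From `|w_r f| ≤ C` to `|f| ≤ C w_{-r}` and back. -/
theorem abs_weight_mul_le_iff {r C y x : ℝ} (hx : x ∈ Dom) :
    |weight r x * y| ≤ C ↔ |y| ≤ C * weight (-r) x := by
  rw [abs_mul, abs_of_pos (weight_pos r hx)]
  have h1 := weight_mul_neg r hx
  have h2 := weight_pos r hx
  have h3 := weight_pos (-r) hx
  constructor
  · intro h
    calc |y| = weight r x * |y| * weight (-r) x := by linear_combination (-|y|) * h1
      _ ≤ C * weight (-r) x := by gcongr
  · intro h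
    calc weight r x * |y| ≤ weight r x * (C * weight (-r) x) := by gcongr
      _ = C := by linear_combination C * h1

/-- `∫₀ˣ A(s) / (1 - s²) ds`. -/
noncomputable def expo (A : ℝ → ℝ) (x : ℝ) : ℝ := ∫ s in (0 : ℝ)..x, A s / (1 - s ^ 2)

theorem expo_zero (A : ℝ → ℝ) : expo A 0 = 0 := by simp [expo]

theorem continuousOn_div_one_sub_sq {A : ℝ → ℝ} (hA : ContinuousOn A Dom) :
    ContinuousOn (fun s => A s / (1 - s ^ 2)) Dom :=
  hA.div (by fun_prop) fun _ hx => (one_sub_sq_pos hx).ne'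

theorem hasDerivAt_expo {A : ℝ → ℝ} (hA : ContinuousOn A Dom) {x : ℝ} (hx : x ∈ Dom) :
    HasDerivAt (expo A) (A x / (1 - x ^ 2)) x :=
  hasDerivAt_integral (continuousOn_div_one_sub_sq hA) hx

theorem continuousOn_expo {A : ℝ → ℝ} (hA : ContinuousOn A Dom) : ContinuousOn (expo A) Dom :=
  continuousOn_of_hasDerivAt fun _ hx => hasDerivAt_expo hA hx

/-- The bound that makes `e^{b} (1 - x²)^{-r}` a majorant of its own integral: here `b = expo A`. -/
structure Grows (A : ℝ → ℝ) (r η Λ : ℝ) : Prop where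
  cont : ContinuousOn A Dom
  pos : 0 < η
  nonneg : 0 ≤ Λ
  right : ∀ x ∈ Ico (0 : ℝ) 1, η ≤ A x + 2 * r * x + Λ * (1 - x ^ 2)
  left : ∀ x ∈ Ioc (-1 : ℝ) 0, η ≤ -A x - 2 * r * x + Λ * (1 - x ^ 2)

theorem Ico_subset_Dom {x : ℝ} (hx : x ∈ Ico (0 : ℝ) 1) : x ∈ Dom := ⟨by linarith [hx.1], hx.2⟩

theorem expo_neg (A : ℝ → ℝ) (x : ℝ) : expo (fun s => -A (-s)) x = expo A (-x) := by
  have h := intervalIntegral.integral_comp_neg (a := 0) (b := x) (fun s => A s / (1 - s ^ 2))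
  simp only [neg_zero] at h
  rw [expo, expo, intervalIntegral.integral_symm (-x) 0, ← h, ← intervalIntegral.integral_neg]
  congr 1
  funext s
  ring

/-- The reflection x ↦ -x exchanges the two end conditions, so estimates need to be proved on [0,1)
only. -/
theorem Grows.neg {A : ℝ → ℝ} {r η Λ : ℝ} (h : Grows A r η Λ) :
    Grows (fun s => -A (-s)) r η Λ where
  cont := (h.cont.comp continuousOn_neg fun _ hx => neg_mem_Dom hx).neg
  pos := h.pos
  nonneg := h.nonneg
  right x hx := by
    have := h.left (-x) ⟨by linarith [hx.2], by linarith [hx.1]⟩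
    nlinarith
  left x hx := by
    have := h.right (-x) ⟨by linarith [hx.2], by linarith [hx.1]⟩
    nlinarith

/-- The factor e^{Λx} adds Λ(1-x²) to the bracket. This term vanishes at ±1, where the sign is
decided by A + 2rx alone, and it can outweigh A in the interior. -/
theorem Grows.hasDerivAt {A : ℝ → ℝ} {r η Λ : ℝ} (h : Grows A r η Λ) {x : ℝ} (hx : x ∈ Dom) :
    HasDerivAt (fun x => Real.exp (expo A x + Λ * x) * weight (-r) x)
      (Real.exp (expo A x + Λ * x) * weight (-1 - r) x *
        (A x + 2 * r * x + Λ * (1 - x ^ 2))) x := by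
  have h1 := ((hasDerivAt_expo h.cont hx).add ((hasDerivAt_id x).const_mul Λ)).exp.mul
    (hasDerivAt_weight (-r) hx)
  refine h1.congr_deriv ?_
  have e : weight (-r) x = (1 - x ^ 2) * weight (-1 - r) x := by
    rw [one_sub_sq_mul_weight _ hx]; congr 1; ring
  have h2 := (one_sub_sq_pos hx).ne'
  simp only [Pi.add_apply, id]
  rw [show -r - 1 = -1 - r by ring, e]
  field_simp
  ring

/-- Both bounds are comparisons with G = e^{b+Λx}(1-x²)^{-r}, b = `expo A`. By `Grows.right`, G' ≥ η
e^b (1-x²)^{-1-r} on [0,1). So G increases from G(0) = 1, and the integrand e^b f is at most (C/η)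
G' in absolute value. -/
theorem Grows.bounds_right {A f : ℝ → ℝ} {r η Λ C : ℝ} (h : Grows A r η Λ)
    (hf : ContinuousOn f Dom) (hb : ∀ x ∈ Dom, |f x| ≤ C * weight (-1 - r) x) {x : ℝ}
    (hx : x ∈ Ico (0 : ℝ) 1) :
    1 ≤ Real.exp (expo A x + Λ * x) * weight (-r) x ∧
    |∫ s in (0 : ℝ)..x, Real.exp (expo A s) * f s| ≤
      C / η * (Real.exp (expo A x + Λ * x) * weight (-r) x) := by
  have hC : 0 ≤ C := by
    have := (abs_nonneg _).trans (hb 0 zero_mem_Dom)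
    rwa [weight_at_zero, mul_one] at this
  have h0 : ∀ y ∈ Ico (0 : ℝ) 1, η * (Real.exp (expo A y) * weight (-1 - r) y) ≤
      Real.exp (expo A y + Λ * y) * weight (-1 - r) y * (A y + 2 * r * y + Λ * (1 - y ^ 2)) := by
    intro y hy
    have hw := weight_pos (-1 - r) (Ico_subset_Dom hy)
    have he : Real.exp (expo A y) ≤ Real.exp (expo A y + Λ * y) :=
      Real.exp_le_exp.2 (by nlinarith [h.nonneg, hy.1])
    rw [mul_comm η]
    have := h.right y hy
    have := h.pos
    gcongr
  constructor
  · have := abs_le_of_deriv_le (F := fun _ => (1 : ℝ)) (F' := fun _ => 0)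
      (fun y hy => hasDerivAt_const y (1 : ℝ)) (fun y hy => h.hasDerivAt (Ico_subset_Dom hy))
      (by simp [expo_zero, weight_at_zero]) (fun y hy => ?_) hx
    · simpa using this
    · refine le_trans ?_ (h0 y hy)
      have hw := weight_pos (-1 - r) (Ico_subset_Dom hy)
      have := h.pos
      rw [abs_zero]
      positivity
  · have hcont : ContinuousOn (fun s => Real.exp (expo A s) * f s) Dom :=
      (Real.continuous_exp.comp_continuousOn (continuousOn_expo h.cont)).mul hf
    refine abs_le_of_deriv_le (fun y hy => hasDerivAt_integral hcont (Ico_subset_Dom hy))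
      (fun y hy => (h.hasDerivAt (Ico_subset_Dom hy)).const_mul (C / η)) ?_ (fun y hy => ?_) hx
    · have := h.pos
      simp only [intervalIntegral.integral_same, abs_zero, expo_zero, weight_at_zero]
      positivity
    · rw [abs_mul, Real.abs_exp]
      have h1 := h0 y hy
      have hp := h.pos
      calc Real.exp (expo A y) * |f y| ≤ Real.exp (expo A y) * (C * weight (-1 - r) y) := by
            gcongr; exact hb y (Ico_subset_Dom hy)
        _ = C / η * (η * (Real.exp (expo A y) * weight (-1 - r) y)) := by field_simp
        _ ≤ _ := by gcongr

/-- Multiplying `Grows.bounds_right` by e^{-b} leaves e^{Λx} ≤ e^Λ, so that the integrating factor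
disappears and only the power of 1 - x² remains. -/
theorem Grows.bounds_of_nonneg {A f : ℝ → ℝ} {r η Λ C : ℝ} (h : Grows A r η Λ)
    (hf : ContinuousOn f Dom) (hb : ∀ x ∈ Dom, |f x| ≤ C * weight (-1 - r) x) {x : ℝ}
    (hx : x ∈ Ico (0 : ℝ) 1) :
    Real.exp (-expo A x) ≤ Real.exp Λ * weight (-r) x ∧
    |Real.exp (-expo A x) * ∫ s in (0 : ℝ)..x, Real.exp (expo A s) * f s| ≤
      C * (Real.exp Λ / η) * weight (-r) x := by
  have hC : 0 ≤ C := by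
    have := (abs_nonneg _).trans (hb 0 zero_mem_Dom)
    rwa [weight_at_zero, mul_one] at this
  obtain ⟨h1, h2⟩ := h.bounds_right hf hb hx
  have hw := weight_pos (-r) (Ico_subset_Dom hx)
  have hp := h.pos
  have he : Real.exp (-expo A x) * Real.exp (expo A x + Λ * x) ≤ Real.exp Λ := by
    rw [← Real.exp_add]
    exact Real.exp_le_exp.2 (by nlinarith [h.nonneg, hx.1, hx.2])
  constructor
  · calc Real.exp (-expo A x) = Real.exp (-expo A x) * 1 := (mul_one _).symm
      _ ≤ Real.exp (-expo A x) * (Real.exp (expo A x + Λ * x) * weight (-r) x) := by gcongr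
      _ = Real.exp (-expo A x) * Real.exp (expo A x + Λ * x) * weight (-r) x := by ring
      _ ≤ _ := by gcongr
  · rw [abs_mul, Real.abs_exp]
    calc _ ≤ Real.exp (-expo A x) *
          (C / η * (Real.exp (expo A x + Λ * x) * weight (-r) x)) := by gcongr
      _ = C / η * (Real.exp (-expo A x) * Real.exp (expo A x + Λ * x)) * weight (-r) x := by ring
      _ ≤ C / η * Real.exp Λ * weight (-r) x := by gcongr
      _ = _ := by ring

theorem Grows.bounds {A f : ℝ → ℝ} {r η Λ C : ℝ} (h : Grows A r η Λ)
    (hf : ContinuousOn f Dom) (hb : ∀ x ∈ Dom, |f x| ≤ C * weight (-1 - r) x) {x : ℝ}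
    (hx : x ∈ Dom) :
    Real.exp (-expo A x) ≤ Real.exp Λ * weight (-r) x ∧
    |Real.exp (-expo A x) * ∫ s in (0 : ℝ)..x, Real.exp (expo A s) * f s| ≤
      C * (Real.exp Λ / η) * weight (-r) x := by
  rcases le_total 0 x with h0 | h0
  · exact h.bounds_of_nonneg hf hb ⟨h0, hx.2⟩
  · have h1 := h.neg.bounds_of_nonneg (f := fun s => f (-s)) (C := C)
      (hf.comp continuousOn_neg fun _ hx => neg_mem_Dom hx)
      (fun y hy => by simpa [weight_neg] using hb (-y) (neg_mem_Dom hy))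
      (x := -x) ⟨by linarith, by linarith [hx.1]⟩
    simp only [expo_neg, neg_neg, weight_neg] at h1
    have h2 := intervalIntegral.integral_comp_neg (a := 0) (b := -x)
      (fun s => Real.exp (expo A s) * f s)
    simp only [neg_zero, neg_neg] at h2
    rw [h2, intervalIntegral.integral_symm, mul_neg, abs_neg] at h1
    exact h1

theorem Grows.exp_neg_le {A : ℝ → ℝ} {r η Λ : ℝ} (h : Grows A r η Λ) {x : ℝ}
    (hx : x ∈ Dom) : Real.exp (-expo A x) ≤ Real.exp Λ * weight (-r) x :=
  (h.bounds (f := fun _ => 0) (C := 0) continuousOn_const (by simp) hx).1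

theorem Grows.abs_integral_le {A f : ℝ → ℝ} {r η Λ C : ℝ} (h : Grows A r η Λ)
    (hf : ContinuousOn f Dom) (hb : ∀ x ∈ Dom, |f x| ≤ C * weight (-1 - r) x) {x : ℝ}
    (hx : x ∈ Dom) :
    |Real.exp (-expo A x) * ∫ s in (0 : ℝ)..x, Real.exp (expo A s) * f s| ≤
      C * (Real.exp Λ / η) * weight (-r) x := (h.bounds hf hb hx).2

/-- Integration of a function of order `(1 - x²)^{-1-r}`, `r > 0`. -/
theorem abs_integral_le_weight {f : ℝ → ℝ} {r C : ℝ} (hr : 0 < r) (hf : ContinuousOn f Dom)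
    (hb : ∀ x ∈ Dom, |f x| ≤ C * weight (-1 - r) x) {x : ℝ} (hx : x ∈ Dom) :
    |∫ s in (0 : ℝ)..x, f s| ≤ C * (Real.exp (2 * r) / (2 * r)) * weight (-r) x := by
  -- With A = 0 the integrating factor is 1. The choice η = Λ = 2r works because x + (1 - x²) ≥ 1 on
  -- [0,1).
  have hG : Grows (fun _ => 0) r (2 * r) (2 * r) :=
    ⟨continuousOn_const, by linarith, by linarith, fun x hx => by
      nlinarith [hx.1, hx.2, mul_nonneg (mul_nonneg hr.le hx.1) (sub_nonneg.2 hx.2.le)],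
      fun x hx => by
      nlinarith [hx.1, hx.2,
        mul_nonneg (mul_nonneg hr.le (neg_nonneg.2 hx.2)) (neg_le_iff_add_nonneg'.1 hx.1.le)]⟩
  have h0 : ∀ s, expo (fun _ => 0) s = 0 := fun s => by simp [expo]
  simpa [h0] using hG.abs_integral_le hf hb hx

/-- The two end point conditions that yield `Grows`. -/
theorem exists_grows {A : ℝ → ℝ} (hA : ContinuousOn A Dom) {s t r : ℝ}
    (hs : Tendsto A (𝓝[>] (-1 : ℝ)) (𝓝 s)) (ht : Tendsto A (𝓝[<] (1 : ℝ)) (𝓝 t))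
    {B : ℝ} (hB : ∀ x ∈ Dom, |A x| ≤ B) (hr : 0 < r)
    (hsr : s < 2 * r) (htr : -t < 2 * r) : ∃ η Λ, Grows A r η Λ := by
  have e1 : ∀ᶠ x in 𝓝[<] (1 : ℝ), (t + 2 * r) / 2 < A x + 2 * r * x := by
    have : Tendsto (fun x => A x + 2 * r * x) (𝓝[<] (1 : ℝ)) (𝓝 (t + 2 * r * 1)) :=
      ht.add ((continuous_const.mul continuous_id).tendsto' (1 : ℝ) _ rfl |>.mono_left
        nhdsWithin_le_nhds)
    exact this.eventually (lt_mem_nhds (by linarith))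
  have e2 : ∀ᶠ x in 𝓝[>] (-1 : ℝ), (2 * r - s) / 2 < -A x - 2 * r * x := by
    have : Tendsto (fun x => -A x - 2 * r * x) (𝓝[>] (-1 : ℝ)) (𝓝 (-s - 2 * r * (-1))) :=
      hs.neg.sub ((continuous_const.mul continuous_id).tendsto' (-1 : ℝ) _ rfl |>.mono_left
        nhdsWithin_le_nhds)
    exact this.eventually (lt_mem_nhds (by linarith))
  obtain ⟨x1, hx1, h1⟩ := (mem_nhdsLT_iff_exists_Ioo_subset' (show (0 : ℝ) < 1 by norm_num)).1 e1
  obtain ⟨x2, hx2, h2⟩ := (mem_nhdsGT_iff_exists_Ioo_subset' (show (-1 : ℝ) < 0 by norm_num)).1 e2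
  simp only [mem_Iio, mem_Ioi] at hx1 hx2
  -- For |x| > ρ the limits at the end points give the bounds. For |x| ≤ ρ the choice of Λ below
  -- makes Λ(1-x²) ≥ B + 1, which exceeds |A| by at least 1.
  set ρ := max 0 (max x1 (-x2)) with hρ
  have hρ0 : 0 ≤ ρ := le_max_left _ _
  have hρ1 : ρ < 1 := by simp only [hρ, max_lt_iff]; exact ⟨by norm_num, hx1, by linarith⟩
  have hx1ρ : x1 ≤ ρ := (le_max_left _ _).trans (le_max_right _ _)
  have hx2ρ : -x2 ≤ ρ := (le_max_right _ _).trans (le_max_right _ _)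
  have hB0 : 0 ≤ B := (abs_nonneg _).trans (hB 0 zero_mem_Dom)
  have hd : 0 < 1 - ρ ^ 2 := by nlinarith
  set η := min 1 (min ((t + 2 * r) / 2) ((2 * r - s) / 2)) with hη
  have hη1 : η ≤ 1 := min_le_left _ _
  have hη2 : η ≤ (t + 2 * r) / 2 := (min_le_right _ _).trans (min_le_left _ _)
  have hη3 : η ≤ (2 * r - s) / 2 := (min_le_right _ _).trans (min_le_right _ _)
  have hη0 : 0 < η := by
    simp only [hη, lt_min_iff]; exact ⟨by norm_num, by linarith, by linarith⟩
  have hΛ : 0 ≤ (B + 1) / (1 - ρ ^ 2) := by positivity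
  have hmid : ∀ x : ℝ, x ^ 2 ≤ ρ ^ 2 → B + 1 ≤ (B + 1) / (1 - ρ ^ 2) * (1 - x ^ 2) := by
    intro x hx
    calc B + 1 = (B + 1) / (1 - ρ ^ 2) * (1 - ρ ^ 2) := by field_simp
      _ ≤ _ := by gcongr
  refine ⟨η, (B + 1) / (1 - ρ ^ 2), hA, hη0, hΛ, fun x hx => ?_, fun x hx => ?_⟩
  · rcases le_or_gt x ρ with h | h
    · have := hmid x (by nlinarith [hx.1])
      have hb := abs_le.1 (hB x (Ico_subset_Dom hx))
      nlinarith [hx.1, hb.1, mul_nonneg hr.le hx.1]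
    · have h3 : (t + 2 * r) / 2 < A x + 2 * r * x := h1 ⟨by linarith, hx.2⟩
      have := mul_nonneg hΛ (one_sub_sq_pos (Ico_subset_Dom hx)).le
      linarith
  · have hxD : x ∈ Dom := ⟨hx.1, by linarith [hx.2]⟩
    rcases le_or_gt (-x) ρ with h | h
    · have := hmid x (by nlinarith [hx.2])
      have hb := abs_le.1 (hB x hxD)
      nlinarith [hx.2, hb.2, mul_nonneg hr.le (neg_nonneg.2 hx.2)]
    · have h3 : (2 * r - s) / 2 < -A x - 2 * r * x := h2 ⟨hx.1, by linarith⟩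
      have := mul_nonneg hΛ (one_sub_sq_pos hxD).le
      linarith

/-! ### Bounded derivatives on the middle interval -/

theorem contDiffOn_succ_of_hasDerivAt {s : Set ℝ} (hs : IsOpen s) {f f' : ℝ → ℝ} {k : ℕ}
    (h : ∀ x ∈ s, HasDerivAt f (f' x) x) (hf' : ContDiffOn ℝ k f' s) :
    ContDiffOn ℝ (k + 1) f s := by
  rw [contDiffOn_succ_iff_deriv_of_isOpen hs]
  exact ⟨fun x hx => (h x hx).differentiableAt.differentiableWithinAt, by simp,
    hf'.congr fun x hx => (h x hx).deriv⟩

theorem contDiffOn_one_of_hasDerivAt {s : Set ℝ} (hs : IsOpen s) {f f' : ℝ → ℝ}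
    (h : ∀ x ∈ s, HasDerivAt f (f' x) x) (hf' : ContinuousOn f' s) : ContDiffOn ℝ 1 f s := by
  simpa using contDiffOn_succ_of_hasDerivAt (k := 0) hs h (contDiffOn_zero.2 hf')

theorem contDiffOn_two_of_hasDerivAt {s : Set ℝ} (hs : IsOpen s) {f f' f'' : ℝ → ℝ}
    (h : ∀ x ∈ s, HasDerivAt f (f' x) x) (h' : ∀ x ∈ s, HasDerivAt f' (f'' x) x)
    (hf' : ContinuousOn f'' s) : ContDiffOn ℝ 2 f s := by
  have := contDiffOn_succ_of_hasDerivAt (k := 1) hs h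
    (by simpa using contDiffOn_one_of_hasDerivAt hs h' hf')
  exact this.of_le (by norm_num)

theorem iteratedDeriv_succ_eqOn {s : Set ℝ} (hs : IsOpen s) {f g g' : ℝ → ℝ} {k : ℕ}
    (h : ∀ x ∈ s, iteratedDeriv k f x = g x) (hg : ∀ x ∈ s, HasDerivAt g (g' x) x) :
    ∀ x ∈ s, iteratedDeriv (k + 1) f x = g' x := by
  intro x hx
  rw [iteratedDeriv_succ, ← (hg x hx).deriv]
  exact Filter.EventuallyEq.deriv_eq (eventuallyEq_of_mem (hs.mem_nhds hx) h)

theorem iteratedDeriv_congr_on {s : Set ℝ} (hs : IsOpen s) {f g : ℝ → ℝ} (h : EqOn f g s)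
    (k : ℕ) : EqOn (iteratedDeriv k f) (iteratedDeriv k g) s := by
  induction k with
  | zero => simpa using h
  | succ k ih =>
    intro x hx
    rw [iteratedDeriv_succ, iteratedDeriv_succ]
    exact Filter.EventuallyEq.deriv_eq (eventuallyEq_of_mem (hs.mem_nhds hx) ih)

theorem deriv_congr_on {s : Set ℝ} (hs : IsOpen s) {f g : ℝ → ℝ} (h : EqOn f g s) :
    EqOn (deriv f) (deriv g) s := fun _ hx =>
  Filter.EventuallyEq.deriv_eq (eventuallyEq_of_mem (hs.mem_nhds hx) h)

theorem hasDerivAt_congr_on {s : Set ℝ} (hs : IsOpen s) {f g : ℝ → ℝ} (h : EqOn f g s) {x f' : ℝ}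
    (hx : x ∈ s) (hf : HasDerivAt f f' x) : HasDerivAt g f' x :=
  hf.congr_of_eventuallyEq (eventuallyEq_of_mem (hs.mem_nhds hx) h.symm)

theorem hasDerivAt_of_contDiffOn {s : Set ℝ} (hs : IsOpen s) {f : ℝ → ℝ} {n : WithTop ℕ∞}
    (hf : ContDiffOn ℝ n f s) (hn : n ≠ 0) {x : ℝ} (hx : x ∈ s) : HasDerivAt f (deriv f x) x :=
  ((hf.contDiffAt (hs.mem_nhds hx)).differentiableAt hn).hasDerivAt

theorem hasDerivAt_iteratedDeriv {s : Set ℝ} (hs : IsOpen s) {f : ℝ → ℝ} {k : ℕ}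
    (hf : ContDiffOn ℝ (k + 1 : ℕ) f s) {x : ℝ} (hx : x ∈ s) :
    HasDerivAt (iteratedDeriv k f) (iteratedDeriv (k + 1) f x) x := by
  rw [iteratedDeriv_succ]
  have h := hf.differentiableOn_iteratedDerivWithin (m := k)
    (by exact_mod_cast Nat.lt_succ_self k) hs.uniqueDiffOn
  exact ((h.congr fun x hx => (iteratedDerivWithin_of_isOpen hs hx).symm).differentiableAt
    (hs.mem_nhds hx)).hasDerivAt

/-- `f` is `C^k` on `(-1/2,1/2)` and its derivatives up to the order `k` are bounded by `C`. -/
def BC : ℕ → (ℝ → ℝ) → ℝ → Prop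
  | 0, f, C => (∀ x ∈ Mid, |f x| ≤ C) ∧ ContinuousOn f Mid
  | k + 1, f, C => (∀ x ∈ Mid, |f x| ≤ C) ∧ DifferentiableOn ℝ f Mid ∧ BC k (deriv f) C

namespace BC

variable {k : ℕ} {f g : ℝ → ℝ} {C D : ℝ}

theorem abs_le (h : BC k f C) : ∀ x ∈ Mid, |f x| ≤ C := by
  cases k <;> exact h.1

theorem nonneg (h : BC k f C) : 0 ≤ C := (abs_nonneg _).trans (h.abs_le 0 zero_mem_Mid)

theorem hasDerivAt (h : BC (k + 1) f C) {x : ℝ} (hx : x ∈ Mid) : HasDerivAt f (deriv f x) x :=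
  ((h.2.1 x hx).differentiableAt (isOpen_Ioo.mem_nhds hx)).hasDerivAt

theorem congr (h : BC k f C) (hfg : EqOn f g Mid) : BC k g C := by
  induction k generalizing f g with
  | zero => exact ⟨fun x hx => hfg hx ▸ h.1 x hx, h.2.congr hfg.symm⟩
  | succ k ih =>
    exact ⟨fun x hx => hfg hx ▸ h.1 x hx, h.2.1.congr fun x hx => (hfg hx).symm,
      ih h.2.2 (deriv_congr_on isOpen_Ioo hfg)⟩

theorem mono (h : BC k f C) (hCD : C ≤ D) : BC k f D := by
  induction k generalizing f with
  | zero => exact ⟨fun x hx => (h.1 x hx).trans hCD, h.2⟩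
  | succ k ih => exact ⟨fun x hx => (h.1 x hx).trans hCD, h.2.1, ih h.2.2⟩

theorem pred (h : BC (k + 1) f C) : BC k f C := by
  induction k generalizing f with
  | zero => exact ⟨h.1, h.2.1.continuousOn⟩
  | succ k ih => exact ⟨h.1, h.2.1, ih h.2.2⟩

theorem of_hasDerivAt (h0 : ∀ x ∈ Mid, |f x| ≤ C) (h : ∀ x ∈ Mid, HasDerivAt f (g x) x)
    (hg : BC k g C) : BC (k + 1) f C :=
  ⟨h0, fun x hx => (h x hx).differentiableAt.differentiableWithinAt,
    hg.congr fun x hx => (h x hx).deriv.symm⟩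

theorem add (hf : BC k f C) (hg : BC k g D) : BC k (fun x => f x + g x) (C + D) := by
  induction k generalizing f g with
  | zero =>
    exact ⟨fun x hx => (abs_add_le _ _).trans (add_le_add (hf.1 x hx) (hg.1 x hx)), hf.2.add hg.2⟩
  | succ k ih =>
    exact of_hasDerivAt
      (fun x hx => (abs_add_le _ _).trans (add_le_add (hf.1 x hx) (hg.1 x hx)))
      (fun x hx => (hf.hasDerivAt hx).add (hg.hasDerivAt hx)) (ih hf.2.2 hg.2.2)

theorem neg (hf : BC k f C) : BC k (fun x => -f x) C := by
  induction k generalizing f with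
  | zero => exact ⟨fun x hx => by rw [abs_neg]; exact hf.1 x hx, hf.2.neg⟩
  | succ k ih =>
    exact of_hasDerivAt (fun x hx => by rw [abs_neg]; exact hf.1 x hx)
      (fun x hx => (hf.hasDerivAt hx).neg) (ih hf.2.2)

theorem sub (hf : BC k f C) (hg : BC k g D) : BC k (fun x => f x - g x) (C + D) := by
  simpa only [sub_eq_add_neg] using hf.add hg.neg

/-- By the Leibniz rule each differentiation turns a product into a sum of two products, hence the
factor 2 for each order. -/
theorem mul (hf : BC k f C) (hg : BC k g D) : BC k (fun x => f x * g x) (2 ^ k * (C * D)) := by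
  induction k generalizing f g with
  | zero =>
    refine ⟨fun x hx => ?_, hf.2.mul hg.2⟩
    rw [abs_mul, pow_zero, one_mul]
    exact mul_le_mul (hf.1 x hx) (hg.1 x hx) (abs_nonneg _) hf.nonneg
  | succ k ih =>
    have hC := hf.nonneg
    have hD := hg.nonneg
    refine of_hasDerivAt (g := fun x => deriv f x * g x + f x * deriv g x) (fun x hx => ?_)
      (fun x hx => (hf.hasDerivAt hx).mul (hg.hasDerivAt hx)) ?_
    · rw [abs_mul]
      calc |f x| * |g x| ≤ C * D := mul_le_mul (hf.1 x hx) (hg.1 x hx) (abs_nonneg _) hC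
        _ = 1 * (C * D) := (one_mul _).symm
        _ ≤ 2 ^ (k + 1) * (C * D) := by gcongr; exact one_le_pow₀ (by norm_num)
    · exact ((ih hf.2.2 hg.pred).add (ih hf.pred hg.2.2)).mono (by rw [pow_succ]; linarith)

theorem contDiffOn (h : BC k f C) : ContDiffOn ℝ k f Mid := by
  induction k generalizing f with
  | zero => simpa using h.2
  | succ k ih =>
    exact (contDiffOn_succ_of_hasDerivAt isOpen_Ioo (fun x hx => h.hasDerivAt hx)
      (ih h.2.2)).of_le (by norm_num)

theorem abs_iteratedDeriv_le (h : BC k f C) {j : ℕ} (hj : j ≤ k) :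
    ∀ x ∈ Mid, |iteratedDeriv j f x| ≤ C := by
  induction k generalizing f j with
  | zero => obtain rfl : j = 0 := by omega
            simpa using h.1
  | succ k ih =>
    cases j with
    | zero => simpa using h.1
    | succ j =>
      intro x hx
      rw [iteratedDeriv_succ']
      exact ih h.2.2 (by omega) x hx

theorem of_contDiffOn (h : ContDiffOn ℝ k f Mid)
    (hb : ∀ j ≤ k, ∀ x ∈ Mid, |iteratedDeriv j f x| ≤ C) : BC k f C := by
  induction k generalizing f with
  | zero => exact ⟨by simpa using hb 0 le_rfl, h.continuousOn⟩
  | succ k ih =>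
    have h' := (contDiffOn_succ_iff_deriv_of_isOpen (n := k) isOpen_Ioo).1 (h.of_le (by norm_num))
    refine ⟨by simpa using hb 0 (by omega), h'.1, ih h'.2.2 fun j hj x hx => ?_⟩
    rw [← iteratedDeriv_succ']
    exact hb (j + 1) (by omega) x hx

/-- The closure of `Mid` is a compact subset of `Dom`, so continuity of the derivatives on `Dom`
bounds them on `Mid`. -/
theorem exists_of_contDiffOn (h : ContDiffOn ℝ k f Dom) : ∃ C, BC k f C := by
  have key : ∀ f : ℝ → ℝ, ContinuousOn f Dom → ∃ C, ∀ x ∈ Mid, |f x| ≤ C := by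
    intro f hf
    obtain ⟨C, hC⟩ := (isCompact_Icc (a := (-1 / 2 : ℝ)) (b := 1 / 2)).exists_bound_of_continuousOn
      (hf.mono fun x hx => ⟨by linarith [hx.1], by linarith [hx.2]⟩)
    exact ⟨C, fun x hx => hC x (Ioo_subset_Icc_self hx)⟩
  induction k generalizing f with
  | zero =>
    obtain ⟨C, hC⟩ := key f h.continuousOn
    exact ⟨C, hC, h.continuousOn.mono Mid_subset_Dom⟩
  | succ k ih =>
    have h' := (contDiffOn_succ_iff_deriv_of_isOpen (n := k) isOpen_Ioo).1 (h.of_le (by norm_num))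
    obtain ⟨C, hC⟩ := key f h.continuousOn
    obtain ⟨D, hD⟩ := ih h'.2.2
    exact ⟨max C D, fun x hx => (hC x hx).trans (le_max_left _ _), h'.1.mono Mid_subset_Dom,
      hD.mono (le_max_right _ _)⟩

end BC

/-! ### Elements of the weighted spaces -/

/-- Sufficient conditions for a function on `(-1,1)` to define an element of `M₁`. -/
structure M1Data (ε : ℝ) (f : ℝ → ℝ) (C : ℝ) : Prop where
  contDiffOn : ContDiffOn ℝ 1 f Dom
  bound : ∀ x ∈ Dom, |f x| ≤ C * weight (1 - 2 * ε) x
  bound_deriv : ∀ x ∈ Dom, |deriv f x| ≤ C * weight (-(2 * ε)) x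
  mid : BC 3 f C

/-- Sufficient conditions for a function on `(-1,1)` to define an element of `M₂`. -/
structure M2Data (ε : ℝ) (f : ℝ → ℝ) (C : ℝ) : Prop where
  contDiffOn : ContDiffOn ℝ 2 f Dom
  bound : ∀ x ∈ Dom, |f x| ≤ C * weight (-ε) x
  bound_deriv : ∀ x ∈ Dom, |deriv f x| ≤ C * weight (-(1 + ε)) x
  bound_deriv2 : ∀ x ∈ Dom, |iteratedDeriv 2 f x| ≤ C * weight (-(2 + ε)) x

theorem eqOn_indicator_Dom (f : ℝ → ℝ) : EqOn (Dom.indicator f) f Dom := fun _ hx =>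
  indicator_of_mem hx f

/-- At ±1 the function is squeezed by |C|(1-x²)^r, which is continuous and vanishes there because r
> 0. -/
theorem continuousOn_Icc_of_weight {f : ℝ → ℝ} (h0 : ∀ x ∉ Dom, f x = 0)
    (hf : ContinuousOn f Dom) {r C : ℝ} (hr : 0 < r)
    (hb : ∀ x ∈ Dom, |f x| ≤ C * weight r x) : ContinuousOn f (Icc (-1) 1) := by
  have hb' : ∀ x ∈ Icc (-1 : ℝ) 1, |f x| ≤ |C| * weight r x := by
    intro x hx
    by_cases hD : x ∈ Dom
    · exact (hb x hD).trans (by gcongr; exacts [(weight_pos r hD).le, le_abs_self C])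
    · rw [h0 x hD, abs_zero]
      exact mul_nonneg (abs_nonneg _) (Real.rpow_nonneg (by nlinarith [hx.1, hx.2]) r)
  intro x hx
  by_cases hD : x ∈ Dom
  · exact (hf.continuousAt (isOpen_Ioo.mem_nhds hD)).continuousWithinAt
  · have hx1 : 1 - x ^ 2 = 0 := by
      have : x = -1 ∨ x = 1 := by
        by_contra h
        push Not at h
        exact hD ⟨lt_of_le_of_ne hx.1 (Ne.symm h.1), lt_of_le_of_ne hx.2 h.2⟩
      rcases this with rfl | rfl <;> norm_num
    have hc : ContinuousAt (fun x => |C| * weight r x) x := by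
      refine continuousAt_const.mul ?_
      exact ContinuousAt.rpow_const (by fun_prop) (Or.inr hr.le)
    have h2 : Tendsto (fun x => |C| * weight r x) (𝓝[Icc (-1) 1] x) (𝓝 0) := by
      have := hc.tendsto.mono_left (nhdsWithin_le_nhds (s := Icc (-1 : ℝ) 1))
      simpa [weight, hx1, Real.zero_rpow hr.ne'] using this
    rw [ContinuousWithinAt, h0 x hD]
    exact squeeze_zero_norm' (eventually_nhdsWithin_of_forall hb') h2

theorem wSup_le {s : Set ℝ} {w f : ℝ → ℝ} {k : ℕ} {C : ℝ} (hC : 0 ≤ C)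
    (h : ∀ x ∈ s, |w x * iteratedDeriv k f x| ≤ C) : wSup s w k f ≤ C :=
  Real.iSup_le (fun x => h x x.2) hC

namespace M1

variable {ε : ℝ}

theorem norm_eq (u : M1 ε) : ‖u‖ = wSup Dom (weight (-1 + 2 * ε)) 0 u.fn +
    wSup Dom (weight (2 * ε)) 1 u.fn + wSup Mid 1 2 u.fn + wSup Mid 1 3 u.fn := rfl

theorem data_bounds {f : ℝ → ℝ} {C : ℝ} (h : M1Data ε f C) :
    (∀ x ∈ Dom, |weight (-1 + 2 * ε) x * iteratedDeriv 0 (Dom.indicator f) x| ≤ C) ∧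
    (∀ x ∈ Dom, |weight (2 * ε) x * iteratedDeriv 1 (Dom.indicator f) x| ≤ C) ∧
    (∀ x ∈ Mid, |(1 : ℝ → ℝ) x * iteratedDeriv 2 (Dom.indicator f) x| ≤ C) ∧
    (∀ x ∈ Mid, |(1 : ℝ → ℝ) x * iteratedDeriv 3 (Dom.indicator f) x| ≤ C) := by
  have e := fun k => iteratedDeriv_congr_on isOpen_Ioo (eqOn_indicator_Dom f) k
  refine ⟨fun x hx => ?_, fun x hx => ?_, fun x hx => ?_, fun x hx => ?_⟩
  · rw [abs_weight_mul_le_iff hx, e 0 hx, iteratedDeriv_zero]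
    convert h.bound x hx using 3
    ring
  · rw [abs_weight_mul_le_iff hx, e 1 hx, iteratedDeriv_one]
    exact h.bound_deriv x hx
  · rw [e 2 (Mid_subset_Dom hx), Pi.one_apply, one_mul]
    exact h.mid.abs_iteratedDeriv_le (by norm_num) x hx
  · rw [e 3 (Mid_subset_Dom hx), Pi.one_apply, one_mul]
    exact h.mid.abs_iteratedDeriv_le le_rfl x hx

theorem data_mem (hε : ε < 1 / 2) {f : ℝ → ℝ} {C : ℝ} (h : M1Data ε f C) :
    Dom.indicator f ∈ M1Sub ε := by
  obtain ⟨h0, h1, h2, h3⟩ := data_bounds h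
  have e := eqOn_indicator_Dom f
  have hz : ∀ x ∉ Dom, Dom.indicator f x = 0 := fun x hx => indicator_of_notMem hx f
  refine ⟨hz, ?_, h.contDiffOn.congr e, ?_, ⟨C, h0⟩, ⟨C, h1⟩, ⟨C, h2⟩, ⟨C, h3⟩⟩
  · exact (h.mid.contDiffOn).congr fun x hx => e (Mid_subset_Dom hx)
  · refine continuousOn_Icc_of_weight hz (h.contDiffOn.continuousOn.congr e)
      (r := 1 - 2 * ε) (C := C) (by linarith) fun x hx => ?_
    rw [e hx]
    exact h.bound x hx

/-- The element of `M₁` with given values on `(-1,1)`. -/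
noncomputable def mk (hε : ε < 1 / 2) {f : ℝ → ℝ} {C : ℝ} (h : M1Data ε f C) : M1 ε :=
  ⟨Dom.indicator f, data_mem hε h⟩

theorem mk_fn (hε : ε < 1 / 2) {f : ℝ → ℝ} {C : ℝ} (h : M1Data ε f C) :
    EqOn (mk hε h).fn f Dom := eqOn_indicator_Dom f

theorem norm_mk_le (hε : ε < 1 / 2) {f : ℝ → ℝ} {C : ℝ} (h : M1Data ε f C) :
    ‖mk hε h‖ ≤ 4 * C := by
  obtain ⟨h0, h1, h2, h3⟩ := data_bounds h
  have hC := h.mid.nonneg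
  rw [norm_eq]
  have := wSup_le hC h0
  have := wSup_le hC h1
  have := wSup_le hC h2
  have := wSup_le hC h3
  change wSup Dom _ 0 (Dom.indicator f) + wSup Dom _ 1 (Dom.indicator f) +
    wSup Mid _ 2 (Dom.indicator f) + wSup Mid _ 3 (Dom.indicator f) ≤ _
  linarith

theorem bounds (u : M1 ε) :
    (∀ x ∈ Dom, |weight (-1 + 2 * ε) x * iteratedDeriv 0 u.fn x| ≤ ‖u‖) ∧
    (∀ x ∈ Dom, |weight (2 * ε) x * iteratedDeriv 1 u.fn x| ≤ ‖u‖) ∧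
    (∀ x ∈ Mid, |(1 : ℝ → ℝ) x * iteratedDeriv 2 u.fn x| ≤ ‖u‖) ∧
    (∀ x ∈ Mid, |(1 : ℝ → ℝ) x * iteratedDeriv 3 u.fn x| ≤ ‖u‖) := by
  obtain ⟨f0, f3, f1, fc, b0, b1, b2, b3⟩ := u.mem
  rw [norm_eq]
  have n0 : 0 ≤ wSup Dom (weight (-1 + 2 * ε)) 0 u.fn := wSup_nonneg
  have n1 : 0 ≤ wSup Dom (weight (2 * ε)) 1 u.fn := wSup_nonneg
  have n2 : 0 ≤ wSup Mid 1 2 u.fn := wSup_nonneg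
  have n3 : 0 ≤ wSup Mid 1 3 u.fn := wSup_nonneg
  exact ⟨fun x hx => (le_wSup b0 hx).trans (by linarith),
    fun x hx => (le_wSup b1 hx).trans (by linarith),
    fun x hx => (le_wSup (s := Mid) b2 hx).trans (by linarith),
    fun x hx => (le_wSup (s := Mid) b3 hx).trans (by linarith)⟩

theorem contDiffOn (u : M1 ε) : ContDiffOn ℝ 1 u.fn Dom := u.mem.2.2.1

theorem hasDerivAt (u : M1 ε) {x : ℝ} (hx : x ∈ Dom) : HasDerivAt u.fn (deriv u.fn x) x :=
  hasDerivAt_of_contDiffOn isOpen_Ioo u.contDiffOn (by norm_num) hx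

theorem continuousOn (u : M1 ε) : ContinuousOn u.fn Dom := u.contDiffOn.continuousOn

theorem abs_le (u : M1 ε) {x : ℝ} (hx : x ∈ Dom) : |u.fn x| ≤ ‖u‖ * weight (1 - 2 * ε) x := by
  have := u.bounds.1 x hx
  rwa [abs_weight_mul_le_iff hx, iteratedDeriv_zero,
    show -(-1 + 2 * ε) = 1 - 2 * ε by ring] at this

theorem abs_deriv_le (u : M1 ε) {x : ℝ} (hx : x ∈ Dom) :
    |deriv u.fn x| ≤ ‖u‖ * weight (-(2 * ε)) x := by
  have := u.bounds.2.1 x hx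
  rwa [abs_weight_mul_le_iff hx, iteratedDeriv_one] at this

theorem fn_sub (u v : M1 ε) : (u - v).fn = u.fn - v.fn := rfl

theorem ext_on {u v : M1 ε} (h : EqOn u.fn v.fn Dom) : u = v := by
  refine M1.ext (funext fun x => ?_)
  by_cases hx : x ∈ Dom
  · exact h hx
  · rw [u.mem.1 x hx, v.mem.1 x hx]

/-- The norm controls the orders 2 and 3 on `Mid` directly and the orders 0 and 1 through the
weights. The factor 2 comes from (1-x²)^{-2ε} ≤ (1-x²)^{-1} ≤ 2 on `Mid`. -/
theorem mid (h0 : 0 < ε) (h : ε < 1 / 2) (u : M1 ε) : BC 3 u.fn (2 * ‖u‖) := by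
  refine BC.of_contDiffOn (u.mem.2.1.of_le (by norm_num)) fun j hj x hx => ?_
  have hn := norm_nonneg u
  have hD := Mid_subset_Dom hx
  interval_cases j
  · rw [iteratedDeriv_zero]
    refine (u.abs_le hD).trans ?_
    have := weight_le_one (r := 1 - 2 * ε) (by linarith) hD
    nlinarith
  · rw [iteratedDeriv_one]
    refine (u.abs_deriv_le hD).trans ?_
    have h1 : weight (-(2 * ε)) x ≤ weight (-1) x := weight_le_weight (by linarith) hD
    have h2 : weight (-1) x ≤ 2 := by
      have h3 : (1 : ℝ) / 2 ≤ 1 - x ^ 2 := by nlinarith [hx.1, hx.2]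
      rw [weight, Real.rpow_neg_one]
      exact (inv_anti₀ (by norm_num) h3).trans (by norm_num)
    nlinarith
  · have := u.bounds.2.2.1 x hx
    rw [Pi.one_apply, one_mul] at this
    linarith
  · have := u.bounds.2.2.2 x hx
    rw [Pi.one_apply, one_mul] at this
    linarith

end M1

namespace M2

variable {ε : ℝ}

theorem norm_eq (u : M2 ε) : ‖u‖ = wSup Dom (weight ε) 0 u.fn +
    wSup Dom (weight (1 + ε)) 1 u.fn + wSup Dom (weight (2 + ε)) 2 u.fn := rfl

theorem data_bounds {f : ℝ → ℝ} {C : ℝ} (h : M2Data ε f C) :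
    (∀ x ∈ Dom, |weight ε x * iteratedDeriv 0 (Dom.indicator f) x| ≤ C) ∧
    (∀ x ∈ Dom, |weight (1 + ε) x * iteratedDeriv 1 (Dom.indicator f) x| ≤ C) ∧
    (∀ x ∈ Dom, |weight (2 + ε) x * iteratedDeriv 2 (Dom.indicator f) x| ≤ C) := by
  have e := fun k => iteratedDeriv_congr_on isOpen_Ioo (eqOn_indicator_Dom f) k
  refine ⟨fun x hx => ?_, fun x hx => ?_, fun x hx => ?_⟩
  · rw [abs_weight_mul_le_iff hx, e 0 hx, iteratedDeriv_zero]
    exact h.bound x hx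
  · rw [abs_weight_mul_le_iff hx, e 1 hx, iteratedDeriv_one]
    exact h.bound_deriv x hx
  · rw [abs_weight_mul_le_iff hx, e 2 hx]
    exact h.bound_deriv2 x hx

theorem data_mem {f : ℝ → ℝ} {C : ℝ} (h : M2Data ε f C) : Dom.indicator f ∈ M2Sub ε := by
  obtain ⟨h0, h1, h2⟩ := data_bounds h
  exact ⟨fun x hx => indicator_of_notMem hx f, h.contDiffOn.congr (eqOn_indicator_Dom f),
    ⟨C, h0⟩, ⟨C, h1⟩, ⟨C, h2⟩⟩

/-- The element of `M₂` with given values on `(-1,1)`. -/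
noncomputable def mk {f : ℝ → ℝ} {C : ℝ} (h : M2Data ε f C) : M2 ε := ⟨Dom.indicator f, data_mem h⟩

theorem mk_fn {f : ℝ → ℝ} {C : ℝ} (h : M2Data ε f C) : EqOn (mk h).fn f Dom :=
  eqOn_indicator_Dom f

theorem norm_mk_le {f : ℝ → ℝ} {C : ℝ} (h : M2Data ε f C) : ‖mk h‖ ≤ 3 * C := by
  obtain ⟨h0, h1, h2⟩ := data_bounds h
  have hC : 0 ≤ C := (abs_nonneg _).trans (h0 0 zero_mem_Dom)
  rw [norm_eq]
  have := wSup_le hC h0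
  have := wSup_le hC h1
  have := wSup_le hC h2
  change wSup Dom _ 0 (Dom.indicator f) + wSup Dom _ 1 (Dom.indicator f) +
    wSup Dom _ 2 (Dom.indicator f) ≤ _
  linarith

theorem bounds (u : M2 ε) :
    (∀ x ∈ Dom, |weight ε x * iteratedDeriv 0 u.fn x| ≤ ‖u‖) ∧
    (∀ x ∈ Dom, |weight (1 + ε) x * iteratedDeriv 1 u.fn x| ≤ ‖u‖) ∧
    (∀ x ∈ Dom, |weight (2 + ε) x * iteratedDeriv 2 u.fn x| ≤ ‖u‖) := by
  obtain ⟨f0, f2, b0, b1, b2⟩ := u.mem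
  rw [norm_eq]
  have n0 : 0 ≤ wSup Dom (weight ε) 0 u.fn := wSup_nonneg
  have n1 : 0 ≤ wSup Dom (weight (1 + ε)) 1 u.fn := wSup_nonneg
  have n2 : 0 ≤ wSup Dom (weight (2 + ε)) 2 u.fn := wSup_nonneg
  exact ⟨fun x hx => (le_wSup b0 hx).trans (by linarith),
    fun x hx => (le_wSup b1 hx).trans (by linarith),
    fun x hx => (le_wSup b2 hx).trans (by linarith)⟩

theorem contDiffOn (u : M2 ε) : ContDiffOn ℝ 2 u.fn Dom := u.mem.2.1

theorem hasDerivAt (u : M2 ε) {x : ℝ} (hx : x ∈ Dom) : HasDerivAt u.fn (deriv u.fn x) x :=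
  hasDerivAt_of_contDiffOn isOpen_Ioo u.contDiffOn (by norm_num) hx

theorem contDiffOn_deriv (u : M2 ε) : ContDiffOn ℝ 1 (deriv u.fn) Dom :=
  ((contDiffOn_succ_iff_deriv_of_isOpen (n := 1) isOpen_Ioo).1
    (by have := u.contDiffOn; norm_num; exact this)).2.2

theorem continuousOn (u : M2 ε) : ContinuousOn u.fn Dom := u.contDiffOn.continuousOn

theorem continuousOn_deriv (u : M2 ε) : ContinuousOn (deriv u.fn) Dom :=
  u.contDiffOn_deriv.continuousOn

theorem abs_le (u : M2 ε) {x : ℝ} (hx : x ∈ Dom) : |u.fn x| ≤ ‖u‖ * weight (-ε) x := by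
  have := u.bounds.1 x hx
  rwa [abs_weight_mul_le_iff hx] at this

theorem abs_deriv_le (u : M2 ε) {x : ℝ} (hx : x ∈ Dom) :
    |deriv u.fn x| ≤ ‖u‖ * weight (-(1 + ε)) x := by
  have := u.bounds.2.1 x hx
  rwa [abs_weight_mul_le_iff hx, iteratedDeriv_one] at this

theorem fn_sub (u v : M2 ε) : (u - v).fn = u.fn - v.fn := rfl

theorem ext_on {u v : M2 ε} (h : EqOn u.fn v.fn Dom) : u = v := by
  refine M2.ext (funext fun x => ?_)
  by_cases hx : x ∈ Dom
  · exact h hx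
  · rw [u.mem.1 x hx, v.mem.1 x hx]

end M2

/-! ### Completeness -/

/-- A positive continuous weight is bounded below near each point, so smallness in the weighted sup
norm implies locally uniform smallness. -/
theorem exists_limit_of_weighted_cauchy {s : Set ℝ} {w : ℝ → ℝ} (hw : ContinuousOn w s)
    (hw0 : ∀ x ∈ s, 0 < w x) {f : ℕ → ℝ → ℝ} (hf : ∀ n, ContinuousOn (f n) s)
    (h : ∀ e > 0, ∃ N, ∀ n ≥ N, ∀ m ≥ N, ∀ x ∈ s, |w x * (f n x - f m x)| ≤ e) :
    ∃ g : ℝ → ℝ, ContinuousOn g s ∧ TendstoLocallyUniformlyOn f g atTop s ∧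
      ∀ e > 0, ∃ N, ∀ n ≥ N, ∀ x ∈ s, |w x * (f n x - g x)| ≤ e := by
  have hc : ∀ x ∈ s, ∃ a, Tendsto (fun n => f n x) atTop (𝓝 a) := by
    intro x hx
    refine cauchySeq_tendsto_of_complete (Metric.cauchySeq_iff.2 fun e he => ?_)
    obtain ⟨N, hN⟩ := h (w x * e / 2) (by have := hw0 x hx; positivity)
    refine ⟨N, fun m hm n hn => ?_⟩
    have h1 := hN m hm n hn x hx
    have h2 := hw0 x hx
    rw [abs_mul, abs_of_pos h2] at h1
    rw [Real.dist_eq]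
    have : |f m x - f n x| ≤ e / 2 := by
      refine le_of_mul_le_mul_left (h1.trans (le_of_eq (by ring))) h2
    linarith
  choose! g hg using hc
  have hlim : ∀ e > 0, ∃ N, ∀ n ≥ N, ∀ x ∈ s, |w x * (f n x - g x)| ≤ e := by
    intro e he
    obtain ⟨N, hN⟩ := h e he
    refine ⟨N, fun n hn x hx => ?_⟩
    refine le_of_tendsto (((hg x hx).const_sub (f n x)).const_mul (w x)).abs ?_
    filter_upwards [eventually_ge_atTop N] with m hm using hN n hn m hm x hx
  have hu : TendstoLocallyUniformlyOn f g atTop s := by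
    rw [Metric.tendstoLocallyUniformlyOn_iff]
    intro e he x hx
    have h2 := hw0 x hx
    refine ⟨s ∩ {y | w x / 2 < w y}, inter_mem self_mem_nhdsWithin
      ((hw x hx).eventually (lt_mem_nhds (by linarith))), ?_⟩
    obtain ⟨N, hN⟩ := hlim (w x * e / 4) (by positivity)
    filter_upwards [eventually_ge_atTop N] with n hn y hy
    have h1 := hN n hn y hy.1
    have h3 : w x / 2 < w y := hy.2
    rw [abs_mul, abs_of_pos (hw0 y hy.1)] at h1
    rw [dist_comm, Real.dist_eq]
    by_contra hcon
    push Not at hcon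
    nlinarith [mul_le_mul h3.le hcon he.le (hw0 y hy.1).le, mul_pos h2 he]
  exact ⟨g, hu.continuousOn (Frequently.of_forall hf), hu, hlim⟩

theorem abs_le_of_limits {s : Set ℝ} {w g : ℝ → ℝ} (f : ℝ → ℝ) {C : ℝ}
    (h1 : ∀ x ∈ s, |w x * f x| ≤ C) {e : ℝ} (h2 : ∀ x ∈ s, |w x * (f x - g x)| ≤ e) :
    ∀ x ∈ s, |w x * g x| ≤ C + e := by
  intro x hx
  have : w x * g x = w x * f x - w x * (f x - g x) := by ring
  rw [this]
  exact (abs_sub _ _).trans (add_le_add (h1 x hx) (h2 x hx))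

/-- The derivatives of each order converge in their own weighted norm. The convergence is locally
uniform, so the limits are successive derivatives of the first one. That ε < 1/2 gives the limit its
continuous extension by 0 to ±1. -/
instance M1.completeSpace (ε : ℝ) [Fact (0 < ε ∧ ε < 1 / 2)] : CompleteSpace (M1 ε) := by
  have hε := (Fact.out : 0 < ε ∧ ε < 1 / 2)
  refine Metric.complete_of_cauchySeq_tendsto fun u hu => ?_
  have hC : ∀ e > 0, ∃ N, ∀ n ≥ N, ∀ m ≥ N, ‖u n - u m‖ ≤ e := by
    intro e he
    obtain ⟨N, hN⟩ := Metric.cauchySeq_iff.1 hu e he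
    exact ⟨N, fun n hn m hm => by rw [← dist_eq_norm]; exact (hN n hn m hm).le⟩
  have c1 := fun n => (u n).contDiffOn
  have c3 : ∀ n, ContDiffOn ℝ 3 (u n).fn Mid := fun n => (u n).mem.2.1
  have cont : ∀ {s : Set ℝ} (hs : IsOpen s) (k : ℕ) (n : ℕ), ContDiffOn ℝ k (u n).fn s →
      ContinuousOn (iteratedDeriv k (u n).fn) s := fun hs k n h =>
    (h.continuousOn_iteratedDerivWithin le_rfl hs.uniqueDiffOn).congr
      fun x hx => (iteratedDerivWithin_of_isOpen hs hx).symm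
  have key : ∀ {s : Set ℝ} (hs : IsOpen s) (k : ℕ) (w : ℝ → ℝ), ContinuousOn w s →
      (∀ x ∈ s, 0 < w x) → (∀ n, ContDiffOn ℝ k (u n).fn s) →
      (∀ v : M1 ε, ∀ x ∈ s, |w x * iteratedDeriv k v.fn x| ≤ ‖v‖) →
      ∃ g : ℝ → ℝ, ContinuousOn g s ∧
        TendstoLocallyUniformlyOn (fun n => iteratedDeriv k (u n).fn) g atTop s ∧
        ∀ e > 0, ∃ N, ∀ n ≥ N, ∀ x ∈ s, |w x * (iteratedDeriv k (u n).fn x - g x)| ≤ e := by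
    intro s hs k w hw hw0 hk hb
    refine exists_limit_of_weighted_cauchy hw hw0 (fun n => cont hs k n (hk n)) fun e he => ?_
    obtain ⟨N, hN⟩ := hC e he
    refine ⟨N, fun n hn m hm x hx => ?_⟩
    rw [← iteratedDeriv_sub ((hk n).contDiffAt (hs.mem_nhds hx))
      ((hk m).contDiffAt (hs.mem_nhds hx)), ← M1.fn_sub]
    exact (hb _ x hx).trans (hN n hn m hm)
  obtain ⟨g0, k0, t0, l0⟩ := key isOpen_Ioo 0 _ (continuousOn_weight (-1 + 2 * ε))
    (fun x hx => weight_pos _ hx) (fun n => (c1 n).of_le (by norm_num)) (fun v => v.bounds.1)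
  obtain ⟨g1, k1, t1, l1⟩ := key isOpen_Ioo 1 _ (continuousOn_weight (2 * ε))
    (fun x hx => weight_pos _ hx) (fun n => c1 n) (fun v => v.bounds.2.1)
  obtain ⟨g2, k2, t2, l2⟩ := key (s := Mid) isOpen_Ioo 2 1 continuousOn_const
    (fun x hx => one_pos) (fun n => (c3 n).of_le (by norm_num)) (fun v => v.bounds.2.2.1)
  obtain ⟨g3, k3, t3, l3⟩ := key (s := Mid) isOpen_Ioo 3 1 continuousOn_const
    (fun x hx => one_pos) (fun n => c3 n) (fun v => v.bounds.2.2.2)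
  have d0 : ∀ x ∈ Dom, HasDerivAt g0 (g1 x) x := fun x hx =>
    hasDerivAt_of_tendstoLocallyUniformlyOn isOpen_Ioo t1
      (Eventually.of_forall fun n x hx => hasDerivAt_iteratedDeriv isOpen_Ioo (k := 0) (c1 n) hx)
      (fun x hx => t0.tendsto_at hx) hx
  have d1 : ∀ x ∈ Mid, HasDerivAt g1 (g2 x) x := fun x hx =>
    hasDerivAt_of_tendstoLocallyUniformlyOn isOpen_Ioo t2
      (Eventually.of_forall fun n x hx => hasDerivAt_iteratedDeriv isOpen_Ioo (k := 1)
        ((c3 n).of_le (by norm_num)) hx)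
      (fun x hx => t1.tendsto_at (Mid_subset_Dom hx)) hx
  have d2 : ∀ x ∈ Mid, HasDerivAt g2 (g3 x) x := fun x hx =>
    hasDerivAt_of_tendstoLocallyUniformlyOn isOpen_Ioo t3
      (Eventually.of_forall fun n x hx => hasDerivAt_iteratedDeriv isOpen_Ioo (k := 2) (c3 n) hx)
      (fun x hx => t2.tendsto_at hx) hx
  have i1 : ∀ x ∈ Dom, deriv g0 x = g1 x := fun x hx => (d0 x hx).deriv
  have i2 : ∀ x ∈ Mid, iteratedDeriv 2 g0 x = g2 x := iteratedDeriv_succ_eqOn isOpen_Ioo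
    (fun x hx => by rw [iteratedDeriv_one]; exact i1 x (Mid_subset_Dom hx)) d1
  have i3 : ∀ x ∈ Mid, iteratedDeriv 3 g0 x = g3 x := iteratedDeriv_succ_eqOn isOpen_Ioo i2 d2
  obtain ⟨N0, hN0⟩ := l0 1 one_pos
  obtain ⟨N1, hN1⟩ := l1 1 one_pos
  obtain ⟨N2, hN2⟩ := l2 1 one_pos
  obtain ⟨N3, hN3⟩ := l3 1 one_pos
  have B0 := abs_le_of_limits _ (u N0).bounds.1 (hN0 N0 le_rfl)
  have B1 := abs_le_of_limits _ (u N1).bounds.2.1 (hN1 N1 le_rfl)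
  have B2 := abs_le_of_limits _ (u N2).bounds.2.2.1 (hN2 N2 le_rfl)
  have B3 := abs_le_of_limits _ (u N3).bounds.2.2.2 (hN3 N3 le_rfl)
  have e := eqOn_indicator_Dom g0
  have E : ∀ k, EqOn (iteratedDeriv k (Dom.indicator g0)) (iteratedDeriv k g0) Dom :=
    fun k => iteratedDeriv_congr_on isOpen_Ioo e k
  have E0 : ∀ x ∈ Dom, iteratedDeriv 0 (Dom.indicator g0) x = g0 x := fun x hx => by
    rw [E 0 hx, iteratedDeriv_zero]
  have E1 : ∀ x ∈ Dom, iteratedDeriv 1 (Dom.indicator g0) x = g1 x := fun x hx => by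
    rw [E 1 hx, iteratedDeriv_one, i1 x hx]
  have E2 : ∀ x ∈ Mid, iteratedDeriv 2 (Dom.indicator g0) x = g2 x := fun x hx => by
    rw [E 2 (Mid_subset_Dom hx), i2 x hx]
  have E3 : ∀ x ∈ Mid, iteratedDeriv 3 (Dom.indicator g0) x = g3 x := fun x hx => by
    rw [E 3 (Mid_subset_Dom hx), i3 x hx]
  have hz : ∀ x ∉ Dom, Dom.indicator g0 x = 0 := fun x hx => indicator_of_notMem hx g0
  have C3 : ContDiffOn ℝ 3 g0 Mid := by
    have h2 := contDiffOn_two_of_hasDerivAt isOpen_Ioo d1 d2 k3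
    have := contDiffOn_succ_of_hasDerivAt (k := 2) isOpen_Ioo
      (fun x hx => d0 x (Mid_subset_Dom hx)) (h2.of_le (by norm_num))
    exact this.of_le (by norm_num)
  have C1 : ContDiffOn ℝ 1 g0 Dom := contDiffOn_one_of_hasDerivAt isOpen_Ioo d0 k1
  have hmem : Dom.indicator g0 ∈ M1Sub ε := by
    refine ⟨hz, C3.congr fun x hx => e (Mid_subset_Dom hx), C1.congr e, ?_,
      ⟨_, fun x hx => by rw [E0 x hx]; exact B0 x hx⟩,
      ⟨_, fun x hx => by rw [E1 x hx]; exact B1 x hx⟩,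
      ⟨_, fun x hx => by rw [E2 x hx]; exact B2 x hx⟩,
      ⟨_, fun x hx => by rw [E3 x hx]; exact B3 x hx⟩⟩
    refine continuousOn_Icc_of_weight hz (k0.congr e) (r := -(-1 + 2 * ε))
      (C := ‖u N0‖ + 1) (by linarith [hε.2])
      fun x hx => ?_
    rw [e hx, ← abs_weight_mul_le_iff hx]
    exact B0 x hx
  let v : M1 ε := ⟨Dom.indicator g0, hmem⟩
  have hv : v.fn = Dom.indicator g0 := rfl
  refine ⟨v, Metric.tendsto_atTop.2 fun e' he => ?_⟩
  obtain ⟨N0, hN0⟩ := l0 (e' / 8) (by positivity)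
  obtain ⟨N1, hN1⟩ := l1 (e' / 8) (by positivity)
  obtain ⟨N2, hN2⟩ := l2 (e' / 8) (by positivity)
  obtain ⟨N3, hN3⟩ := l3 (e' / 8) (by positivity)
  refine ⟨max (max N0 N1) (max N2 N3), fun n hn => ?_⟩
  simp only [ge_iff_le, max_le_iff] at hn
  have he8 : 0 ≤ e' / 8 := by positivity
  have sub : ∀ {s : Set ℝ} (hs : IsOpen s) (k : ℕ), (∀ u : M1 ε, ContDiffOn ℝ k u.fn s) →
      ∀ x ∈ s, iteratedDeriv k (u n - v).fn x =
        iteratedDeriv k (u n).fn x - iteratedDeriv k (Dom.indicator g0) x := by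
    intro s hs k h x hx
    rw [M1.fn_sub, iteratedDeriv_sub ((h _).contDiffAt (hs.mem_nhds hx))
      ((h _).contDiffAt (hs.mem_nhds hx)), hv]
  rw [dist_eq_norm, M1.norm_eq]
  have s0 : wSup Dom (weight (-1 + 2 * ε)) 0 (u n - v).fn ≤ e' / 8 := wSup_le he8 fun x hx => by
    rw [sub isOpen_Ioo 0 (fun u => u.contDiffOn.of_le (by norm_num)) x hx, E0 x hx]
    exact hN0 n hn.1.1 x hx
  have s1 : wSup Dom (weight (2 * ε)) 1 (u n - v).fn ≤ e' / 8 := wSup_le he8 fun x hx => by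
    rw [sub isOpen_Ioo 1 (fun u => u.contDiffOn) x hx, E1 x hx]
    exact hN1 n hn.1.2 x hx
  have s2 : wSup Mid 1 2 (u n - v).fn ≤ e' / 8 := wSup_le he8 fun x hx => by
    rw [sub (s := Mid) isOpen_Ioo 2 (fun u => u.mem.2.1.of_le (by norm_num)) x hx, E2 x hx]
    exact hN2 n hn.2.1 x hx
  have s3 : wSup Mid 1 3 (u n - v).fn ≤ e' / 8 := wSup_le he8 fun x hx => by
    rw [sub (s := Mid) isOpen_Ioo 3 (fun u => u.mem.2.1) x hx, E3 x hx]
    exact hN3 n hn.2.2 x hx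
  linarith

instance M2.completeSpace (ε : ℝ) : CompleteSpace (M2 ε) := by
  refine Metric.complete_of_cauchySeq_tendsto fun u hu => ?_
  have hC : ∀ e > 0, ∃ N, ∀ n ≥ N, ∀ m ≥ N, ‖u n - u m‖ ≤ e := by
    intro e he
    obtain ⟨N, hN⟩ := Metric.cauchySeq_iff.1 hu e he
    exact ⟨N, fun n hn m hm => by rw [← dist_eq_norm]; exact (hN n hn m hm).le⟩
  have cd : ∀ (k : ℕ), k ≤ 2 → ∀ v : M2 ε, ContDiffOn ℝ k v.fn Dom := fun k hk v =>
    v.contDiffOn.of_le (by exact_mod_cast hk)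
  have key : ∀ (k : ℕ), k ≤ 2 → ∀ (r : ℝ),
      (∀ v : M2 ε, ∀ x ∈ Dom, |weight r x * iteratedDeriv k v.fn x| ≤ ‖v‖) →
      ∃ g : ℝ → ℝ, ContinuousOn g Dom ∧
        TendstoLocallyUniformlyOn (fun n => iteratedDeriv k (u n).fn) g atTop Dom ∧
        ∀ e > 0, ∃ N, ∀ n ≥ N, ∀ x ∈ Dom,
          |weight r x * (iteratedDeriv k (u n).fn x - g x)| ≤ e := by
    intro k hk r hb
    refine exists_limit_of_weighted_cauchy (continuousOn_weight r) (fun x hx => weight_pos r hx)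
      (fun n => ((cd k hk (u n)).continuousOn_iteratedDerivWithin le_rfl
        isOpen_Ioo.uniqueDiffOn).congr
        fun x hx => (iteratedDerivWithin_of_isOpen isOpen_Ioo hx).symm) fun e he => ?_
    obtain ⟨N, hN⟩ := hC e he
    refine ⟨N, fun n hn m hm x hx => ?_⟩
    rw [← iteratedDeriv_sub ((cd k hk (u n)).contDiffAt (isOpen_Ioo.mem_nhds hx))
      ((cd k hk (u m)).contDiffAt (isOpen_Ioo.mem_nhds hx)), ← M2.fn_sub]
    exact (hb _ x hx).trans (hN n hn m hm)
  obtain ⟨g0, k0, t0, l0⟩ := key 0 (by norm_num) _ (fun v => v.bounds.1)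
  obtain ⟨g1, k1, t1, l1⟩ := key 1 (by norm_num) _ (fun v => v.bounds.2.1)
  obtain ⟨g2, k2, t2, l2⟩ := key 2 (by norm_num) _ (fun v => v.bounds.2.2)
  have d0 : ∀ x ∈ Dom, HasDerivAt g0 (g1 x) x := fun x hx =>
    hasDerivAt_of_tendstoLocallyUniformlyOn isOpen_Ioo t1
      (Eventually.of_forall fun n x hx => hasDerivAt_iteratedDeriv isOpen_Ioo (k := 0)
        (cd 1 (by norm_num) (u n)) hx) (fun x hx => t0.tendsto_at hx) hx
  have d1 : ∀ x ∈ Dom, HasDerivAt g1 (g2 x) x := fun x hx =>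
    hasDerivAt_of_tendstoLocallyUniformlyOn isOpen_Ioo t2
      (Eventually.of_forall fun n x hx => hasDerivAt_iteratedDeriv isOpen_Ioo (k := 1)
        (cd 2 (by norm_num) (u n)) hx) (fun x hx => t1.tendsto_at hx) hx
  have i1 : ∀ x ∈ Dom, iteratedDeriv 1 g0 x = g1 x := fun x hx => by
    rw [iteratedDeriv_one, (d0 x hx).deriv]
  have i2 : ∀ x ∈ Dom, iteratedDeriv 2 g0 x = g2 x := iteratedDeriv_succ_eqOn isOpen_Ioo i1 d1
  obtain ⟨N0, hN0⟩ := l0 1 one_pos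
  obtain ⟨N1, hN1⟩ := l1 1 one_pos
  obtain ⟨N2, hN2⟩ := l2 1 one_pos
  have B0 := abs_le_of_limits _ (u N0).bounds.1 (hN0 N0 le_rfl)
  have B1 := abs_le_of_limits _ (u N1).bounds.2.1 (hN1 N1 le_rfl)
  have B2 := abs_le_of_limits _ (u N2).bounds.2.2 (hN2 N2 le_rfl)
  have e := eqOn_indicator_Dom g0
  have E : ∀ k, EqOn (iteratedDeriv k (Dom.indicator g0)) (iteratedDeriv k g0) Dom :=
    fun k => iteratedDeriv_congr_on isOpen_Ioo e k
  have E0 : ∀ x ∈ Dom, iteratedDeriv 0 (Dom.indicator g0) x = g0 x := fun x hx => by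
    rw [E 0 hx, iteratedDeriv_zero]
  have E1 : ∀ x ∈ Dom, iteratedDeriv 1 (Dom.indicator g0) x = g1 x := fun x hx => by
    rw [E 1 hx, i1 x hx]
  have E2 : ∀ x ∈ Dom, iteratedDeriv 2 (Dom.indicator g0) x = g2 x := fun x hx => by
    rw [E 2 hx, i2 x hx]
  have hz : ∀ x ∉ Dom, Dom.indicator g0 x = 0 := fun x hx => indicator_of_notMem hx g0
  have C2 : ContDiffOn ℝ 2 g0 Dom := contDiffOn_two_of_hasDerivAt isOpen_Ioo d0 d1 k2
  have hmem : Dom.indicator g0 ∈ M2Sub ε :=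
    ⟨hz, C2.congr e, ⟨_, fun x hx => by rw [E0 x hx]; exact B0 x hx⟩,
      ⟨_, fun x hx => by rw [E1 x hx]; exact B1 x hx⟩,
      ⟨_, fun x hx => by rw [E2 x hx]; exact B2 x hx⟩⟩
  let v : M2 ε := ⟨Dom.indicator g0, hmem⟩
  have hv : v.fn = Dom.indicator g0 := rfl
  refine ⟨v, Metric.tendsto_atTop.2 fun e' he => ?_⟩
  obtain ⟨N0, hN0⟩ := l0 (e' / 8) (by positivity)
  obtain ⟨N1, hN1⟩ := l1 (e' / 8) (by positivity)
  obtain ⟨N2, hN2⟩ := l2 (e' / 8) (by positivity)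
  refine ⟨max (max N0 N1) N2, fun n hn => ?_⟩
  simp only [ge_iff_le, max_le_iff] at hn
  have he8 : 0 ≤ e' / 8 := by positivity
  have sub : ∀ (k : ℕ), k ≤ 2 → ∀ x ∈ Dom, iteratedDeriv k (u n - v).fn x =
        iteratedDeriv k (u n).fn x - iteratedDeriv k (Dom.indicator g0) x := by
    intro k hk x hx
    rw [M2.fn_sub, iteratedDeriv_sub ((cd k hk _).contDiffAt (isOpen_Ioo.mem_nhds hx))
      ((cd k hk _).contDiffAt (isOpen_Ioo.mem_nhds hx)), hv]
  rw [dist_eq_norm, M2.norm_eq]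
  have s0 : wSup Dom (weight ε) 0 (u n - v).fn ≤ e' / 8 := wSup_le he8 fun x hx => by
    rw [sub 0 (by norm_num) x hx, E0 x hx]
    exact hN0 n hn.1.1 x hx
  have s1 : wSup Dom (weight (1 + ε)) 1 (u n - v).fn ≤ e' / 8 := wSup_le he8 fun x hx => by
    rw [sub 1 (by norm_num) x hx, E1 x hx]
    exact hN1 n hn.1.2 x hx
  have s2 : wSup Dom (weight (2 + ε)) 2 (u n - v).fn ≤ e' / 8 := wSup_le he8 fun x hx => by
    rw [sub 2 le_rfl x hx, E2 x hx]
    exact hN2 n hn.2 x hx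
  linarith

/-! ### The linearized equations -/

/-- Coefficients for which the linear equations are solvable in `M₁` and `M₂`. -/
structure Good (ε : ℝ) (A : ℝ → ℝ) : Prop where
  cont : ContinuousOn A Dom
  bdd : ∃ B, ∀ x ∈ Dom, |A x| ≤ B
  mid : ∃ C, BC 2 A C
  -- The exponents match the spaces: the first solution operator carries an additional factor 1 -
  -- x², so r = 2ε yields the order 1 - 2ε of M₁, while r = 1 + ε is the order -(1+ε) of v' for v in
  -- M₂.
  growsθ : ∃ η Λ, Grows A (2 * ε) η Λ
  growsφ : ∃ η Λ, Grows A (1 + ε) η Λ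

theorem exists_bound_of_tendsto {A : ℝ → ℝ} (hA : ContinuousOn A Dom) {s t : ℝ}
    (hs : Tendsto A (𝓝[>] (-1 : ℝ)) (𝓝 s)) (ht : Tendsto A (𝓝[<] (1 : ℝ)) (𝓝 t)) :
    ∃ B, ∀ x ∈ Dom, |A x| ≤ B := by
  have e1 : ∀ᶠ x in 𝓝[<] (1 : ℝ), |A x| < |t| + 1 := ht.abs.eventually (gt_mem_nhds (by linarith))
  have e2 : ∀ᶠ x in 𝓝[>] (-1 : ℝ), |A x| < |s| + 1 := hs.abs.eventually (gt_mem_nhds (by linarith))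
  obtain ⟨x1, hx1, h1⟩ := (mem_nhdsLT_iff_exists_Ioo_subset' (show (0 : ℝ) < 1 by norm_num)).1 e1
  obtain ⟨x2, hx2, h2⟩ := (mem_nhdsGT_iff_exists_Ioo_subset' (show (-1 : ℝ) < 0 by norm_num)).1 e2
  simp only [mem_Iio, mem_Ioi] at hx1 hx2
  obtain ⟨C, hC⟩ := (isCompact_Icc (a := x2) (b := x1)).exists_bound_of_continuousOn
    (hA.mono fun x hx => ⟨by linarith [hx.1], by linarith [hx.2]⟩)
  refine ⟨max C (max (|t| + 1) (|s| + 1)), fun x hx => ?_⟩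
  by_cases h : x1 < x
  · exact (show |A x| < |t| + 1 from h1 ⟨h, hx.2⟩).le.trans
      ((le_max_left _ _).trans (le_max_right _ _))
  by_cases h' : x < x2
  · exact (show |A x| < |s| + 1 from h2 ⟨hx.1, h'⟩).le.trans
      ((le_max_right _ _).trans (le_max_right _ _))
  exact (hC x ⟨not_lt.1 h', not_lt.1 h⟩).trans (le_max_left _ _)

/-- The end conditions are exactly those of `exists_grows` for r = 2ε. For r = 1 + ε the required
bound 2 + 2ε is weaker, because 4ε < 2 + 2ε. -/
theorem Good.of_tendsto {ε : ℝ} (hε : 0 < ε ∧ ε < 1 / 2) {A : ℝ → ℝ} (hA : ContinuousOn A Dom)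
    {s t : ℝ} (hs : Tendsto A (𝓝[>] (-1 : ℝ)) (𝓝 s)) (ht : Tendsto A (𝓝[<] (1 : ℝ)) (𝓝 t))
    (hsε : s < 4 * ε) (htε : -t < 4 * ε) (hm : ∃ C, BC 2 A C) : Good ε A := by
  obtain ⟨B, hB⟩ := exists_bound_of_tendsto hA hs ht
  exact ⟨hA, ⟨B, hB⟩, hm,
    exists_grows hA hs ht hB (by linarith [hε.1]) (by linarith) (by linarith),
    exists_grows hA hs ht hB (by linarith [hε.1]) (by linarith [hε.2]) (by linarith [hε.2])⟩

/-- Right hand sides for the first equation. -/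
structure Srcθ (ε : ℝ) (g : ℝ → ℝ) (C : ℝ) : Prop where
  cont : ContinuousOn g Dom
  bound : ∀ x ∈ Dom, |g x| ≤ C * weight (1 - 2 * ε) x
  mid : BC 2 g C

/-- Right hand sides for the second equation. -/
structure Srcφ (ε : ℝ) (h : ℝ → ℝ) (C : ℝ) : Prop where
  cont : ContinuousOn h Dom
  bound : ∀ x ∈ Dom, |h x| ≤ C * weight (-(1 + ε)) x

/-- The solution of `(1 - x²) u' + (2x + A) u = g`, `u(0) = k`. -/
noncomputable def solθ (A : ℝ → ℝ) (k : ℝ) (g : ℝ → ℝ) (x : ℝ) : ℝ :=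
  (1 - x ^ 2) * (Real.exp (-expo A x) *
    (k + ∫ s in (0 : ℝ)..x, Real.exp (expo A s) * (g s / (1 - s ^ 2) ^ 2)))

/-- The solution of `(1 - x²) z' + A z = h`, `z(0) = k`. -/
noncomputable def solφ' (A : ℝ → ℝ) (k : ℝ) (h : ℝ → ℝ) (x : ℝ) : ℝ :=
  Real.exp (-expo A x) * (k + ∫ s in (0 : ℝ)..x, Real.exp (expo A s) * (h s / (1 - s ^ 2)))

/-- The solution of `(1 - x²) v'' + A v' = h`, `v(0) = k₀`, `v'(0) = k₁`. -/
noncomputable def solφ (A : ℝ → ℝ) (k₀ k₁ : ℝ) (h : ℝ → ℝ) (x : ℝ) : ℝ :=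
  k₀ + ∫ s in (0 : ℝ)..x, solφ' A k₁ h s

section sol

variable {A g h : ℝ → ℝ} {k k₀ k₁ : ℝ}

theorem solθ_zero : solθ A k g 0 = k := by simp [solθ, expo_zero]

theorem solφ'_zero : solφ' A k h 0 = k := by simp [solφ', expo_zero]

theorem solφ_zero : solφ A k₀ k₁ h 0 = k₀ := by simp [solφ]

theorem continuousOn_exp_expo (hA : ContinuousOn A Dom) :
    ContinuousOn (fun s => Real.exp (expo A s)) Dom :=
  Real.continuous_exp.comp_continuousOn (continuousOn_expo hA)

theorem continuousOn_div_sq (hg : ContinuousOn g Dom) :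
    ContinuousOn (fun s => g s / (1 - s ^ 2) ^ 2) Dom :=
  hg.div (by fun_prop) fun _ hx => pow_ne_zero 2 (one_sub_sq_pos hx).ne'

/-- The integrating factor of the first equation is e^b/(1-x²) with b = `expo A`, because 2x/(1-x²)
integrates to -log(1-x²). This produces the factor 1 - x² in front and the square in the
denominator, and both equations share the same b. -/
theorem hasDerivAt_solθ (hA : ContinuousOn A Dom) (hg : ContinuousOn g Dom) {x : ℝ}
    (hx : x ∈ Dom) :
    HasDerivAt (solθ A k g) ((g x - (2 * x + A x) * solθ A k g x) / (1 - x ^ 2)) x := by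
  have h1 : HasDerivAt (fun x : ℝ => 1 - x ^ 2) (-(2 * x)) x := by
    simpa using ((hasDerivAt_id x).pow 2).const_sub 1
  have h2 := (hasDerivAt_integral
    ((continuousOn_exp_expo hA).mul (continuousOn_div_sq hg)) hx).const_add k
  refine (h1.mul ((hasDerivAt_expo hA hx).neg.exp.mul h2)).congr_deriv ?_
  have h3 := (one_sub_sq_pos hx).ne'
  have h4 : Real.exp (-expo A x) * Real.exp (expo A x) = 1 := by rw [← Real.exp_add]; simp
  simp only [solθ, Pi.neg_apply, Pi.mul_apply]
  generalize (∫ s in (0 : ℝ)..x, Real.exp (expo A s) * (g s / (1 - s ^ 2) ^ 2)) = J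
  field_simp
  linear_combination g x * h4

theorem hasDerivAt_solφ' (hA : ContinuousOn A Dom) (hh : ContinuousOn h Dom) {x : ℝ}
    (hx : x ∈ Dom) :
    HasDerivAt (solφ' A k h) ((h x - A x * solφ' A k h x) / (1 - x ^ 2)) x := by
  have h2 := (hasDerivAt_integral
    ((continuousOn_exp_expo hA).mul (continuousOn_div_one_sub_sq hh)) hx).const_add k
  refine ((hasDerivAt_expo hA hx).neg.exp.mul h2).congr_deriv ?_
  have h3 := (one_sub_sq_pos hx).ne'
  have h4 : Real.exp (-expo A x) * Real.exp (expo A x) = 1 := by rw [← Real.exp_add]; simp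
  simp only [solφ', Pi.neg_apply, Pi.mul_apply]
  generalize (∫ s in (0 : ℝ)..x, Real.exp (expo A s) * (h s / (1 - s ^ 2))) = J
  field_simp
  linear_combination h x * h4

theorem continuousOn_solφ' (hA : ContinuousOn A Dom) (hh : ContinuousOn h Dom) :
    ContinuousOn (solφ' A k h) Dom :=
  continuousOn_of_hasDerivAt fun _ hx => hasDerivAt_solφ' hA hh hx

theorem hasDerivAt_solφ (hA : ContinuousOn A Dom) (hh : ContinuousOn h Dom) {x : ℝ}
    (hx : x ∈ Dom) : HasDerivAt (solφ A k₀ k₁ h) (solφ' A k₁ h x) x :=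
  (hasDerivAt_integral (continuousOn_solφ' hA hh) hx).const_add k₀

theorem deriv_solφ_zero (hA : ContinuousOn A Dom) (hh : ContinuousOn h Dom) :
    deriv (solφ A k₀ k₁ h) 0 = k₁ := by
  rw [(hasDerivAt_solφ hA hh zero_mem_Dom).deriv, solφ'_zero]

/-- Uniqueness for the first equation. -/
theorem eq_solθ (hA : ContinuousOn A Dom) (hg : ContinuousOn g Dom) {u : ℝ → ℝ}
    (hu : DifferentiableOn ℝ u Dom)
    (he : ∀ x ∈ Dom, (1 - x ^ 2) * deriv u x + (2 * x + A x) * u x = g x) :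
    EqOn u (solθ A (u 0) g) Dom := by
  refine fun x hx => eq_of_linear (k := fun x => -(2 * x + A x) / (1 - x ^ 2))
    (g := fun x => g x / (1 - x ^ 2)) (continuousOn_div_one_sub_sq (by fun_prop))
    (fun y hy => ?_) (fun y hy => ?_) solθ_zero.symm hx
  · refine ((hu y hy).differentiableAt (isOpen_Ioo.mem_nhds hy)).hasDerivAt.congr_deriv ?_
    have := (one_sub_sq_pos hy).ne'
    field_simp
    linear_combination he y hy
  · refine (hasDerivAt_solθ hA hg hy).congr_deriv ?_
    have := (one_sub_sq_pos hy).ne'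
    field_simp
    ring

/-- Uniqueness for the second equation. -/
theorem eq_solφ (hA : ContinuousOn A Dom) (hh : ContinuousOn h Dom) {v : ℝ → ℝ}
    (hv : ContDiffOn ℝ 2 v Dom)
    (he : ∀ x ∈ Dom, (1 - x ^ 2) * iteratedDeriv 2 v x + A x * deriv v x = h x) :
    EqOn v (solφ A (v 0) (deriv v 0) h) Dom := by
  have hd : ∀ y ∈ Dom, HasDerivAt (deriv v) (iteratedDeriv 2 v y) y := fun y hy => by
    have := hasDerivAt_iteratedDeriv isOpen_Ioo (k := 1) hv hy
    rwa [iteratedDeriv_one] at this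
  have key : EqOn (deriv v) (solφ' A (deriv v 0) h) Dom := by
    refine fun x hx => eq_of_linear (k := fun x => -A x / (1 - x ^ 2))
      (g := fun x => h x / (1 - x ^ 2)) (continuousOn_div_one_sub_sq (by fun_prop))
      (fun y hy => ?_) (fun y hy => ?_) solφ'_zero.symm hx
    · refine (hd y hy).congr_deriv ?_
      have := (one_sub_sq_pos hy).ne'
      field_simp
      linear_combination he y hy
    · refine (hasDerivAt_solφ' hA hh hy).congr_deriv ?_
      have := (one_sub_sq_pos hy).ne'
      field_simp
      ring
  exact fun x hx => eq_of_hasDerivAt_eq (f' := solφ' A (deriv v 0) h)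
    (fun y hy => (hasDerivAt_of_contDiffOn isOpen_Ioo hv (by norm_num) hy).congr_deriv (key hy))
    (fun y hy => hasDerivAt_solφ hA hh hy) solφ_zero.symm hx

/-- The second equation holds for `solφ`. -/
theorem iteratedDeriv_two_solφ (hA : ContinuousOn A Dom) (hh : ContinuousOn h Dom) {x : ℝ}
    (hx : x ∈ Dom) : iteratedDeriv 2 (solφ A k₀ k₁ h) x =
      (h x - A x * solφ' A k₁ h x) / (1 - x ^ 2) :=
  iteratedDeriv_succ_eqOn (k := 1) isOpen_Ioo (g := solφ' A k₁ h)
    (fun y hy => by rw [iteratedDeriv_one]; exact (hasDerivAt_solφ hA hh hy).deriv)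
    (fun y hy => hasDerivAt_solφ' hA hh hy) x hx

end sol

theorem exists_BC_one_sub_sq_inv : ∃ H, BC 2 (fun x => 1 / (1 - x ^ 2)) H := by
  refine BC.exists_of_contDiffOn (contDiffOn_const.div (by fun_prop) fun x hx => ?_)
  exact (one_sub_sq_pos hx).ne'

theorem exists_BC_id : ∃ H, BC 2 (fun x => 2 * x) H :=
  BC.exists_of_contDiffOn (by fun_prop)

/-- The equation expresses u' through u and g, so each bound on u gains one order. The constant 4
bounds the factor 2^j of `BC.mul` for j ≤ 2. -/
theorem BC_solθ_step {A : ℝ → ℝ} (hA : ContinuousOn A Dom) {H D : ℝ}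
    (hH : BC 2 (fun x => 1 / (1 - x ^ 2)) H) (hD : BC 2 (fun x => 2 * x + A x) D) {j : ℕ}
    (hj : j ≤ 2) {k C K : ℝ} {g : ℝ → ℝ} (hg : ContinuousOn g Dom) (hg2 : BC 2 g C)
    (hu : BC j (solθ A k g) K) :
    BC (j + 1) (solθ A k g) (K + 4 * (H * (C + 4 * (D * K)))) := by
  have low : ∀ {f : ℝ → ℝ} {C : ℝ}, BC 2 f C → BC j f C := by
    intro f C hf
    interval_cases j
    exacts [hf.pred.pred, hf.pred, hf]
  have hp : (2 : ℝ) ^ j ≤ 4 := by interval_cases j <;> norm_num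
  have nK := hu.nonneg
  have nC := hg2.nonneg
  have nH := hH.nonneg
  have nD := hD.nonneg
  have h1 : BC j (fun x => (2 * x + A x) * solθ A k g x) (4 * (D * K)) :=
    ((low hD).mul hu).mono (by gcongr)
  have h2 : BC j (fun x => 1 / (1 - x ^ 2) * (g x - (2 * x + A x) * solθ A k g x))
      (4 * (H * (C + 4 * (D * K)))) :=
    ((low hH).mul ((low hg2).sub h1)).mono (by gcongr)
  refine BC.of_hasDerivAt (fun x hx => (hu.abs_le x hx).trans (le_add_of_nonneg_right ?_))
    (fun x hx => (hasDerivAt_solθ hA hg (Mid_subset_Dom hx)).congr_deriv ?_)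
    (h2.mono (le_add_of_nonneg_left nK))
  · positivity
  · ring

/-- `Grows` with r = 2ε bounds u, the equation then bounds u', and three rounds of `BC_solθ_step`
bound the derivatives on `Mid`. The constant K depends on A and ε only, which makes the solution
operator bounded. -/
theorem Good.exists_M1Data {ε : ℝ} (hε : 0 < ε ∧ ε < 1 / 2) {A : ℝ → ℝ} (hA : Good ε A) :
    ∃ K, 0 ≤ K ∧ ∀ k g C, Srcθ ε g C → M1Data ε (solθ A k g) (K * (|k| + C)) := by
  obtain ⟨η, Λ, hG⟩ := hA.growsθ
  obtain ⟨B, hB⟩ := hA.bdd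
  obtain ⟨CA, hCA⟩ := hA.mid
  obtain ⟨H, hH⟩ := exists_BC_one_sub_sq_inv
  obtain ⟨D', hD'⟩ := exists_BC_id
  have hD := hD'.add hCA
  set D := D' + CA
  have nH := hH.nonneg
  have nD := hD.nonneg
  have nB : 0 ≤ B := (abs_nonneg _).trans (hB 0 zero_mem_Dom)
  have hη := hG.pos
  set K0 := Real.exp Λ + Real.exp Λ / η with hK0
  have nK0 : 0 ≤ K0 := by positivity
  -- One round of `BC_solθ_step`, as a map on the factor in front of S = |k| + C. It is iterated
  -- three times, starting from the sup bound K0.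
  set st : ℝ → ℝ := fun K => K + 4 * (H * (1 + 4 * (D * K))) with hst
  have st_le : ∀ K, 0 ≤ K → K ≤ st K := fun K hK => by
    simp only [hst]; exact le_add_of_nonneg_right (by positivity)
  have n1 := nK0.trans (st_le K0 nK0)
  have n2 := n1.trans (st_le _ n1)
  have n3 := n2.trans (st_le _ n2)
  have l03 : K0 ≤ st (st (st K0)) := (st_le _ nK0).trans ((st_le _ n1).trans (st_le _ n2))
  refine ⟨st (st (st K0)) + (1 + (2 + B) * K0), by positivity, fun k g C hg => ?_⟩
  have nC := hg.mid.nonneg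
  set S := |k| + C with hS
  have nS : 0 ≤ S := by positivity
  have hCS : C ≤ S := le_add_of_nonneg_left (abs_nonneg k)
  -- The source loses two powers of 1 - x², from 1 - 2ε to -1 - 2ε, which is the order that `Grows`
  -- admits for r = 2ε.
  have hb : ∀ x ∈ Dom, |g x / (1 - x ^ 2) ^ 2| ≤ C * weight (-1 - 2 * ε) x := by
    intro x hx
    have h1 := one_sub_sq_pos hx
    rw [abs_div, abs_of_pos (pow_pos h1 2), div_le_iff₀ (pow_pos h1 2)]
    refine (hg.bound x hx).trans (le_of_eq ?_)
    rw [show 1 - 2 * ε = 1 + (1 + (-1 - 2 * ε)) by ring, weight_add _ _ hx, weight_add _ _ hx,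
      weight_one]
    ring
  have hu0 : ∀ x ∈ Dom, |solθ A k g x| ≤ K0 * S * weight (1 - 2 * ε) x := by
    intro x hx
    have h1 := one_sub_sq_pos hx
    have e1 := hG.exp_neg_le hx
    have e2 := hG.abs_integral_le (continuousOn_div_sq hg.cont) hb hx
    have hw := weight_pos (-(2 * ε)) hx
    rw [solθ, abs_mul, abs_of_pos h1, mul_add]
    have e3 : |Real.exp (-expo A x) * k| ≤ |k| * (Real.exp Λ * weight (-(2 * ε)) x) := by
      rw [abs_mul, Real.abs_exp, mul_comm]; gcongr
    have e4 : (1 - x ^ 2) * weight (-(2 * ε)) x = weight (1 - 2 * ε) x := by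
      rw [one_sub_sq_mul_weight _ hx]; rfl
    calc _ ≤ (1 - x ^ 2) * (|k| * (Real.exp Λ * weight (-(2 * ε)) x) +
          C * (Real.exp Λ / η) * weight (-(2 * ε)) x) := by
            gcongr; exact (abs_add_le _ _).trans (add_le_add e3 e2)
      _ = (|k| * Real.exp Λ + C * (Real.exp Λ / η)) * weight (1 - 2 * ε) x := by
            rw [← e4]; ring
      _ ≤ (S * Real.exp Λ + S * (Real.exp Λ / η)) * weight (1 - 2 * ε) x := by
            have := weight_pos (1 - 2 * ε) hx
            have : |k| ≤ S := le_add_of_nonneg_right nC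
            gcongr
      _ = _ := by rw [hK0]; ring
  have hder := fun x hx => hasDerivAt_solθ (k := k) hA.cont hg.cont (x := x) hx
  have hcu : ContinuousOn (solθ A k g) Dom := continuousOn_of_hasDerivAt hder
  have hu1 : ∀ x ∈ Dom, |deriv (solθ A k g) x| ≤ (1 + (2 + B) * K0) * S * weight (-(2 * ε)) x := by
    intro x hx
    have h1 := one_sub_sq_pos hx
    have hw := weight_pos (1 - 2 * ε) hx
    have e4 : (1 - x ^ 2) * weight (-(2 * ε)) x = weight (1 - 2 * ε) x := by
      rw [one_sub_sq_mul_weight _ hx]; rfl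
    rw [(hder x hx).deriv, abs_div, abs_of_pos h1, div_le_iff₀ h1]
    have e5 : |2 * x + A x| ≤ 2 + B := by
      refine (abs_add_le _ _).trans (add_le_add ?_ (hB x hx))
      rw [abs_le]; constructor <;> linarith [hx.1, hx.2]
    calc _ ≤ |g x| + |2 * x + A x| * |solθ A k g x| := by
            rw [← abs_mul]; exact abs_sub _ _
      _ ≤ C * weight (1 - 2 * ε) x + (2 + B) * (K0 * S * weight (1 - 2 * ε) x) := by
            gcongr
            exacts [hg.bound x hx, hu0 x hx]
      _ ≤ S * weight (1 - 2 * ε) x + (2 + B) * (K0 * S * weight (1 - 2 * ε) x) := by gcongr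
      _ = _ := by rw [← e4]; ring
  have m0 : BC 0 (solθ A k g) (K0 * S) := by
    refine ⟨fun x hx => (hu0 x (Mid_subset_Dom hx)).trans ?_, hcu.mono Mid_subset_Dom⟩
    have := weight_le_one (r := 1 - 2 * ε) (by linarith [hε.2]) (Mid_subset_Dom hx)
    exact mul_le_of_le_one_right (by positivity) this
  have step : ∀ {j : ℕ} {K : ℝ}, j ≤ 2 → 0 ≤ K → BC j (solθ A k g) (K * S) →
      BC (j + 1) (solθ A k g) (st K * S) := by
    intro j K hj hK h
    refine (BC_solθ_step hA.cont hH hD hj hg.cont hg.mid h).mono ?_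
    have : K * S + 4 * (H * (C + 4 * (D * (K * S)))) ≤
        K * S + 4 * (H * (S + 4 * (D * (K * S)))) := by gcongr
    refine this.trans (le_of_eq ?_)
    simp only [hst]; ring
  have m3 := step (j := 2) le_rfl n2 (step (j := 1) (by norm_num) n1 (step (by norm_num) nK0 m0))
  refine ⟨contDiffOn_one_of_hasDerivAt isOpen_Ioo hder ?_, fun x hx => ?_, fun x hx => ?_, ?_⟩
  · exact continuousOn_div_one_sub_sq
      (hg.cont.sub ((ContinuousOn.add (by fun_prop) hA.cont).mul hcu))
  · refine (hu0 x hx).trans ?_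
    have := weight_pos (1 - 2 * ε) hx
    gcongr
    refine l03.trans (le_add_of_nonneg_right (by positivity))
  · refine (hu1 x hx).trans ?_
    have := weight_pos (-(2 * ε)) hx
    gcongr ?_ * S * _
    exact le_add_of_nonneg_left n3
  · refine m3.mono ?_
    gcongr
    exact le_add_of_nonneg_right (by positivity)

/-- `Grows` with r = 1 + ε bounds v', integration gains one power for v since ε > 0, and the
equation bounds v''. -/
theorem Good.exists_M2Data {ε : ℝ} (hε : 0 < ε ∧ ε < 1 / 2) {A : ℝ → ℝ} (hA : Good ε A) :
    ∃ K, 0 ≤ K ∧ ∀ k₀ k₁ h C, Srcφ ε h C → M2Data ε (solφ A k₀ k₁ h) (K * (|k₀| + |k₁| + C)) := by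
  obtain ⟨η, Λ, hG⟩ := hA.growsφ
  obtain ⟨B, hB⟩ := hA.bdd
  have nB : 0 ≤ B := (abs_nonneg _).trans (hB 0 zero_mem_Dom)
  have hη := hG.pos
  have hε0 := hε.1
  set K0 := Real.exp Λ + Real.exp Λ / η with hK0
  have nK0 : 0 ≤ K0 := by positivity
  set E := Real.exp (2 * ε) / (2 * ε) with hE
  have nE : 0 ≤ E := by positivity
  refine ⟨(1 + K0 * E) + (K0 + (1 + B * K0)), by positivity, fun k₀ k₁ h C hh => ?_⟩
  have nC : 0 ≤ C := by
    have := (abs_nonneg _).trans (hh.bound 0 zero_mem_Dom)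
    rwa [weight_at_zero, mul_one] at this
  set S := |k₀| + |k₁| + C with hS
  have nS : 0 ≤ S := by positivity
  have hCS : C ≤ S := le_add_of_nonneg_left (by positivity)
  have hk1 : |k₁| ≤ S := by rw [hS]; linarith [abs_nonneg k₀]
  have hk0 : |k₀| ≤ S := by rw [hS]; linarith [abs_nonneg k₁]
  have hb : ∀ x ∈ Dom, |h x / (1 - x ^ 2)| ≤ C * weight (-1 - (1 + ε)) x := by
    intro x hx
    have h1 := one_sub_sq_pos hx
    rw [abs_div, abs_of_pos h1, div_le_iff₀ h1]
    refine (hh.bound x hx).trans (le_of_eq ?_)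
    rw [show -(1 + ε) = 1 + (-1 - (1 + ε)) by ring, weight_add _ _ hx, weight_one]
    ring
  have hz : ∀ x ∈ Dom, |solφ' A k₁ h x| ≤ K0 * S * weight (-(1 + ε)) x := by
    intro x hx
    have e1 := hG.exp_neg_le hx
    have e2 := hG.abs_integral_le (continuousOn_div_one_sub_sq hh.cont) hb hx
    have hw := weight_pos (-(1 + ε)) hx
    rw [solφ', mul_add]
    have e3 : |Real.exp (-expo A x) * k₁| ≤ |k₁| * (Real.exp Λ * weight (-(1 + ε)) x) := by
      rw [abs_mul, Real.abs_exp, mul_comm]; gcongr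
    calc _ ≤ |k₁| * (Real.exp Λ * weight (-(1 + ε)) x) +
          C * (Real.exp Λ / η) * weight (-(1 + ε)) x :=
            (abs_add_le _ _).trans (add_le_add e3 e2)
      _ ≤ S * (Real.exp Λ * weight (-(1 + ε)) x) +
          S * (Real.exp Λ / η) * weight (-(1 + ε)) x := by gcongr
      _ = _ := by rw [hK0]; ring
  have hcz := continuousOn_solφ' (k := k₁) hA.cont hh.cont
  refine ⟨contDiffOn_two_of_hasDerivAt isOpen_Ioo
    (fun x hx => hasDerivAt_solφ hA.cont hh.cont hx)
    (fun x hx => hasDerivAt_solφ' hA.cont hh.cont hx) ?_, fun x hx => ?_, fun x hx => ?_,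
    fun x hx => ?_⟩
  · exact continuousOn_div_one_sub_sq (hh.cont.sub (hA.cont.mul hcz))
  · have e1 := abs_integral_le_weight hε0 hcz (C := K0 * S)
      (fun x hx => by rw [show -1 - ε = -(1 + ε) by ring]; exact hz x hx) hx
    have h1 := one_le_weight (r := -ε) (by linarith) hx
    have hw := weight_pos (-ε) hx
    calc |solφ A k₀ k₁ h x| ≤ |k₀| + K0 * S * E * weight (-ε) x :=
          (abs_add_le _ _).trans (add_le_add le_rfl e1)
      _ ≤ S * weight (-ε) x + K0 * S * E * weight (-ε) x := by
          gcongr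
          exact hk0.trans (le_mul_of_one_le_right nS h1)
      _ = (1 + K0 * E) * S * weight (-ε) x := by ring
      _ ≤ _ := by gcongr ?_ * S * _; exact le_add_of_nonneg_right (by positivity)
  · rw [(hasDerivAt_solφ hA.cont hh.cont hx).deriv]
    refine (hz x hx).trans ?_
    have hw := weight_pos (-(1 + ε)) hx
    gcongr
    have : 0 ≤ (1 + K0 * E) := by positivity
    have : 0 ≤ (1 + B * K0) := by positivity
    linarith
  · rw [iteratedDeriv_two_solφ hA.cont hh.cont hx]
    have h1 := one_sub_sq_pos hx
    have hw := weight_pos (-(1 + ε)) hx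
    rw [abs_div, abs_of_pos h1, div_le_iff₀ h1]
    have e4 : weight (-(2 + ε)) x * (1 - x ^ 2) = weight (-(1 + ε)) x := by
      rw [mul_comm, one_sub_sq_mul_weight _ hx]; congr 1; ring
    rw [mul_assoc, e4]
    calc _ ≤ |h x| + |A x| * |solφ' A k₁ h x| := by
            rw [← abs_mul]; exact abs_sub _ _
      _ ≤ C * weight (-(1 + ε)) x + B * (K0 * S * weight (-(1 + ε)) x) := by
            gcongr
            exacts [hh.bound x hx, hB x hx, hz x hx]
      _ ≤ S * weight (-(1 + ε)) x + B * (K0 * S * weight (-(1 + ε)) x) := by gcongr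
      _ = (1 + B * K0) * S * weight (-(1 + ε)) x := by ring
      _ ≤ _ := by
        gcongr ?_ * S * _
        have : 0 ≤ (1 + K0 * E) := by positivity
        linarith

/-! ### Bilinear right hand sides -/

section bilinear

variable {A g g' : ℝ → ℝ}

theorem solθ_congr (h : EqOn g g' Dom) (k : ℝ) : EqOn (solθ A k g) (solθ A k g') Dom := by
  intro x hx
  simp only [solθ]
  congr 3
  exact intervalIntegral.integral_congr fun s hs => by
    simp only [h (uIcc_zero_subset_Dom hx hs)]

theorem solθ_add (hA : ContinuousOn A Dom) (hg : ContinuousOn g Dom) (hg' : ContinuousOn g' Dom)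
    (k k' : ℝ) {x : ℝ} (hx : x ∈ Dom) :
    solθ A (k + k') (g + g') x = solθ A k g x + solθ A k' g' x := by
  have i1 := intervalIntegrable_of_continuousOn_Dom
    ((continuousOn_exp_expo hA).mul (continuousOn_div_sq hg)) hx
  have i2 := intervalIntegrable_of_continuousOn_Dom
    ((continuousOn_exp_expo hA).mul (continuousOn_div_sq hg')) hx
  have := intervalIntegral.integral_add i1 i2
  simp only [Pi.mul_apply] at this
  simp only [solθ]
  rw [show (∫ s in (0 : ℝ)..x, Real.exp (expo A s) * ((g + g') s / (1 - s ^ 2) ^ 2)) =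
    ∫ s in (0 : ℝ)..x, (Real.exp (expo A s) * (g s / (1 - s ^ 2) ^ 2) +
      Real.exp (expo A s) * (g' s / (1 - s ^ 2) ^ 2)) from by
      congr 1; funext s; simp only [Pi.add_apply]; ring, this]
  ring

theorem solθ_smul (c k : ℝ) (x : ℝ) : solθ A (c * k) (c • g) x = c * solθ A k g x := by
  simp only [solθ]
  rw [show (∫ s in (0 : ℝ)..x, Real.exp (expo A s) * ((c • g) s / (1 - s ^ 2) ^ 2)) =
    ∫ s in (0 : ℝ)..x, c * (Real.exp (expo A s) * (g s / (1 - s ^ 2) ^ 2)) from by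
      congr 1; funext s; simp only [Pi.smul_apply, smul_eq_mul]; ring,
    intervalIntegral.integral_const_mul]
  ring

theorem solφ'_congr (h : EqOn g g' Dom) (k : ℝ) : EqOn (solφ' A k g) (solφ' A k g') Dom := by
  intro x hx
  simp only [solφ']
  congr 2
  exact intervalIntegral.integral_congr fun s hs => by
    simp only [h (uIcc_zero_subset_Dom hx hs)]

theorem solφ_congr (h : EqOn g g' Dom) (k₀ k₁ : ℝ) :
    EqOn (solφ A k₀ k₁ g) (solφ A k₀ k₁ g') Dom := by
  intro x hx
  simp only [solφ]
  congr 1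
  exact intervalIntegral.integral_congr fun s hs => solφ'_congr h k₁ (uIcc_zero_subset_Dom hx hs)

theorem solφ'_add (hA : ContinuousOn A Dom) (hg : ContinuousOn g Dom) (hg' : ContinuousOn g' Dom)
    (k k' : ℝ) {x : ℝ} (hx : x ∈ Dom) :
    solφ' A (k + k') (g + g') x = solφ' A k g x + solφ' A k' g' x := by
  have i1 := intervalIntegrable_of_continuousOn_Dom
    ((continuousOn_exp_expo hA).mul (continuousOn_div_one_sub_sq hg)) hx
  have i2 := intervalIntegrable_of_continuousOn_Dom
    ((continuousOn_exp_expo hA).mul (continuousOn_div_one_sub_sq hg')) hx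
  have := intervalIntegral.integral_add i1 i2
  simp only [Pi.mul_apply] at this
  simp only [solφ']
  rw [show (∫ s in (0 : ℝ)..x, Real.exp (expo A s) * ((g + g') s / (1 - s ^ 2))) =
    ∫ s in (0 : ℝ)..x, (Real.exp (expo A s) * (g s / (1 - s ^ 2)) +
      Real.exp (expo A s) * (g' s / (1 - s ^ 2))) from by
      congr 1; funext s; simp only [Pi.add_apply]; ring, this]
  ring

theorem solφ'_smul (c k : ℝ) (x : ℝ) : solφ' A (c * k) (c • g) x = c * solφ' A k g x := by
  simp only [solφ']
  rw [show (∫ s in (0 : ℝ)..x, Real.exp (expo A s) * ((c • g) s / (1 - s ^ 2))) =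
    ∫ s in (0 : ℝ)..x, c * (Real.exp (expo A s) * (g s / (1 - s ^ 2))) from by
      congr 1; funext s; simp only [Pi.smul_apply, smul_eq_mul]; ring,
    intervalIntegral.integral_const_mul]
  ring

theorem solφ_add (hA : ContinuousOn A Dom) (hg : ContinuousOn g Dom) (hg' : ContinuousOn g' Dom)
    (k₀ k₀' k k' : ℝ) {x : ℝ} (hx : x ∈ Dom) :
    solφ A (k₀ + k₀') (k + k') (g + g') x = solφ A k₀ k g x + solφ A k₀' k' g' x := by
  have := intervalIntegral.integral_add
    (intervalIntegrable_of_continuousOn_Dom (continuousOn_solφ' (k := k) hA hg) hx)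
    (intervalIntegrable_of_continuousOn_Dom (continuousOn_solφ' (k := k') hA hg') hx)
  simp only [solφ]
  rw [intervalIntegral.integral_congr (g := fun s => solφ' A k g s + solφ' A k' g' s)
    fun s hs => solφ'_add hA hg hg' k k' (uIcc_zero_subset_Dom hx hs), this]
  ring

theorem solφ_smul (c k₀ k : ℝ) (x : ℝ) :
    solφ A (c * k₀) (c * k) (c • g) x = c * solφ A k₀ k g x := by
  simp only [solφ, solφ'_smul, intervalIntegral.integral_const_mul]
  ring

variable {E G : Type*} [NormedAddCommGroup E] [NormedSpace ℝ E] [NormedAddCommGroup G]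
  [NormedSpace ℝ G]

/-- A bilinear operation on functions, up to equality on `(-1,1)`. -/
structure BilinOn (F : E → G → ℝ → ℝ) : Prop where
  add_left : ∀ e e' g, EqOn (F (e + e') g) (F e g + F e' g) Dom
  smul_left : ∀ (c : ℝ) e g, EqOn (F (c • e) g) (c • F e g) Dom
  add_right : ∀ e g g', EqOn (F e (g + g')) (F e g + F e g') Dom
  smul_right : ∀ (c : ℝ) e g, EqOn (F e (c • g)) (c • F e g) Dom

/-- With zero initial value the solution is linear in its source, so a bounded bilinear source gives
a bounded bilinear map into M₁. -/
theorem Good.exists_bilinθ {ε : ℝ} (hε : 0 < ε ∧ ε < 1 / 2) (hA : Good ε A) {F : E → G → ℝ → ℝ}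
    (hF : BilinOn F) {c : ℝ} (hb : ∀ e g, Srcθ ε (F e g) (c * ‖e‖ * ‖g‖)) :
    ∃ B : E →L[ℝ] G →L[ℝ] M1 ε, ∀ e g, EqOn (B e g).fn (solθ A 0 (F e g)) Dom := by
  obtain ⟨K, hK, hM⟩ := hA.exists_M1Data hε
  have hfn := fun e g => M1.mk_fn hε.2 (hM 0 _ _ (hb e g))
  let B₀ : E →ₗ[ℝ] G →ₗ[ℝ] M1 ε := LinearMap.mk₂ ℝ (fun e g => M1.mk hε.2 (hM 0 _ _ (hb e g)))
    (fun e e' g => M1.ext_on fun x hx => by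
      rw [M1.fn_add, Pi.add_apply, hfn _ _ hx, hfn _ _ hx, hfn _ _ hx,
        solθ_congr (hF.add_left e e' g) 0 hx]
      simpa using solθ_add hA.cont (hb e g).cont (hb e' g).cont 0 0 hx)
    (fun c e g => M1.ext_on fun x hx => by
      rw [M1.fn_smul, Pi.smul_apply, hfn _ _ hx, hfn _ _ hx,
        solθ_congr (hF.smul_left c e g) 0 hx]
      simpa using solθ_smul (A := A) (g := F e g) c 0 x)
    (fun e g g' => M1.ext_on fun x hx => by
      rw [M1.fn_add, Pi.add_apply, hfn _ _ hx, hfn _ _ hx, hfn _ _ hx,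
        solθ_congr (hF.add_right e g g') 0 hx]
      simpa using solθ_add hA.cont (hb e g).cont (hb e g').cont 0 0 hx)
    (fun c e g => M1.ext_on fun x hx => by
      rw [M1.fn_smul, Pi.smul_apply, hfn _ _ hx, hfn _ _ hx,
        solθ_congr (hF.smul_right c e g) 0 hx]
      simpa using solθ_smul (A := A) (g := F e g) c 0 x)
  refine ⟨B₀.mkContinuous₂ (4 * (K * c)) fun e g => ?_, fun e g => hfn e g⟩
  refine (M1.norm_mk_le hε.2 (hM 0 _ _ (hb e g))).trans (le_of_eq ?_)
  rw [abs_zero]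
  ring

theorem Good.exists_bilinφ {ε : ℝ} (hε : 0 < ε ∧ ε < 1 / 2) (hA : Good ε A) {F : E → G → ℝ → ℝ}
    (hF : BilinOn F) {c : ℝ} (hb : ∀ e g, Srcφ ε (F e g) (c * ‖e‖ * ‖g‖)) :
    ∃ B : E →L[ℝ] G →L[ℝ] M2 ε, ∀ e g, EqOn (B e g).fn (solφ A 0 0 (F e g)) Dom := by
  obtain ⟨K, hK, hM⟩ := hA.exists_M2Data hε
  have hfn := fun e g => M2.mk_fn (hM 0 0 _ _ (hb e g))
  let B₀ : E →ₗ[ℝ] G →ₗ[ℝ] M2 ε := LinearMap.mk₂ ℝ (fun e g => M2.mk (hM 0 0 _ _ (hb e g)))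
    (fun e e' g => M2.ext_on fun x hx => by
      rw [M2.fn_add, Pi.add_apply, hfn _ _ hx, hfn _ _ hx, hfn _ _ hx,
        solφ_congr (hF.add_left e e' g) 0 0 hx]
      simpa using solφ_add hA.cont (hb e g).cont (hb e' g).cont 0 0 0 0 hx)
    (fun c e g => M2.ext_on fun x hx => by
      rw [M2.fn_smul, Pi.smul_apply, hfn _ _ hx, hfn _ _ hx,
        solφ_congr (hF.smul_left c e g) 0 0 hx]
      simpa using solφ_smul (A := A) (g := F e g) c 0 0 x)
    (fun e g g' => M2.ext_on fun x hx => by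
      rw [M2.fn_add, Pi.add_apply, hfn _ _ hx, hfn _ _ hx, hfn _ _ hx,
        solφ_congr (hF.add_right e g g') 0 0 hx]
      simpa using solφ_add hA.cont (hb e g).cont (hb e g').cont 0 0 0 0 hx)
    (fun c e g => M2.ext_on fun x hx => by
      rw [M2.fn_smul, Pi.smul_apply, hfn _ _ hx, hfn _ _ hx,
        solφ_congr (hF.smul_right c e g) 0 0 hx]
      simpa using solφ_smul (A := A) (g := F e g) c 0 0 x)
  refine ⟨B₀.mkContinuous₂ (3 * (K * c)) fun e g => ?_, fun e g => hfn e g⟩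
  refine (M2.norm_mk_le (hM 0 0 _ _ (hb e g))).trans (le_of_eq ?_)
  rw [abs_zero]
  ring

end bilinear

/-! ### The triple integral -/

section edge

variable {k : ℝ → ℝ} {r C : ℝ}

theorem intervalIntegrable_one_sub_rpow (hr : r < 1) (a b : ℝ) :
    IntervalIntegrable (fun s : ℝ => (1 - s) ^ (-r)) MeasureTheory.volume a b := by
  have := (intervalIntegral.intervalIntegrable_rpow' (a := 1 - a) (b := 1 - b)
    (show -1 < -r by linarith)).comp_sub_left 1
  simpa using this

theorem abs_le_one_sub_rpow (hr0 : 0 ≤ r) (hC : 0 ≤ C)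
    (hb : ∀ x ∈ Dom, |k x| ≤ C * weight (-r) x) {s : ℝ} (hs : s ∈ Ico (0 : ℝ) 1) :
    |k s| ≤ C * (1 - s) ^ (-r) := by
  refine (hb s (Ico_subset_Dom hs)).trans ?_
  gcongr
  exact Real.rpow_le_rpow_of_nonpos (by linarith [hs.2]) (by nlinarith [hs.1, hs.2]) (by linarith)

theorem intervalIntegrable_zero_one (hk : ContinuousOn k Dom) (hr0 : 0 ≤ r) (hr : r < 1)
    (hb : ∀ x ∈ Dom, |k x| ≤ C * weight (-r) x) :
    IntervalIntegrable k MeasureTheory.volume 0 1 := by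
  have hC : 0 ≤ C := by
    have := (abs_nonneg _).trans (hb 0 zero_mem_Dom)
    rwa [weight_at_zero, mul_one] at this
  rw [intervalIntegrable_iff, uIoc_of_le zero_le_one,
    integrableOn_Ioc_iff_integrableOn_Ioo]
  have hg := (intervalIntegrable_one_sub_rpow hr 0 1).const_mul C
  rw [intervalIntegrable_iff, uIoc_of_le zero_le_one,
    integrableOn_Ioc_iff_integrableOn_Ioo] at hg
  refine MeasureTheory.Integrable.mono' hg
    ((hk.mono fun x hx => ⟨by linarith [hx.1], hx.2⟩).aestronglyMeasurable measurableSet_Ioo) ?_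
  filter_upwards [MeasureTheory.ae_restrict_mem measurableSet_Ioo] with s hs
  exact abs_le_one_sub_rpow hr0 hC hb ⟨hs.1.le, hs.2⟩

/-- On [0,1) one has 1 - x² ≥ 1 - x, so the integrand is dominated by the power (1-s)^{-r}, which is
integrable up to 1 because r < 1. Its integral over (x,1) is of order (1-x)^{1-r}. -/
theorem abs_integral_one_sub_le (hk : ContinuousOn k Dom) (hr0 : 0 ≤ r) (hr : r < 1)
    (hb : ∀ x ∈ Dom, |k x| ≤ C * weight (-r) x) {x : ℝ} (hx : x ∈ Ico (0 : ℝ) 1) :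
    |(∫ s in (0 : ℝ)..1, k s) - ∫ s in (0 : ℝ)..x, k s| ≤ C / (1 - r) * weight (1 - r) x := by
  have hC : 0 ≤ C := by
    have := (abs_nonneg _).trans (hb 0 zero_mem_Dom)
    rwa [weight_at_zero, mul_one] at this
  have i1 := intervalIntegrable_zero_one hk hr0 hr hb
  have ix := intervalIntegrable_of_continuousOn_Dom hk (Ico_subset_Dom hx)
  rw [intervalIntegral.integral_interval_sub_left i1 ix]
  have hle : |∫ s in x..1, k s| ≤ ∫ s in x..1, C * (1 - s) ^ (-r) := by
    refine intervalIntegral.norm_integral_le_of_norm_le (f := k) hx.2.le ?_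
      ((intervalIntegrable_one_sub_rpow hr x 1).const_mul C)
    have : ∀ᵐ s : ℝ, s ≠ 1 := by
      simp [MeasureTheory.ae_iff]
    filter_upwards [this] with s hs1 hs
    exact abs_le_one_sub_rpow hr0 hC hb ⟨hx.1.trans hs.1.le, lt_of_le_of_ne hs.2 hs1⟩
  refine hle.trans ?_
  have h1 : 0 < 1 - r := by linarith
  have e : (∫ s in x..1, C * (1 - s) ^ (-r)) = C / (1 - r) * (1 - x) ^ (1 - r) := by
    rw [intervalIntegral.integral_const_mul,
      intervalIntegral.integral_comp_sub_left (fun s : ℝ => s ^ (-r)) 1,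
      integral_rpow (Or.inl (by linarith))]
    rw [show -r + 1 = 1 - r by ring, sub_self, Real.zero_rpow h1.ne']
    ring
  rw [e]
  gcongr
  exact Real.rpow_le_rpow (by linarith [hx.2]) (by nlinarith [hx.1, hx.2]) h1.le

theorem continuousOn_comp_neg (hk : ContinuousOn k Dom) : ContinuousOn (fun s => k (-s)) Dom :=
  hk.comp continuousOn_neg fun _ hx => neg_mem_Dom hx

theorem integral_zero_neg (k : ℝ → ℝ) (x : ℝ) :
    (∫ s in (0 : ℝ)..(-x), k s) = -∫ s in (0 : ℝ)..x, k (-s) := by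
  have h2 := intervalIntegral.integral_comp_neg (a := 0) (b := x) k
  rw [neg_zero] at h2
  rw [h2, intervalIntegral.integral_symm]

theorem intervalIntegrable_Icc (hk : ContinuousOn k Dom) (hr0 : 0 ≤ r) (hr : r < 1)
    (hb : ∀ x ∈ Dom, |k x| ≤ C * weight (-r) x) {x : ℝ} (hx : x ∈ Icc (-1 : ℝ) 1) :
    IntervalIntegrable k MeasureTheory.volume 0 x := by
  rcases eq_or_lt_of_le hx.2 with rfl | h2
  · exact intervalIntegrable_zero_one hk hr0 hr hb
  rcases eq_or_lt_of_le hx.1 with rfl | h1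
  · have := intervalIntegrable_zero_one (continuousOn_comp_neg hk) hr0 hr (C := C)
      (fun x hx => by simpa [weight_neg] using hb (-x) (neg_mem_Dom hx))
    have h' := (IntervalIntegrable.iff_comp_neg (f := fun s => k (-s)) (by simp)).1 this
    simpa using h'
  · exact intervalIntegrable_of_continuousOn_Dom hk ⟨h1, h2⟩

/-- A primitive, corrected by a quadratic polynomial so that it vanishes at `±1`. -/
theorem abs_corrected_primitive_le (hk : ContinuousOn k Dom) (hr0 : 0 ≤ r) (hr : r < 1)
    (hb : ∀ x ∈ Dom, |k x| ≤ C * weight (-r) x) {F : ℝ → ℝ}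
    (hF : ∀ x, F x = ∫ s in (0 : ℝ)..x, k s) :
    |F 1| ≤ C / (1 - r) ∧ |F (-1)| ≤ C / (1 - r) ∧ ∀ x ∈ Dom,
      |F x - F (-1) * (1 - x) / 2 - F 1 * (1 + x) / 2 + (F 1 + F (-1)) / 2 * (1 - x ^ 2)| ≤
        3 * (C / (1 - r)) * weight (1 - r) x := by
  have hb' : ∀ x ∈ Dom, |k (-x)| ≤ C * weight (-r) x := fun x hx => by
    simpa [weight_neg] using hb (-x) (neg_mem_Dom hx)
  have R : ∀ x ∈ Ico (0 : ℝ) 1, |F 1 - F x| ≤ C / (1 - r) * weight (1 - r) x := fun x hx => by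
    rw [hF, hF]; exact abs_integral_one_sub_le hk hr0 hr hb hx
  have L : ∀ x ∈ Ico (0 : ℝ) 1, |F (-1) - F (-x)| ≤ C / (1 - r) * weight (1 - r) x := by
    intro x hx
    rw [hF, hF, integral_zero_neg, integral_zero_neg, neg_sub_neg, abs_sub_comm]
    exact abs_integral_one_sub_le (continuousOn_comp_neg hk) hr0 hr hb' hx
  have hF0 : F 0 = 0 := by rw [hF]; simp
  have F1 : |F 1| ≤ C / (1 - r) := by
    simpa [hF0, weight_at_zero] using R 0 ⟨le_rfl, one_pos⟩
  have F2 : |F (-1)| ≤ C / (1 - r) := by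
    simpa [hF0, weight_at_zero] using L 0 ⟨le_rfl, one_pos⟩
  refine ⟨F1, F2, fun x hx => ?_⟩
  have hD0 : 0 ≤ C / (1 - r) := (abs_nonneg _).trans F1
  have hw : 1 - x ^ 2 ≤ weight (1 - r) x := by
    rw [← weight_one]; exact weight_le_weight (by linarith) hx
  have hpos := one_sub_sq_pos hx
  have hS : |(F 1 + F (-1)) / 2| ≤ C / (1 - r) := by
    rw [abs_le] at *; constructor <;> linarith [F1.1, F1.2, F2.1, F2.2]
  have hDf : |(F 1 - F (-1)) / 2| ≤ C / (1 - r) := by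
    rw [abs_le] at *; constructor <;> linarith [F1.1, F1.2, F2.1, F2.2]
  -- Expanded about the nearer end point, the corrected primitive consists of F(x) - F(±1) and
  -- multiples of 1 ∓ x and 1 - x². On the corresponding half of the interval 1 ∓ x ≤ 1 - x² ≤
  -- (1-x²)^{1-r}.
  have key : ∀ a b : ℝ, |a| ≤ C / (1 - r) → |b| ≤ 1 - x ^ 2 →
      |a * b| ≤ C / (1 - r) * weight (1 - r) x := fun a b ha hb => by
    rw [abs_mul]; exact mul_le_mul ha (hb.trans hw) (abs_nonneg _) hD0
  have k3 := key _ (1 - x ^ 2) hS (abs_of_pos hpos).le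
  rcases le_total 0 x with h0 | h0
  · have k1 := R x ⟨h0, hx.2⟩
    have k2 := key _ (1 - x) hDf (by rw [abs_of_pos (by linarith [hx.2])]; nlinarith [hx.2])
    have e : F x - F (-1) * (1 - x) / 2 - F 1 * (1 + x) / 2 + (F 1 + F (-1)) / 2 * (1 - x ^ 2) =
        -(F 1 - F x) + ((F 1 - F (-1)) / 2) * (1 - x) + (F 1 + F (-1)) / 2 * (1 - x ^ 2) := by ring
    rw [e]
    refine (abs_add_le _ _).trans (le_trans (add_le_add ((abs_add_le _ _).trans
      (add_le_add (abs_neg _).le le_rfl)) le_rfl) ?_)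
    linarith
  · have k1 := L (-x) ⟨by linarith, by linarith [hx.1]⟩
    rw [neg_neg, weight_neg] at k1
    have k2 := key _ (1 + x) hDf (by rw [abs_of_pos (by linarith [hx.1])]; nlinarith [hx.1])
    have e : F x - F (-1) * (1 - x) / 2 - F 1 * (1 + x) / 2 + (F 1 + F (-1)) / 2 * (1 - x ^ 2) =
        -(F (-1) - F x) + -(((F 1 - F (-1)) / 2) * (1 + x)) + (F 1 + F (-1)) / 2 * (1 - x ^ 2) := by
      ring
    rw [e]
    refine (abs_add_le _ _).trans (le_trans (add_le_add ((abs_add_le _ _).trans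
      (add_le_add (abs_neg _).le (abs_neg _).le)) le_rfl) ?_)
    linarith

end edge

/-- `∫₀ˣ ∫₀ˡ ∫₀ᵗ k`. -/
noncomputable def triple (k : ℝ → ℝ) (x : ℝ) : ℝ :=
  ∫ l in (0 : ℝ)..x, ∫ t in (0 : ℝ)..l, ∫ s in (0 : ℝ)..t, k s

theorem psi_eq_triple (f g : ℝ → ℝ) :
    psi f g = triple fun s => 2 * f s * deriv g s / (1 - s ^ 2) := rfl

/-- The integrands for which `triple` is defined up to the end points. -/
structure TripleSrc (ε : ℝ) (k : ℝ → ℝ) (C : ℝ) : Prop where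
  cont : ContinuousOn k Dom
  bound : ∀ x ∈ Dom, |k x| ≤ C * weight (-1 - (1 + 2 * ε)) x

section triple

variable {ε : ℝ} {k k' : ℝ → ℝ} {C C' : ℝ}

theorem integral_congr_Icc (h : EqOn k k' Dom) {x : ℝ} (hx : x ∈ Icc (-1 : ℝ) 1) :
    (∫ s in (0 : ℝ)..x, k s) = ∫ s in (0 : ℝ)..x, k' s := by
  refine intervalIntegral.integral_congr_uIoo fun s hs => h ⟨?_, ?_⟩
  · exact lt_of_le_of_lt (le_min (by norm_num) hx.1) hs.1
  · exact lt_of_lt_of_le hs.2 (max_le (by norm_num) hx.2)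

theorem triple_congr (h : EqOn k k' Dom) {x : ℝ} (hx : x ∈ Icc (-1 : ℝ) 1) :
    triple k x = triple k' x :=
  integral_congr_Icc (fun _ hl => integral_congr_Icc
    (fun _ ht => integral_congr_Icc h (Ioo_subset_Icc_self ht)) (Ioo_subset_Icc_self hl)) hx

/-- Each integration gains one power of 1 - x². After two of them the exponent is -2ε > -1, so the
third integral converges up to ±1, where ψ has to be evaluated. -/
theorem TripleSrc.abs_integral_le (hε : 0 < ε) (h : TripleSrc ε k C) {x : ℝ} (hx : x ∈ Dom) :
    |∫ s in (0 : ℝ)..x, k s| ≤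
      C * (Real.exp (2 * (1 + 2 * ε)) / (2 * (1 + 2 * ε))) * weight (-(1 + 2 * ε)) x :=
  abs_integral_le_weight (by linarith) h.cont h.bound hx

theorem TripleSrc.abs_integral2_le (hε : 0 < ε) (h : TripleSrc ε k C) {x : ℝ} (hx : x ∈ Dom) :
    |∫ t in (0 : ℝ)..x, ∫ s in (0 : ℝ)..t, k s| ≤
      C * (Real.exp (2 * (1 + 2 * ε)) / (2 * (1 + 2 * ε))) *
        (Real.exp (2 * (2 * ε)) / (2 * (2 * ε))) * weight (-(2 * ε)) x :=
  abs_integral_le_weight (by linarith) (continuousOn_integral h.cont) (fun y hy => by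
    rw [show -1 - 2 * ε = -(1 + 2 * ε) by ring]; exact h.abs_integral_le hε hy) hx

theorem TripleSrc.continuousOn2 (h : TripleSrc ε k C) :
    ContinuousOn (fun x => ∫ t in (0 : ℝ)..x, ∫ s in (0 : ℝ)..t, k s) Dom :=
  continuousOn_integral (continuousOn_integral h.cont)

theorem TripleSrc.hasDerivAt (h : TripleSrc ε k C) {x : ℝ} (hx : x ∈ Dom) :
    HasDerivAt (triple k) (∫ t in (0 : ℝ)..x, ∫ s in (0 : ℝ)..t, k s) x :=
  hasDerivAt_integral h.continuousOn2 hx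

theorem TripleSrc.hasDerivAt2 (h : TripleSrc ε k C) {x : ℝ} (hx : x ∈ Dom) :
    HasDerivAt (fun x => ∫ t in (0 : ℝ)..x, ∫ s in (0 : ℝ)..t, k s)
      (∫ s in (0 : ℝ)..x, k s) x :=
  hasDerivAt_integral (continuousOn_integral h.cont) hx

/-- The end points ±1 are included because the quadratic correction contains the values there; this
requires integrability of the double integral up to ±1. -/
theorem triple_add (hε : 0 < ε ∧ ε < 1 / 2) (h : TripleSrc ε k C) (h' : TripleSrc ε k' C') {x : ℝ}
    (hx : x ∈ Icc (-1 : ℝ) 1) : triple (k + k') x = triple k x + triple k' x := by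
  have e1 : ∀ t ∈ Dom, (∫ s in (0 : ℝ)..t, (k + k') s) =
      (∫ s in (0 : ℝ)..t, k s) + ∫ s in (0 : ℝ)..t, k' s := fun t ht =>
    intervalIntegral.integral_add (intervalIntegrable_of_continuousOn_Dom h.cont ht)
      (intervalIntegrable_of_continuousOn_Dom h'.cont ht)
  have e2 : ∀ l ∈ Dom, (∫ t in (0 : ℝ)..l, ∫ s in (0 : ℝ)..t, (k + k') s) =
      (∫ t in (0 : ℝ)..l, ∫ s in (0 : ℝ)..t, k s) +
        ∫ t in (0 : ℝ)..l, ∫ s in (0 : ℝ)..t, k' s := fun l hl => by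
    rw [integral_congr_Icc e1 (Ioo_subset_Icc_self hl)]
    exact intervalIntegral.integral_add
      (intervalIntegrable_of_continuousOn_Dom (continuousOn_integral h.cont) hl)
      (intervalIntegrable_of_continuousOn_Dom (continuousOn_integral h'.cont) hl)
  simp only [triple]
  rw [integral_congr_Icc e2 hx]
  exact intervalIntegral.integral_add
    (intervalIntegrable_Icc h.continuousOn2 (by linarith) (by linarith)
      (fun x hx => h.abs_integral2_le hε.1 hx) hx)
    (intervalIntegrable_Icc h'.continuousOn2 (by linarith) (by linarith)
      (fun x hx => h'.abs_integral2_le hε.1 hx) hx)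

theorem triple_smul (c : ℝ) (k : ℝ → ℝ) (x : ℝ) : triple (c • k) x = c * triple k x := by
  simp only [triple, Pi.smul_apply, smul_eq_mul, intervalIntegral.integral_const_mul]

end triple

/-- `triple k`, corrected by a quadratic polynomial so that it vanishes at `0` and `±1`. -/
noncomputable def triple0 (k : ℝ → ℝ) (x : ℝ) : ℝ :=
  triple k x - triple k (-1) * (1 - x) / 2 - triple k 1 * (1 + x) / 2 +
    (triple k 1 + triple k (-1)) / 2 * (1 - x ^ 2)

theorem BC_quadratic (a b c : ℝ) : BC 2 (fun x => a + b * x + c * x ^ 2) (|a| + |b| + 2 * |c|) := by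
  have na := abs_nonneg a
  have nb := abs_nonneg b
  have nc := abs_nonneg c
  have hx1 : ∀ x ∈ Mid, |x| ≤ 1 := fun x hx => by
    rw [abs_le]; constructor <;> linarith [hx.1, hx.2]
  refine BC.of_hasDerivAt (g := fun x => b + 2 * c * x) (fun x hx => ?_) (fun x _ => ?_)
    (BC.of_hasDerivAt (g := fun _ => 2 * c) (fun x hx => ?_) (fun x _ => ?_)
    ⟨fun x _ => ?_, continuousOn_const⟩)
  · have h1 := hx1 x hx
    have h2 : |x ^ 2| ≤ 1 := by rw [abs_pow]; exact pow_le_one₀ (abs_nonneg x) h1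
    refine (abs_add_le _ _).trans ((add_le_add (abs_add_le _ _) le_rfl).trans ?_)
    rw [abs_mul, abs_mul]
    nlinarith [mul_le_of_le_one_right nb h1, mul_le_of_le_one_right nc h2]
  · exact ((((hasDerivAt_id x).const_mul b).const_add a).add
      (((hasDerivAt_id x).pow 2).const_mul c)).congr_deriv (by simp; ring)
  · have h1 := hx1 x hx
    refine (abs_add_le _ _).trans ?_
    rw [abs_mul, abs_mul, abs_two]
    nlinarith [mul_le_of_le_one_right nc h1]
  · exact (((hasDerivAt_id x).const_mul (2 * c)).const_add b).congr_deriv (by simp)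
  · rw [abs_mul, abs_two]; linarith

theorem weight_le_two_of_mem_Mid {r x : ℝ} (hr : r ≤ 2) (hx : x ∈ Mid) : weight (-r) x ≤ 2 := by
  refine (weight_le_weight (show -2 ≤ -r by linarith) (Mid_subset_Dom hx)).trans ?_
  have h3 : (3 : ℝ) / 4 ≤ 1 - x ^ 2 := by nlinarith [hx.1, hx.2]
  rw [weight, Real.rpow_neg (by linarith), Real.rpow_ofNat]
  have : (3 / 4 : ℝ) ^ 2 ≤ (1 - x ^ 2) ^ 2 := by gcongr
  exact (inv_anti₀ (by norm_num) this).trans (by norm_num)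

/-- The order 1 - 2ε is `abs_corrected_primitive_le` with r = 2ε, applied to the double integral. On
`Mid` the first two derivatives of the triple integral are the double and the single integral, which
are already estimated. -/
theorem exists_Srcθ_triple0 {ε : ℝ} (hε : 0 < ε ∧ ε < 1 / 2) :
    ∃ K, 0 ≤ K ∧ ∀ k C, TripleSrc ε k C → Srcθ ε (triple0 k) (K * C) := by
  have hε0 := hε.1
  have hε1 := hε.2
  set a := Real.exp (2 * (1 + 2 * ε)) / (2 * (1 + 2 * ε)) with ha
  set b := Real.exp (2 * (2 * ε)) / (2 * (2 * ε)) with hb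
  have na : 0 ≤ a := by positivity
  have nb : 0 ≤ b := by positivity
  have h1 : 0 < 1 - 2 * ε := by linarith
  set d := a * b / (1 - 2 * ε) with hd
  have nd : 0 ≤ d := by positivity
  refine ⟨(4 * d + 2 * (a * b) + 2 * a) + 8 * d, by positivity, fun k C h => ?_⟩
  have nC : 0 ≤ C := by
    have := (abs_nonneg _).trans (h.bound 0 zero_mem_Dom)
    rwa [weight_at_zero, mul_one] at this
  have hb2 := fun x (hx : x ∈ Dom) => h.abs_integral2_le hε0 hx
  obtain ⟨F1, F2, F0⟩ := abs_corrected_primitive_le h.continuousOn2 (by linarith) (by linarith) hb2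
    (F := triple k) (fun x => rfl)
  rw [← ha, ← hb] at F1 F2 F0
  have ed : C * a * b / (1 - 2 * ε) = d * C := by rw [hd]; ring
  rw [ed] at F1 F2 F0
  have hcd : ∀ x ∈ Dom, HasDerivAt (triple k) _ x := fun x hx => h.hasDerivAt hx
  have hct : ContinuousOn (triple k) Dom := continuousOn_of_hasDerivAt hcd
  have hc0 : ContinuousOn (triple0 k) Dom := by
    unfold triple0
    fun_prop
  have hq := BC_quadratic (-triple k (-1) / 2 - triple k 1 / 2 + (triple k 1 + triple k (-1)) / 2)
    (triple k (-1) / 2 - triple k 1 / 2) (-((triple k 1 + triple k (-1)) / 2))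
  have hq' : |(-triple k (-1) / 2 - triple k 1 / 2 + (triple k 1 + triple k (-1)) / 2)| +
    |(triple k (-1) / 2 - triple k 1 / 2)| + 2 * |(-((triple k 1 + triple k (-1)) / 2))| ≤
      3 * (d * C) := by
    have e0 : -triple k (-1) / 2 - triple k 1 / 2 + (triple k 1 + triple k (-1)) / 2 = 0 := by ring
    have e1 : |triple k (-1) / 2 - triple k 1 / 2| ≤ d * C := by
      rw [abs_le] at *; constructor <;> linarith [F1.1, F1.2, F2.1, F2.2]
    have e2 : |(triple k 1 + triple k (-1)) / 2| ≤ d * C := by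
      rw [abs_le] at *; constructor <;> linarith [F1.1, F1.2, F2.1, F2.2]
    rw [e0, abs_zero, abs_neg]
    linarith
  refine ⟨hc0, fun x hx => ?_, ?_⟩
  · refine (F0 x hx).trans ?_
    have hw := weight_pos (1 - 2 * ε) hx
    rw [← mul_assoc]
    gcongr ?_ * C * _
    have : 0 ≤ a * b := by positivity
    linarith
  · have hdC : 0 ≤ d * C := by positivity
    have habC : 0 ≤ a * b * C := by positivity
    have haC : 0 ≤ a * C := by positivity
    have m : BC 2 (triple k) ((4 * d + 2 * (a * b) + 2 * a) * C + 4 * d * C) := by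
      refine BC.of_hasDerivAt (fun x hx => ?_) (fun x hx => h.hasDerivAt (Mid_subset_Dom hx))
        (BC.of_hasDerivAt (fun x hx => ?_) (fun x hx => h.hasDerivAt2 (Mid_subset_Dom hx))
          ⟨fun x hx => ?_, (continuousOn_integral h.cont).mono Mid_subset_Dom⟩)
      · have g1 := F0 x (Mid_subset_Dom hx)
        have g2 := (hq.mono hq').abs_le x hx
        have hw := weight_le_one (r := 1 - 2 * ε) (by linarith) (Mid_subset_Dom hx)
        have g3 : 3 * (d * C) * weight (1 - 2 * ε) x ≤ 3 * (d * C) :=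
          mul_le_of_le_one_right (by positivity) hw
        -- The bound of the uncorrected triple integral on `Mid` is recovered from that of the
        -- corrected one by removing the quadratic polynomial, hence 6 = 3 + 3.
        have g4 : ∀ p q : ℝ, |p + q| ≤ 3 * (d * C) → |q| ≤ 3 * (d * C) → |p| ≤ 6 * (d * C) := by
          intro p q hp hq
          rw [abs_le] at *; constructor <;> linarith [hp.1, hp.2, hq.1, hq.2]
        refine (g4 (triple k x) _ ?_ g2).trans (by linarith)
        refine le_trans (le_of_eq ?_) (g1.trans g3)
        congr 1
        ring
      · refine (hb2 x (Mid_subset_Dom hx)).trans ?_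
        have hw := weight_le_two_of_mem_Mid (r := 2 * ε) (by linarith) hx
        have : C * a * b * weight (-(2 * ε)) x ≤ C * a * b * 2 := by gcongr
        refine this.trans ?_
        linarith
      · refine (h.abs_integral_le hε0 (Mid_subset_Dom hx)).trans ?_
        have hw := weight_le_two_of_mem_Mid (r := 1 + 2 * ε) (by linarith) hx
        have : C * a * weight (-(1 + 2 * ε)) x ≤ C * a * 2 := by gcongr
        refine this.trans ?_
        linarith
    refine ((m.add hq).congr fun x _ => ?_).mono ?_
    · simp only [triple0]; ring
    · linarith

/-! ### The correction of `ψ` as a bilinear operation on `M₂` -/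

/-- `ψ[v, w]`, corrected by a quadratic polynomial so that it vanishes at `0` and `±1`. -/
noncomputable def Psi0 (f g : ℝ → ℝ) (x : ℝ) : ℝ :=
  psi f g x - psi f g (-1) * (1 - x) / 2 - psi f g 1 * (1 + x) / 2 +
    (psi f g 1 + psi f g (-1)) / 2 * (1 - x ^ 2)

theorem triple0_congr {k k' : ℝ → ℝ} (h : EqOn k k' Dom) : EqOn (triple0 k) (triple0 k') Dom := by
  intro x hx
  simp only [triple0]
  rw [triple_congr h (Ioo_subset_Icc_self hx), triple_congr h (x := -1) (by constructor <;> norm_num),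
    triple_congr h (x := 1) (by constructor <;> norm_num)]

theorem triple0_add {ε : ℝ} (hε : 0 < ε ∧ ε < 1 / 2) {k k' : ℝ → ℝ} {C C' : ℝ}
    (h : TripleSrc ε k C) (h' : TripleSrc ε k' C') :
    EqOn (triple0 (k + k')) (triple0 k + triple0 k') Dom := by
  intro x hx
  simp only [triple0, Pi.add_apply]
  rw [triple_add hε h h' (Ioo_subset_Icc_self hx),
    triple_add hε h h' (x := -1) (by constructor <;> norm_num),
    triple_add hε h h' (x := 1) (by constructor <;> norm_num)]
  ring

theorem triple0_smul (c : ℝ) (k : ℝ → ℝ) : triple0 (c • k) = c • triple0 k := by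
  funext x
  simp only [triple0, Pi.smul_apply, smul_eq_mul, triple_smul]
  ring

theorem psi_congr {f f' g g' : ℝ → ℝ} (hf : EqOn f f' Dom) (hg : EqOn g g' Dom) {x : ℝ}
    (hx : x ∈ Icc (-1 : ℝ) 1) : psi f g x = psi f' g' x :=
  triple_congr (fun s hs => by simp only [hf hs, deriv_congr_on isOpen_Ioo hg hs]) hx

/-- The orders -ε of v, -(1+ε) of w' and -1 of the denominator add up to -1 - (1+2ε). -/
theorem M2.tripleSrc {ε : ℝ} (v w : M2 ε) :
    TripleSrc ε (fun s => 2 * v.fn s * deriv w.fn s / (1 - s ^ 2)) (2 * (‖v‖ * ‖w‖)) := by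
  refine ⟨continuousOn_div_one_sub_sq ((continuousOn_const.mul v.continuousOn).mul
    w.continuousOn_deriv), fun x hx => ?_⟩
  have h1 := one_sub_sq_pos hx
  rw [abs_div, abs_of_pos h1, div_le_iff₀ h1, abs_mul, abs_mul, abs_two]
  have e : weight (-ε) x * weight (-(1 + ε)) x = weight (-1 - (1 + 2 * ε)) x * (1 - x ^ 2) := by
    rw [← weight_add _ _ hx, mul_comm, one_sub_sq_mul_weight _ hx]
    congr 1
    ring
  calc 2 * |v.fn x| * |deriv w.fn x| ≤ 2 * (‖v‖ * weight (-ε) x) * (‖w‖ * weight (-(1 + ε)) x) := by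
        have := weight_pos (-ε) hx
        gcongr
        exacts [v.abs_le hx, w.abs_deriv_le hx]
    _ = 2 * (‖v‖ * ‖w‖) * (weight (-ε) x * weight (-(1 + ε)) x) := by ring
    _ = _ := by rw [e]; ring

theorem M2.deriv_add {ε : ℝ} (v w : M2 ε) {x : ℝ} (hx : x ∈ Dom) :
    deriv (v + w).fn x = deriv v.fn x + deriv w.fn x :=
  ((v.hasDerivAt hx).add (w.hasDerivAt hx)).deriv

theorem M2.deriv_smul {ε : ℝ} (c : ℝ) (v : M2 ε) {x : ℝ} (hx : x ∈ Dom) :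
    deriv (c • v).fn x = c * deriv v.fn x :=
  ((v.hasDerivAt hx).const_smul c).deriv

theorem bilinOn_Psi0 {ε : ℝ} (hε : 0 < ε ∧ ε < 1 / 2) :
    BilinOn fun v w : M2 ε => Psi0 v.fn w.fn := by
  refine ⟨fun v v' w => ?_, fun c v w => ?_, fun v w w' => ?_, fun c v w => ?_⟩
  · refine EqOn.trans (triple0_congr fun s hs => ?_)
      (triple0_add hε (M2.tripleSrc v w) (M2.tripleSrc v' w))
    simp only [Pi.add_apply, M2.fn_add]
    ring
  · refine EqOn.trans (triple0_congr fun s hs => ?_) fun x _ => congrFun (triple0_smul c _) x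
    simp only [Pi.smul_apply, M2.fn_smul, smul_eq_mul]
    ring
  · refine EqOn.trans (triple0_congr fun s hs => ?_)
      (triple0_add hε (M2.tripleSrc v w) (M2.tripleSrc v w'))
    simp only [Pi.add_apply, M2.deriv_add w w' hs]
    ring
  · refine EqOn.trans (triple0_congr fun s hs => ?_) fun x _ => congrFun (triple0_smul c _) x
    simp only [Pi.smul_apply, M2.deriv_smul c w hs, smul_eq_mul]
    ring

theorem exists_Srcθ_Psi0 {ε : ℝ} (hε : 0 < ε ∧ ε < 1 / 2) :
    ∃ c, ∀ v w : M2 ε, Srcθ ε (Psi0 v.fn w.fn) (c * ‖v‖ * ‖w‖) := by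
  obtain ⟨K, _, hK⟩ := exists_Srcθ_triple0 hε
  refine ⟨K * 2, fun v w => ?_⟩
  have := hK _ _ (M2.tripleSrc v w)
  rwa [show K * (2 * (‖v‖ * ‖w‖)) = K * 2 * ‖v‖ * ‖w‖ by ring] at this

/-! ### The reduced system in normal form -/

/-- The data of a solution: the values of `U_θ` at `∓1`, the constant `f` of the first equation,
and `w(0)`, `v(0)`, `v'(0)`. -/
abbrev Dat : Type := (ℝ × ℝ) × ℝ × ℝ × ℝ × ℝ

/-- The affine function with the values `m.1` and `m.2` at `-1` and `1`. -/
noncomputable def aff (m : ℝ × ℝ) (x : ℝ) : ℝ := m.1 * (1 - x) / 2 + m.2 * (1 + x) / 2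

theorem aff_add (m m' : ℝ × ℝ) (x : ℝ) : aff (m + m') x = aff m x + aff m' x := by
  simp only [aff, Prod.fst_add, Prod.snd_add]; ring

theorem aff_smul (c : ℝ) (m : ℝ × ℝ) (x : ℝ) : aff (c • m) x = c * aff m x := by
  simp only [aff, Prod.smul_fst, Prod.smul_snd, smul_eq_mul]; ring

theorem aff_neg_one (m : ℝ × ℝ) : aff m (-1) = m.1 := by simp only [aff]; ring

theorem aff_one (m : ℝ × ℝ) : aff m 1 = m.2 := by simp only [aff]; ring

theorem continuous_aff (m : ℝ × ℝ) : Continuous (aff m) := by unfold aff; fun_prop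

theorem abs_aff_le (m : ℝ × ℝ) {x : ℝ} (hx : x ∈ Dom) : |aff m x| ≤ ‖m‖ := by
  have h1 : |m.1| ≤ ‖m‖ := norm_fst_le m
  have h2 : |m.2| ≤ ‖m‖ := norm_snd_le m
  rw [abs_le] at *
  simp only [aff]
  constructor <;> nlinarith [hx.1, hx.2]

theorem BC_aff (m : ℝ × ℝ) : BC 2 (aff m) (2 * ‖m‖) := by
  have h1 : |m.1| ≤ ‖m‖ := norm_fst_le m
  have h2 : |m.2| ≤ ‖m‖ := norm_snd_le m
  refine ((BC_quadratic ((m.1 + m.2) / 2) ((m.2 - m.1) / 2) 0).congr fun x _ => ?_).mono ?_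
  · simp only [aff]; ring
  · rw [abs_zero]
    have e1 : |(m.1 + m.2) / 2| ≤ ‖m‖ := by
      rw [abs_le] at *; constructor <;> linarith [h1.1, h1.2, h2.1, h2.2]
    have e2 : |(m.2 - m.1) / 2| ≤ ‖m‖ := by
      rw [abs_le] at *; constructor <;> linarith [h1.1, h1.2, h2.1, h2.2]
    linarith

/-- `(aff q.1 + w, v)` solves the reduced system; the constants are encoded in `q`. -/
structure IsSol {ε : ℝ} (q : Dat) (w : M1 ε) (v : M2 ε) : Prop where
  eqθ : ∀ x ∈ Dom, (1 - x ^ 2) * deriv w.fn x + (2 * x + aff q.1 x) * w.fn x +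
    1 / 2 * w.fn x ^ 2 + Psi0 v.fn v.fn x = q.2.1 * (1 - x ^ 2)
  eqφ : ∀ x ∈ Dom, (1 - x ^ 2) * iteratedDeriv 2 v.fn x + (aff q.1 x + w.fn x) * deriv v.fn x = 0
  w_zero : w.fn 0 = q.2.2.1
  v_zero : v.fn 0 = q.2.2.2.1
  v_deriv_zero : deriv v.fn 0 = q.2.2.2.2

theorem M1.deriv_add {ε : ℝ} (v w : M1 ε) {x : ℝ} (hx : x ∈ Dom) :
    deriv (v + w).fn x = deriv v.fn x + deriv w.fn x :=
  ((v.hasDerivAt hx).add (w.hasDerivAt hx)).deriv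

theorem Psi0_zero_left (g : ℝ → ℝ) (x : ℝ) : Psi0 0 g x = 0 := by
  simp [Psi0, psi]

section Lin

variable {A u u' g g' : ℝ → ℝ} {k' k₀' k₀ k c : ℝ}

/-- `u` solves `(1 - x²) u' + (2x + A) u = g`, `u(0) = k` on `(-1,1)`. -/
structure Linθ (A u : ℝ → ℝ) (k : ℝ) (g : ℝ → ℝ) : Prop where
  cont : ContinuousOn g Dom
  eq : EqOn u (solθ A k g) Dom

/-- `u` solves `(1 - x²) u'' + A u' = g`, `u(0) = k₀`, `u'(0) = k` on `(-1,1)`. -/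
structure Linφ (A u : ℝ → ℝ) (k₀ k : ℝ) (g : ℝ → ℝ) : Prop where
  cont : ContinuousOn g Dom
  eq : EqOn u (solφ A k₀ k g) Dom

theorem Linθ.add (hA : ContinuousOn A Dom) (h : Linθ A u k g) (h' : Linθ A u' k' g') :
    Linθ A (u + u') (k + k') (g + g') :=
  ⟨h.cont.add h'.cont, fun x hx => by
    rw [Pi.add_apply, h.eq hx, h'.eq hx, solθ_add hA h.cont h'.cont k k' hx]⟩

theorem Linθ.smul (c : ℝ) (h : Linθ A u k g) : Linθ A (c • u) (c * k) (c • g) :=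
  ⟨h.cont.const_smul c, fun x hx => by rw [Pi.smul_apply, h.eq hx, solθ_smul, smul_eq_mul]⟩

theorem Linφ.add (hA : ContinuousOn A Dom) (h : Linφ A u k₀ k g) (h' : Linφ A u' k₀' k' g') :
    Linφ A (u + u') (k₀ + k₀') (k + k') (g + g') :=
  ⟨h.cont.add h'.cont, fun x hx => by
    rw [Pi.add_apply, h.eq hx, h'.eq hx, solφ_add hA h.cont h'.cont k₀ k₀' k k' hx]⟩

theorem Linφ.smul (c : ℝ) (h : Linφ A u k₀ k g) : Linφ A (c • u) (c * k₀) (c * k) (c • g) :=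
  ⟨h.cont.const_smul c, fun x hx => by rw [Pi.smul_apply, h.eq hx, solφ_smul, smul_eq_mul]⟩

theorem Linθ.solves (hA : ContinuousOn A Dom) (h : Linθ A u k g) {x : ℝ} (hx : x ∈ Dom) :
    (1 - x ^ 2) * deriv u x + (2 * x + A x) * u x = g x := by
  rw [deriv_congr_on isOpen_Ioo h.eq hx, (hasDerivAt_solθ hA h.cont hx).deriv, h.eq hx]
  have := (one_sub_sq_pos hx).ne'
  field_simp
  ring

theorem Linφ.solves (hA : ContinuousOn A Dom) (h : Linφ A u k₀ k g) {x : ℝ} (hx : x ∈ Dom) :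
    (1 - x ^ 2) * iteratedDeriv 2 u x + A x * deriv u x = g x := by
  rw [iteratedDeriv_congr_on isOpen_Ioo h.eq 2 hx, deriv_congr_on isOpen_Ioo h.eq hx,
    (hasDerivAt_solφ hA h.cont hx).deriv, iteratedDeriv_two_solφ hA h.cont hx]
  have := (one_sub_sq_pos hx).ne'
  field_simp
  ring

end Lin

theorem Srcθ_zero (ε : ℝ) : Srcθ ε 0 0 :=
  ⟨continuousOn_const, by simp,
    ((BC_quadratic 0 0 0).congr fun x _ => by simp).mono (by simp)⟩

theorem Srcφ_zero (ε : ℝ) : Srcφ ε 0 0 := ⟨continuousOn_const, by simp⟩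

theorem Srcθ_one_sub_sq {ε : ℝ} (hε : 0 < ε) : Srcθ ε (fun x => 1 - x ^ 2) 3 := by
  refine ⟨by fun_prop, fun x hx => ?_, ?_⟩
  · have h1 : 1 - x ^ 2 ≤ weight (1 - 2 * ε) x := by
      rw [← weight_one]; exact weight_le_weight (by linarith) hx
    have := one_sub_sq_pos hx
    rw [abs_of_pos this]
    linarith
  · refine ((BC_quadratic 1 0 (-1)).congr fun x _ => by ring).mono (by norm_num)

/-! ### The bilinear terms of the system. -/

section operators

variable {ε : ℝ}

theorem bilinOn_aff_mul : BilinOn fun (m : ℝ × ℝ) (u : M1 ε) => fun x => aff m x * u.fn x := by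
  refine ⟨fun m m' u x _ => ?_, fun c m u x _ => ?_, fun m u u' x _ => ?_, fun c m u x _ => ?_⟩
  · simp only [aff_add, Pi.add_apply]; ring
  · simp only [aff_smul, Pi.smul_apply, smul_eq_mul]; ring
  · simp only [M1.fn_add, Pi.add_apply]; ring
  · simp only [M1.fn_smul, Pi.smul_apply, smul_eq_mul]; ring

/-- The constant is 16 = 2² · 2 · 2, from `BC.mul`, `BC_aff` and `M1.mid`. -/
theorem Srcθ_aff_mul (hε : 0 < ε ∧ ε < 1 / 2) (m : ℝ × ℝ) (u : M1 ε) :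
    Srcθ ε (fun x => aff m x * u.fn x) (16 * ‖m‖ * ‖u‖) := by
  refine ⟨(continuous_aff m).continuousOn.mul u.continuousOn, fun x hx => ?_, ?_⟩
  · rw [abs_mul]
    have hw := weight_pos (1 - 2 * ε) hx
    calc |aff m x| * |u.fn x| ≤ ‖m‖ * (‖u‖ * weight (1 - 2 * ε) x) := by
          gcongr; exacts [abs_aff_le m hx, u.abs_le hx]
      _ = 1 * ‖m‖ * ‖u‖ * weight (1 - 2 * ε) x := by ring
      _ ≤ _ := by gcongr; norm_num
  · exact ((BC_aff m).mul (u.mid hε.1 hε.2).pred).mono (le_of_eq (by ring))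

theorem bilinOn_mul : BilinOn fun (u v : M1 ε) => fun x => u.fn x * v.fn x := by
  refine ⟨fun m m' u x _ => ?_, fun c m u x _ => ?_, fun m u u' x _ => ?_, fun c m u x _ => ?_⟩ <;>
  · simp only [M1.fn_add, M1.fn_smul, Pi.add_apply, Pi.smul_apply, smul_eq_mul]; ring

theorem Srcθ_mul (hε : 0 < ε ∧ ε < 1 / 2) (u v : M1 ε) :
    Srcθ ε (fun x => u.fn x * v.fn x) (16 * ‖u‖ * ‖v‖) := by
  refine ⟨u.continuousOn.mul v.continuousOn, fun x hx => ?_, ?_⟩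
  · rw [abs_mul]
    have hw := weight_pos (1 - 2 * ε) hx
    have hw1 := weight_le_one (r := 1 - 2 * ε) (by linarith [hε.2]) hx
    calc |u.fn x| * |v.fn x| ≤ (‖u‖ * 1) * (‖v‖ * weight (1 - 2 * ε) x) := by
          gcongr
          · exact (u.abs_le hx).trans (by gcongr)
          · exact v.abs_le hx
      _ = 1 * ‖u‖ * ‖v‖ * weight (1 - 2 * ε) x := by ring
      _ ≤ _ := by gcongr; norm_num
  · exact ((u.mid hε.1 hε.2).pred.mul (v.mid hε.1 hε.2).pred).mono (le_of_eq (by ring))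

theorem bilinOn_aff_mul_deriv :
    BilinOn fun (m : ℝ × ℝ) (v : M2 ε) => fun x => aff m x * deriv v.fn x := by
  refine ⟨fun m m' u x _ => ?_, fun c m u x _ => ?_, fun m u u' x hx => ?_, fun c m u x hx => ?_⟩
  · simp only [aff_add, Pi.add_apply]; ring
  · simp only [aff_smul, Pi.smul_apply, smul_eq_mul]; ring
  · simp only [M2.deriv_add u u' hx, Pi.add_apply]; ring
  · simp only [M2.deriv_smul c u hx, Pi.smul_apply, smul_eq_mul]; ring

theorem Srcφ_aff_mul_deriv (m : ℝ × ℝ) (v : M2 ε) :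
    Srcφ ε (fun x => aff m x * deriv v.fn x) (1 * ‖m‖ * ‖v‖) := by
  refine ⟨(continuous_aff m).continuousOn.mul v.continuousOn_deriv, fun x hx => ?_⟩
  rw [abs_mul, one_mul, mul_assoc]
  exact mul_le_mul (abs_aff_le m hx) (v.abs_deriv_le hx) (abs_nonneg _) (norm_nonneg _)

theorem bilinOn_mul_deriv :
    BilinOn fun (u : M1 ε) (v : M2 ε) => fun x => u.fn x * deriv v.fn x := by
  refine ⟨fun m m' u x _ => ?_, fun c m u x _ => ?_, fun m u u' x hx => ?_, fun c m u x hx => ?_⟩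
  · simp only [M1.fn_add, Pi.add_apply]; ring
  · simp only [M1.fn_smul, Pi.smul_apply, smul_eq_mul]; ring
  · simp only [M2.deriv_add u u' hx, Pi.add_apply]; ring
  · simp only [M2.deriv_smul c u hx, Pi.smul_apply, smul_eq_mul]; ring

theorem M1.abs_le_norm (hε : ε < 1 / 2) (u : M1 ε) {x : ℝ} (hx : x ∈ Dom) : |u.fn x| ≤ ‖u‖ :=
  (u.abs_le hx).trans (mul_le_of_le_one_right (norm_nonneg u) (weight_le_one (by linarith) hx))

theorem Srcφ_mul_deriv (hε : 0 < ε ∧ ε < 1 / 2) (u : M1 ε) (v : M2 ε) :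
    Srcφ ε (fun x => u.fn x * deriv v.fn x) (1 * ‖u‖ * ‖v‖) := by
  refine ⟨u.continuousOn.mul v.continuousOn_deriv, fun x hx => ?_⟩
  rw [abs_mul, one_mul, mul_assoc]
  exact mul_le_mul (u.abs_le_norm hε.2 hx) (v.abs_deriv_le hx) (abs_nonneg _) (norm_nonneg _)

end operators

theorem M1.tendsto_zero {ε : ℝ} (u : M1 ε) :
    Tendsto u.fn (𝓝[>] (-1 : ℝ)) (𝓝 0) ∧ Tendsto u.fn (𝓝[<] (1 : ℝ)) (𝓝 0) := by
  have hc := u.mem.2.2.2.1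
  have h1 : u.fn 1 = 0 := u.mem.1 1 (by simp)
  have h2 : u.fn (-1) = 0 := u.mem.1 (-1) (by simp)
  constructor
  · have := (hc (-1) (by constructor <;> norm_num)).mono
      (show Ioo (-1 : ℝ) 1 ⊆ Icc (-1) 1 from Ioo_subset_Icc_self)
    rwa [ContinuousWithinAt, h2, nhdsWithin_Ioo_eq_nhdsGT (by norm_num)] at this
  · have := (hc 1 (by constructor <;> norm_num)).mono
      (show Ioo (-1 : ℝ) 1 ⊆ Icc (-1) 1 from Ioo_subset_Icc_self)
    rwa [ContinuousWithinAt, h1, nhdsWithin_Ioo_eq_nhdsLT (by norm_num)] at this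

/-- Elements of M₁ vanish at ±1, so the coefficient has the end values of its affine part. -/
theorem good_aff_add {ε : ℝ} (hε : 0 < ε ∧ ε < 1 / 2) {m : ℝ × ℝ} (h1 : m.1 < 4 * ε)
    (h2 : -m.2 < 4 * ε) (w : M1 ε) : Good ε fun x => aff m x + w.fn x := by
  refine Good.of_tendsto hε ((continuous_aff m).continuousOn.add w.continuousOn)
    (s := m.1) (t := m.2) ?_ ?_ h1 h2 ⟨_, (BC_aff m).add (w.mid hε.1 hε.2).pred⟩
  · have := ((continuous_aff m).tendsto (-1)).mono_left (nhdsWithin_le_nhds (s := Ioi (-1)))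
    rw [aff_neg_one] at this
    simpa using this.add w.tendsto_zero.1
  · have := ((continuous_aff m).tendsto 1).mono_left (nhdsWithin_le_nhds (s := Iio 1))
    rw [aff_one] at this
    simpa using this.add w.tendsto_zero.2

/-- The derivative at `0` of a bounded bilinear expression. -/
theorem hasFDerivAt_bilinear_zero {Z E F G : Type*} [NormedAddCommGroup Z] [NormedSpace ℝ Z]
    [NormedAddCommGroup E] [NormedSpace ℝ E] [NormedAddCommGroup F] [NormedSpace ℝ F]
    [NormedAddCommGroup G] [NormedSpace ℝ G] (B : E →L[ℝ] F →L[ℝ] G) (a : Z →L[ℝ] E)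
    (b : Z →L[ℝ] F) : HasFDerivAt (fun z => B (a z) (b z)) (0 : Z →L[ℝ] G) 0 := by
  refine ((B.comp a).hasFDerivAt.clm_apply b.hasFDerivAt).congr_fderiv ?_
  ext z
  simp

/-- Fixed points depending analytically on a parameter. -/
theorem exists_fixedPoint {P Y : Type*} [NormedAddCommGroup P] [NormedSpace ℝ P] [CompleteSpace P]
    [NormedAddCommGroup Y] [NormedSpace ℝ Y] [CompleteSpace Y] {T : P × Y → Y}
    (hT : ContDiff ℝ ω T) (h0 : T 0 = 0) {L : P →L[ℝ] Y}
    (hL : HasFDerivAt T (L.comp (ContinuousLinearMap.fst ℝ P Y)) 0) :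
    ∃ S : P → Y, S 0 = 0 ∧ ContDiffAt ℝ ω S 0 ∧ HasFDerivAt S L 0 ∧
      (∀ᶠ q in 𝓝 0, T (q, S q) = S q) ∧
      ∀ᶠ z in 𝓝 (0 : P × Y), T z = z.2 → z.2 = S z.1 := by
  -- The implicit function theorem is applied to z.2 - T z. By `hL` the derivative of T at 0 does
  -- not involve the unknown, so the partial derivative in the unknown is the identity.
  have cdf : ContDiffAt ℝ ω (fun z : P × Y => z.2 - T z) 0 := by fun_prop
  have hd : HasFDerivAt (fun z : P × Y => z.2 - T z)
      (ContinuousLinearMap.snd ℝ P Y - L.comp (ContinuousLinearMap.fst ℝ P Y)) 0 :=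
    hasFDerivAt_snd.sub hL
  have hinr : fderiv ℝ (fun z : P × Y => z.2 - T z) 0 ∘L ContinuousLinearMap.inr ℝ P Y =
      ContinuousLinearMap.id ℝ Y := by
    rw [hd.fderiv]; ext y; simp
  have if₂ : (fderiv ℝ (fun z : P × Y => z.2 - T z) 0 ∘L
      ContinuousLinearMap.inr ℝ P Y).IsInvertible := by
    rw [hinr]; exact ⟨ContinuousLinearEquiv.refl ℝ Y, rfl⟩
  have pn : (ω : WithTop ℕ∞) ≠ 0 := by simp
  have hu : (0 : P × Y).2 - T 0 = 0 := by simp [h0]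
  refine ⟨cdf.implicitFunction pn if₂, cdf.implicitFunction_apply_self pn if₂,
    cdf.contDiffAt_implicitFunction pn if₂, ?_, ?_, ?_⟩
  · refine (cdf.hasStrictFDerivAt_implicitFunction pn if₂).hasFDerivAt.congr_fderiv ?_
    rw [hinr, hd.fderiv]
    ext q
    simp
  · filter_upwards [cdf.eventually_apply_implicitFunction pn if₂] with q hq
    rw [hu] at hq
    exact (sub_eq_zero.1 hq).symm
  · filter_upwards [cdf.eventually_apply_eq_iff_implicitFunction pn if₂] with z hz h
    exact (hz.1 (by rw [hu, h, sub_self])).symm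

/-! ### Local solvability of the reduced system -/

theorem Linθ.congr {A u u' g g' : ℝ → ℝ} {k k' : ℝ} (h : Linθ A u k g) (hu : EqOn u' u Dom)
    (hk : k = k') (hg : EqOn g' g Dom) : Linθ A u' k' g' :=
  ⟨h.cont.congr hg, fun x hx => by rw [hu hx, h.eq hx, solθ_congr hg k' hx, hk]⟩

theorem Linφ.congr {A u u' g g' : ℝ → ℝ} {k₀ k₀' k k' : ℝ} (h : Linφ A u k₀ k g)
    (hu : EqOn u' u Dom) (hk₀ : k₀ = k₀') (hk : k = k') (hg : EqOn g' g Dom) :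
    Linφ A u' k₀' k' g' :=
  ⟨h.cont.congr hg, fun x hx => by rw [hu hx, h.eq hx, solφ_congr hg k₀' k' hx, hk₀, hk]⟩

theorem Linθ.eq_iff {ε : ℝ} {A g : ℝ → ℝ} {k : ℝ} (hA : ContinuousOn A Dom) {t : M1 ε}
    (h : Linθ A t.fn k g) (u : M1 ε) : t = u ↔
      (∀ x ∈ Dom, (1 - x ^ 2) * deriv u.fn x + (2 * x + A x) * u.fn x = g x) ∧ u.fn 0 = k := by
  constructor
  · rintro rfl
    exact ⟨fun x hx => h.solves hA hx, by rw [h.eq zero_mem_Dom, solθ_zero]⟩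
  · rintro ⟨h1, rfl⟩
    refine M1.ext_on fun x hx => ?_
    rw [h.eq hx]
    exact (eq_solθ hA h.cont (fun y hy => (u.hasDerivAt hy).differentiableAt.differentiableWithinAt)
      h1 hx).symm

theorem Linφ.eq_iff {ε : ℝ} {A g : ℝ → ℝ} {k₀ k : ℝ} (hA : ContinuousOn A Dom) {t : M2 ε}
    (h : Linφ A t.fn k₀ k g) (u : M2 ε) : t = u ↔
      (∀ x ∈ Dom, (1 - x ^ 2) * iteratedDeriv 2 u.fn x + A x * deriv u.fn x = g x) ∧
        u.fn 0 = k₀ ∧ deriv u.fn 0 = k := by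
  constructor
  · rintro rfl
    refine ⟨fun x hx => h.solves hA hx, by rw [h.eq zero_mem_Dom, solφ_zero], ?_⟩
    rw [deriv_congr_on isOpen_Ioo h.eq zero_mem_Dom, deriv_solφ_zero hA h.cont]
  · rintro ⟨h1, rfl, rfl⟩
    refine M2.ext_on fun x hx => ?_
    rw [h.eq hx]
    exact (eq_solφ hA h.cont u.contDiffOn h1 hx).symm

/-- The equation of the base solution is subtracted. What stays on the left is the linear operator
with the fixed coefficient A = aff + w₀; the changes of the data and all quadratic terms form the
sources on the right. -/
theorem IsSol.add_iff {ε : ℝ} {q₀ q : Dat} {w₀ w : M1 ε} {v : M2 ε} (h₀ : IsSol q₀ w₀ (0 : M2 ε)) :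
    IsSol (q₀ + q) (w₀ + w) v ↔
      ((∀ x ∈ Dom, (1 - x ^ 2) * deriv w.fn x + (2 * x + (aff q₀.1 x + w₀.fn x)) * w.fn x =
        q.2.1 * (1 - x ^ 2) - aff q.1 x * w₀.fn x - aff q.1 x * w.fn x -
          1 / 2 * (w.fn x * w.fn x) - Psi0 v.fn v.fn x) ∧ w.fn 0 = q.2.2.1) ∧
      (∀ x ∈ Dom, (1 - x ^ 2) * iteratedDeriv 2 v.fn x + (aff q₀.1 x + w₀.fn x) * deriv v.fn x =
        -(aff q.1 x * deriv v.fn x) - w.fn x * deriv v.fn x) ∧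
      v.fn 0 = q.2.2.2.1 ∧ deriv v.fn 0 = q.2.2.2.2 := by
  have hv0 := h₀.v_zero
  have hv1 := h₀.v_deriv_zero
  rw [M2.fn_zero] at hv0 hv1
  simp only [Pi.zero_apply, Pi.zero_def, deriv_const] at hv0 hv1
  have e : ∀ x ∈ Dom, (1 - x ^ 2) * deriv w₀.fn x + (2 * x + aff q₀.1 x) * w₀.fn x +
      1 / 2 * w₀.fn x ^ 2 = q₀.2.1 * (1 - x ^ 2) := fun x hx => by
    have := h₀.eqθ x hx
    rwa [M2.fn_zero, Psi0_zero_left, add_zero] at this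
  constructor
  · intro h
    refine ⟨⟨fun x hx => ?_, ?_⟩, fun x hx => ?_, ?_, ?_⟩
    · have := h.eqθ x hx
      rw [M1.deriv_add _ _ hx] at this
      simp only [Prod.fst_add, Prod.snd_add, aff_add, M1.fn_add, Pi.add_apply] at this
      linear_combination this - e x hx
    · have := h.w_zero
      simp only [Prod.fst_add, Prod.snd_add, M1.fn_add, Pi.add_apply, h₀.w_zero] at this
      linarith
    · have := h.eqφ x hx
      simp only [Prod.fst_add, aff_add, M1.fn_add, Pi.add_apply] at this
      linear_combination this
    · have := h.v_zero
      simp only [Prod.fst_add, Prod.snd_add] at this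
      linarith
    · have := h.v_deriv_zero
      simp only [Prod.snd_add] at this
      linarith
  · rintro ⟨⟨h1, h2⟩, h3, h4, h5⟩
    refine ⟨fun x hx => ?_, fun x hx => ?_, ?_, ?_, ?_⟩
    · rw [M1.deriv_add _ _ hx]
      simp only [Prod.fst_add, Prod.snd_add, aff_add, M1.fn_add, Pi.add_apply]
      linear_combination h1 x hx + e x hx
    · simp only [Prod.fst_add, aff_add, M1.fn_add, Pi.add_apply]
      linear_combination h3 x hx
    · simp only [Prod.fst_add, Prod.snd_add, M1.fn_add, Pi.add_apply, h₀.w_zero, h2]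
    · simp only [Prod.fst_add, Prod.snd_add, h4]
      linarith
    · simp only [Prod.snd_add, h5]
      linarith

theorem contDiff_bilinear {Z E F G : Type*} [NormedAddCommGroup Z] [NormedSpace ℝ Z]
    [NormedAddCommGroup E] [NormedSpace ℝ E] [NormedAddCommGroup F] [NormedSpace ℝ F]
    [NormedAddCommGroup G] [NormedSpace ℝ G] (B : E →L[ℝ] F →L[ℝ] G) (a : Z →L[ℝ] E)
    (b : Z →L[ℝ] F) : ContDiff ℝ ω (fun z => B (a z) (b z)) :=
  (B.comp a).contDiff.clm_apply b.contDiff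

open ContinuousLinearMap in
/-- Near a solution without swirl, the solutions of the reduced system are parametrized
analytically by their data. -/
theorem exists_local {ε : ℝ} (hε : 0 < ε ∧ ε < 1 / 2) {q₀ : Dat} {w₀ : M1 ε}
    (h₀ : IsSol q₀ w₀ (0 : M2 ε)) (hl : q₀.1.1 < 4 * ε) (hr : -q₀.1.2 < 4 * ε) :
    ∃ (S : Dat → M1 ε × M2 ε) (D : Dat →L[ℝ] M1 ε × M2 ε), S q₀ = (w₀, 0) ∧
      ContDiffAt ℝ ω S q₀ ∧ HasFDerivAt S D q₀ ∧
      (∀ᶠ q in 𝓝 q₀, IsSol q (S q).1 (S q).2) ∧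
      (∀ᶠ z in 𝓝 (q₀, (w₀, (0 : M2 ε))), IsSol z.1 z.2.1 z.2.2 → z.2 = S z.1) ∧
      ∀ f k a b : ℝ,
        EqOn (D (0, f, k, a, b)).1.fn
          (solθ (fun x => aff q₀.1 x + w₀.fn x) k fun x => f * (1 - x ^ 2)) Dom ∧
        EqOn (D (0, f, k, a, b)).2.fn (solφ (fun x => aff q₀.1 x + w₀.fn x) a b 0) Dom := by
  have : Fact (0 < ε ∧ ε < 1 / 2) := ⟨hε⟩
  have hA := good_aff_add hε hl hr w₀
  set A : ℝ → ℝ := fun x => aff q₀.1 x + w₀.fn x with hAdef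
  have hAc := hA.cont
  obtain ⟨c, hc⟩ := exists_Srcθ_Psi0 hε
  obtain ⟨K₁, -, hK₁⟩ := hA.exists_M1Data hε
  obtain ⟨K₂, -, hK₂⟩ := hA.exists_M2Data hε
  obtain ⟨Ba, hBa⟩ := hA.exists_bilinθ hε bilinOn_aff_mul (Srcθ_aff_mul hε)
  obtain ⟨Bm, hBm⟩ := hA.exists_bilinθ hε bilinOn_mul (Srcθ_mul hε)
  obtain ⟨Bψ, hBψ⟩ := hA.exists_bilinθ hε (bilinOn_Psi0 hε) hc
  obtain ⟨Da, hDa⟩ := hA.exists_bilinφ hε bilinOn_aff_mul_deriv (Srcφ_aff_mul_deriv (ε := ε))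
  obtain ⟨Dm, hDm⟩ := hA.exists_bilinφ hε bilinOn_mul_deriv (Srcφ_mul_deriv hε)
  obtain ⟨V₁, hV₁⟩ : ∃ V : M1 ε, EqOn V.fn (solθ A 1 0) Dom :=
    ⟨_, M1.mk_fn hε.2 (hK₁ 1 _ _ (Srcθ_zero ε))⟩
  obtain ⟨V₂, hV₂⟩ : ∃ V : M1 ε, EqOn V.fn (solθ A 0 fun x => 1 - x ^ 2) Dom :=
    ⟨_, M1.mk_fn hε.2 (hK₁ 0 _ _ (Srcθ_one_sub_sq hε.1))⟩
  obtain ⟨V₃, hV₃⟩ : ∃ V : M2 ε, EqOn V.fn (solφ A 0 1 0) Dom :=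
    ⟨_, M2.mk_fn (hK₂ 0 1 _ _ (Srcφ_zero ε))⟩
  obtain ⟨V₄, hV₄⟩ : ∃ V : M2 ε, EqOn V.fn (solφ A 1 0 0) Dom :=
    ⟨_, M2.mk_fn (hK₂ 1 0 _ _ (Srcφ_zero ε))⟩
  -- coordinates of the data
  let πm : Dat →L[ℝ] ℝ × ℝ := fst ℝ _ _
  let π' : Dat →L[ℝ] ℝ × ℝ × ℝ × ℝ := snd ℝ _ _
  let πf : Dat →L[ℝ] ℝ := (fst ℝ _ _).comp π'
  let π'' : Dat →L[ℝ] ℝ × ℝ × ℝ := (snd ℝ _ _).comp π'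
  let πk : Dat →L[ℝ] ℝ := (fst ℝ _ _).comp π''
  let πa : Dat →L[ℝ] ℝ := (fst ℝ _ _).comp ((snd ℝ _ _).comp π'')
  let πb : Dat →L[ℝ] ℝ := (snd ℝ _ _).comp ((snd ℝ _ _).comp π'')
  -- The part of the solution that is linear in the data: the responses to the initial value, to f,
  -- and to the change of the end values, which acts through its product with w₀.
  let L₁ : Dat →L[ℝ] M1 ε := πk.smulRight V₁ + πf.smulRight V₂ - (Ba.flip w₀).comp πm
  let L₂ : Dat →L[ℝ] M2 ε := πa.smulRight V₄ + πb.smulRight V₃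
  let zm : Dat × M1 ε × M2 ε →L[ℝ] ℝ × ℝ := πm.comp (fst ℝ _ _)
  let zw : Dat × M1 ε × M2 ε →L[ℝ] M1 ε := (fst ℝ _ _).comp (snd ℝ _ _)
  let zv : Dat × M1 ε × M2 ε →L[ℝ] M2 ε := (snd ℝ _ _).comp (snd ℝ _ _)
  let T₁ : Dat × M1 ε × M2 ε → M1 ε := fun z =>
    L₁ z.1 - Ba (zm z) (zw z) - (1 / 2 : ℝ) • Bm (zw z) (zw z) - Bψ (zv z) (zv z)
  let T₂ : Dat × M1 ε × M2 ε → M2 ε := fun z => L₂ z.1 - Da (zm z) (zv z) - Dm (zw z) (zv z)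
  have hL₁ : ∀ q : Dat, Linθ A (L₁ q).fn q.2.2.1
      (fun x => q.2.1 * (1 - x ^ 2) - aff q.1 x * w₀.fn x) := fun q => by
    have l1 : Linθ A V₁.fn 1 0 := ⟨continuousOn_const, hV₁⟩
    have l2 : Linθ A V₂.fn 0 (fun x => 1 - x ^ 2) := ⟨by fun_prop, hV₂⟩
    have l3 : Linθ A (Ba q.1 w₀).fn 0 _ := ⟨(Srcθ_aff_mul hε q.1 w₀).cont, hBa _ _⟩
    refine (((l1.smul q.2.2.1).add hAc (l2.smul q.2.1)).add hAc (l3.smul (-1))).congr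
      (fun x _ => ?_) (by ring) fun x _ => ?_
    · change (q.2.2.1 • V₁ + q.2.1 • V₂ - Ba q.1 w₀).fn x = _
      simp only [M1.fn_sub, M1.fn_add, M1.fn_smul, Pi.sub_apply, Pi.add_apply, Pi.smul_apply,
        smul_eq_mul]
      ring
    · simp only [Pi.add_apply, Pi.smul_apply, Pi.zero_apply, smul_eq_mul]
      ring
  have hL₂ : ∀ q : Dat, Linφ A (L₂ q).fn q.2.2.2.1 q.2.2.2.2 0 := fun q => by
    have l1 : Linφ A V₄.fn 1 0 0 := ⟨continuousOn_const, hV₄⟩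
    have l2 : Linφ A V₃.fn 0 1 0 := ⟨continuousOn_const, hV₃⟩
    refine ((l1.smul q.2.2.2.1).add hAc (l2.smul q.2.2.2.2)).congr
      (fun x _ => ?_) (by ring) (by ring) fun x _ => ?_
    · rfl
    · simp
  have hT₁ : ∀ z : Dat × M1 ε × M2 ε, Linθ A (T₁ z).fn z.1.2.2.1
      (fun x => z.1.2.1 * (1 - x ^ 2) - aff z.1.1 x * w₀.fn x - aff z.1.1 x * z.2.1.fn x -
          1 / 2 * (z.2.1.fn x * z.2.1.fn x) - Psi0 z.2.2.fn z.2.2.fn x) := fun z => by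
    have l2 : Linθ A (Ba z.1.1 z.2.1).fn 0 _ := ⟨(Srcθ_aff_mul hε _ _).cont, hBa _ _⟩
    have l3 : Linθ A (Bm z.2.1 z.2.1).fn 0 _ := ⟨(Srcθ_mul hε _ _).cont, hBm _ _⟩
    have l4 : Linθ A (Bψ z.2.2 z.2.2).fn 0 _ := ⟨(hc _ _).cont, hBψ _ _⟩
    refine ((((hL₁ z.1).add hAc (l2.smul (-1))).add hAc (l3.smul (-(1 / 2)))).add hAc
      (l4.smul (-1))).congr (fun x _ => ?_) (by ring) fun x _ => ?_
    · change (L₁ z.1 - Ba z.1.1 z.2.1 - (1 / 2 : ℝ) • Bm z.2.1 z.2.1 - Bψ z.2.2 z.2.2).fn x = _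
      simp only [M1.fn_sub, M1.fn_smul, Pi.sub_apply, Pi.add_apply, Pi.smul_apply, smul_eq_mul]
      ring
    · simp only [Pi.add_apply, Pi.smul_apply, smul_eq_mul]
      ring
  have hT₂ : ∀ z : Dat × M1 ε × M2 ε, Linφ A (T₂ z).fn z.1.2.2.2.1 z.1.2.2.2.2
      (fun x => -(aff z.1.1 x * deriv z.2.2.fn x) - z.2.1.fn x * deriv z.2.2.fn x) := fun z => by
    have l2 : Linφ A (Da z.1.1 z.2.2).fn 0 0 _ := ⟨(Srcφ_aff_mul_deriv _ _).cont, hDa _ _⟩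
    have l3 : Linφ A (Dm z.2.1 z.2.2).fn 0 0 _ := ⟨(Srcφ_mul_deriv hε _ _).cont, hDm _ _⟩
    refine (((hL₂ z.1).add hAc (l2.smul (-1))).add hAc (l3.smul (-1))).congr
      (fun x _ => ?_) (by ring) (by ring) fun x _ => ?_
    · change (L₂ z.1 - Da z.1.1 z.2.2 - Dm z.2.1 z.2.2).fn x = _
      simp only [M2.fn_sub, Pi.sub_apply, Pi.add_apply, Pi.smul_apply, smul_eq_mul]
      ring
    · simp only [Pi.add_apply, Pi.smul_apply, Pi.zero_apply, smul_eq_mul]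
      ring
  -- By uniqueness for the linear initial value problems, a fixed point of (T₁, T₂) is the same as a
  -- solution of the system with the shifted data.
  have key : ∀ z : Dat × M1 ε × M2 ε,
      (T₁ z, T₂ z) = z.2 ↔ IsSol (q₀ + z.1) (w₀ + z.2.1) z.2.2 := fun z => by
    rw [h₀.add_iff, Prod.ext_iff, (hT₁ z).eq_iff hAc, (hT₂ z).eq_iff hAc]
  obtain ⟨S, hS0, hSω, hSd, hS1, hS2⟩ := exists_fixedPoint (T := fun z => (T₁ z, T₂ z))
    (L := L₁.prod L₂)
    (ContDiff.prodMk
      ((((L₁.contDiff.comp contDiff_fst).sub (contDiff_bilinear Ba zm zw)).sub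
        ((contDiff_bilinear Bm zw zw).const_smul _)).sub (contDiff_bilinear Bψ zv zv))
      (((L₂.contDiff.comp contDiff_fst).sub (contDiff_bilinear Da zm zv)).sub
        (contDiff_bilinear Dm zw zv)))
    (by simp [T₁, T₂])
    (by
      have d1 := (((L₁.hasFDerivAt.comp (0 : Dat × M1 ε × M2 ε) hasFDerivAt_fst).sub
        (hasFDerivAt_bilinear_zero Ba zm zw)).sub
        ((hasFDerivAt_bilinear_zero Bm zw zw).const_smul (1 / 2 : ℝ))).sub
        (hasFDerivAt_bilinear_zero Bψ zv zv)
      have d2 := ((L₂.hasFDerivAt.comp (0 : Dat × M1 ε × M2 ε) hasFDerivAt_fst).sub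
        (hasFDerivAt_bilinear_zero Da zm zv)).sub (hasFDerivAt_bilinear_zero Dm zw zv)
      refine (d1.prodMk d2).congr_fderiv ?_
      ext z <;> simp)
  have hsub : Tendsto (fun q : Dat => q - q₀) (𝓝 q₀) (𝓝 0) := by
    have : Continuous (fun q : Dat => q - q₀) := by fun_prop
    simpa using this.tendsto q₀
  refine ⟨fun q => (w₀, 0) + S (q - q₀), L₁.prod L₂, by simp [hS0], ?_, ?_, ?_, ?_, ?_⟩
  · refine contDiffAt_const.add (ContDiffAt.comp q₀ (g := S) ?_ (by fun_prop))
    rwa [sub_self]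
  · refine HasFDerivAt.const_add _ ?_
    have := HasFDerivAt.comp q₀ (g := S) (g' := L₁.prod L₂)
      (by rwa [id, sub_self]) ((hasFDerivAt_id q₀).sub_const q₀)
    exact this
  · filter_upwards [hsub.eventually hS1] with q hq
    have := (key (q - q₀, S (q - q₀))).1 hq
    simpa using this
  · have hsub2 : Tendsto (fun z : Dat × M1 ε × M2 ε => z - (q₀, (w₀, (0 : M2 ε))))
        (𝓝 (q₀, (w₀, (0 : M2 ε)))) (𝓝 0) := by
      have : Continuous (fun z : Dat × M1 ε × M2 ε => z - (q₀, (w₀, (0 : M2 ε)))) := by fun_prop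
      simpa using this.tendsto (q₀, (w₀, (0 : M2 ε)))
    filter_upwards [hsub2.eventually hS2] with z hz hsol
    have := hz ((key _).2 (by simpa using hsol))
    simp only [Prod.snd_sub, Prod.fst_sub] at this
    exact sub_eq_iff_eq_add'.1 this
  · intro f k a b
    constructor
    · refine ((hL₁ (0, f, k, a, b)).congr (fun x _ => rfl) rfl fun x _ => ?_).eq
      simp [aff]
    · exact (hL₂ (0, f, k, a, b)).eq

/-! ### Solutions without swirl -/

/-- The level b is a barrier: f cannot cross it upwards if f decreases whenever it is at b. -/
theorem le_of_deriv_neg_at {f f' : ℝ → ℝ} {x₀ b : ℝ}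
    (hf : ∀ x ∈ Ico x₀ 1, HasDerivAt f (f' x) x) (h₀ : f x₀ ≤ b)
    (hb : ∀ x ∈ Ico x₀ 1, f x = b → f' x < 0) {x : ℝ} (hx : x ∈ Ico x₀ 1) : f x ≤ b := by
  have sub : Icc x₀ x ⊆ Ico x₀ 1 := fun y hy => ⟨hy.1, hy.2.trans_lt hx.2⟩
  exact image_le_of_deriv_right_lt_deriv_boundary (f := f) (B := fun _ => b) (B' := fun _ => 0)
    (fun y hy => (hf y (sub hy)).continuousAt.continuousWithinAt)
    (fun y hy => (hf y (sub (Ico_subset_Icc_self hy))).hasDerivWithinAt) h₀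
    (fun y => hasDerivAt_const y b) (fun y hy => hb y (sub (Ico_subset_Icc_self hy)))
    ⟨hx.1, le_rfl⟩

/-- A function that decreases at a definite rate with respect to `dx / (1 - x²)` as long as it is
at least `b` is eventually at most `b`. -/
theorem eventually_le_of_deriv_le {f f' : ℝ → ℝ} {x₀ b c : ℝ} (hx₀ : x₀ ∈ Ico (0 : ℝ) 1)
    (hc : 0 < c) (hf : ∀ x ∈ Ico x₀ 1, HasDerivAt f (f' x) x)
    (hb : ∀ x ∈ Ico x₀ 1, b ≤ f x → (1 - x ^ 2) * f' x ≤ -c) :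
    ∀ᶠ x in 𝓝[<] (1 : ℝ), f x ≤ b := by
  have pos : ∀ x ∈ Ico x₀ 1, 0 < 1 - x ^ 2 := fun x hx =>
    one_sub_sq_pos (Ico_subset_Dom ⟨hx₀.1.trans hx.1, hx.2⟩)
  obtain ⟨x₁, hx₁, h₁⟩ : ∃ x₁ ∈ Ico x₀ 1, f x₁ ≤ b := by
    -- If f stayed above b, then f' ≤ -c/(1-x²) ≤ -(c/2)/(1-x), so f - (c/2) log(1-x) would be
    -- nonincreasing and f would tend to -∞ at 1.
    by_contra! hcon
    have hd : ∀ x ∈ Ico x₀ 1, HasDerivAt (fun x => f x - c / 2 * Real.log (1 - x))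
        (f' x - c / 2 * (-1 / (1 - x))) x := fun x hx =>
      (hf x hx).sub (((((hasDerivAt_id x).const_sub 1)).log (by simp; linarith [hx.2])).const_mul _)
    have anti : AntitoneOn (fun x => f x - c / 2 * Real.log (1 - x)) (Ico x₀ 1) := by
      refine antitoneOn_of_deriv_nonpos (convex_Ico _ _)
        (fun x hx => (hd x hx).continuousAt.continuousWithinAt)
        (fun x hx => (hd x (interior_subset hx)).differentiableAt.differentiableWithinAt)
        fun x hx => ?_
      have hx := interior_subset hx
      have h1 := hb x hx (hcon x hx).le
      have h2 := pos x hx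
      have h3 : 0 < 1 - x := by linarith [hx.2]
      rw [(hd x hx).deriv]
      have h4 : f' x ≤ -c / (1 - x ^ 2) := by rw [le_div_iff₀ h2]; linarith
      have h5 : -c / (1 - x ^ 2) ≤ -c / (2 * (1 - x)) := by
        rw [neg_div, neg_div, neg_le_neg_iff]
        gcongr
        nlinarith
      have h6 : -c / (2 * (1 - x)) = c / 2 * (-1 / (1 - x)) := by field_simp
      linarith
    set M := 2 * (f x₀ - b) / c with hM
    have hM0 : 0 ≤ M := div_nonneg (by linarith [hcon x₀ ⟨le_rfl, hx₀.2⟩]) hc.le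
    have e1 : Real.exp (-M) ≤ 1 := Real.exp_le_one_iff.2 (by linarith)
    have e2 := Real.exp_pos (-M)
    have p0 : 0 < 1 - x₀ := by linarith [hx₀.2]
    -- At this point (c/2) log(1-x) has dropped by (c/2)M = f(x₀) - b since x₀, which forces f ≤ b
    -- there.
    have hy : 1 - (1 - x₀) * Real.exp (-M) ∈ Ico x₀ 1 := ⟨by nlinarith, by nlinarith⟩
    have h1 := anti ⟨le_rfl, hx₀.2⟩ hy hy.1
    have h2 := hcon _ hy
    simp only [sub_sub_cancel, Real.log_mul p0.ne' e2.ne', Real.log_exp] at h1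
    have h3 : c / 2 * M = f x₀ - b := by rw [hM]; field_simp
    linarith
  filter_upwards [Ioo_mem_nhdsLT hx₁.2] with x hx
  have sub : ∀ y ∈ Ico x₁ 1, y ∈ Ico x₀ 1 := fun y hy => ⟨hx₁.1.trans hy.1, hy.2⟩
  refine le_of_deriv_neg_at (fun y hy => hf y (sub y hy)) h₁ (fun y hy hyb => ?_) ⟨hx.1.le, hx.2⟩
  have := hb y (sub y hy) hyb.ge
  have := pos y (sub y hy)
  by_contra! hn
  nlinarith

theorem continuous_P (c : Fin 3 → ℝ) : Continuous (P c) := by unfold P; fun_prop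

namespace IsNoSwirlSolution

variable {c : Fin 3 → ℝ} {u v : ℝ → ℝ}

theorem hasDerivAt (h : IsNoSwirlSolution c u) {x : ℝ} (hx : x ∈ Dom) :
    HasDerivAt u ((P c x - 2 * x * u x - 1 / 2 * u x ^ 2) / (1 - x ^ 2)) x := by
  refine (hasDerivAt_of_contDiffOn isOpen_Ioo h.1 (by norm_num) hx).congr_deriv ?_
  rw [eq_div_iff (one_sub_sq_pos hx).ne']
  linarith [h.2 x hx]

theorem of_hasDerivAt
    (h : ∀ x ∈ Dom, HasDerivAt u ((P c x - 2 * x * u x - 1 / 2 * u x ^ 2) / (1 - x ^ 2)) x) :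
    IsNoSwirlSolution c u := by
  have hc := continuousOn_of_hasDerivAt h
  have hP := (continuous_P c).continuousOn (s := Dom)
  refine ⟨contDiffOn_one_of_hasDerivAt isOpen_Ioo h
    (continuousOn_div_one_sub_sq (by fun_prop)), fun x hx => ?_⟩
  rw [(h x hx).deriv]
  have := (one_sub_sq_pos hx).ne'
  field_simp
  ring

theorem continuousOn (h : IsNoSwirlSolution c u) : ContinuousOn u Dom := h.1.continuousOn

theorem contDiffOn_two (h : IsNoSwirlSolution c u) : ContDiffOn ℝ 2 u Dom := by
  refine contDiffOn_succ_of_hasDerivAt (k := 1) isOpen_Ioo (fun x hx => h.hasDerivAt hx) ?_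
  have h1 : ContDiffOn ℝ 1 u Dom := h.1
  have h2 : ContDiffOn ℝ 1 (P c) Dom := by unfold P; fun_prop
  refine ContDiffOn.div (by fun_prop) (by fun_prop) fun x hx => (one_sub_sq_pos hx).ne'

/-- The difference of two solutions of a Riccati equation satisfies a homogeneous linear equation,
so it never changes sign and the solutions are ordered by their values at 0. -/
theorem sub_eq (hu : IsNoSwirlSolution c u) (hv : IsNoSwirlSolution c v) {x : ℝ} (hx : x ∈ Dom) :
    ∃ e : ℝ, 0 < e ∧ u x - v x = (u 0 - v 0) * e := by
  have cu := hu.continuousOn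
  have cv := hv.continuousOn
  refine ⟨_, Real.exp_pos _, eq_mul_exp_of_hasDerivAt (w := fun x => u x - v x)
    (k := fun x => -(2 * x + 1 / 2 * (u x + v x)) / (1 - x ^ 2))
    (continuousOn_div_one_sub_sq (by fun_prop)) (fun y hy => ?_) hx⟩
  refine ((hu.hasDerivAt hy).sub (hv.hasDerivAt hy)).congr_deriv ?_
  have := (one_sub_sq_pos hy).ne'
  field_simp
  ring

theorem lt (hu : IsNoSwirlSolution c u) (hv : IsNoSwirlSolution c v) (h : u 0 < v 0) {x : ℝ}
    (hx : x ∈ Dom) : u x < v x := by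
  obtain ⟨e, he, h1⟩ := hv.sub_eq hu hx
  nlinarith [mul_pos (sub_pos.2 h) he]

/-- The values at `0` of the solutions form an interval. -/
theorem exists_between (hu : IsNoSwirlSolution c u) (hv : IsNoSwirlSolution c v) {γ : ℝ}
    (h₁ : u 0 < γ) (h₂ : γ < v 0) : ∃ w, IsNoSwirlSolution c w ∧ w 0 = γ := by
  have cu := hu.continuousOn
  -- The substitution w = u + 1/z turns the Riccati equation into the linear equation (1-x²)z' =
  -- (2x+u)z + 1/2. One solution is 1/(v-u), and E solves the homogeneous equation. Since k > 0, the
  -- sum z stays positive and w exists on the whole interval; k is chosen so that w(0) = γ.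
  set E : ℝ → ℝ := fun x => Real.exp (expo (fun s => 2 * s + u s) x) with hE
  set k := 1 / (γ - u 0) - 1 / (v 0 - u 0) with hk
  have hk0 : 0 < k := by
    rw [hk, sub_pos]; exact one_div_lt_one_div_of_lt (by linarith) (by linarith)
  set z : ℝ → ℝ := fun x => 1 / (v x - u x) + k * E x with hz
  have pos : ∀ x ∈ Dom, 0 < v x - u x := fun x hx => sub_pos.2 (hu.lt hv (h₁.trans h₂) hx)
  have zpos : ∀ x ∈ Dom, 0 < z x := fun x hx =>
    add_pos (one_div_pos.2 (pos x hx)) (mul_pos hk0 (Real.exp_pos _))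
  have hzd : ∀ x ∈ Dom, HasDerivAt z (((2 * x + u x) * z x + 1 / 2) / (1 - x ^ 2)) x := by
    intro x hx
    have hEd : HasDerivAt E (E x * ((2 * x + u x) / (1 - x ^ 2))) x :=
      (hasDerivAt_expo (by fun_prop) hx).exp
    have p := (pos x hx).ne'
    have q := (one_sub_sq_pos hx).ne'
    have := (((hasDerivAt_const x (1 : ℝ)).div ((hv.hasDerivAt hx).sub (hu.hasDerivAt hx)) p)).add
      (hEd.const_mul k)
    refine this.congr_deriv ?_
    simp only [hz, Pi.sub_apply]
    field_simp
    ring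
  refine ⟨fun x => u x + 1 / z x, of_hasDerivAt fun x hx => ?_, ?_⟩
  · have p := (zpos x hx).ne'
    have q := (one_sub_sq_pos hx).ne'
    refine ((hu.hasDerivAt hx).add ((hasDerivAt_const x (1 : ℝ)).div (hzd x hx) p)).congr_deriv ?_
    field_simp
    ring
  · have : z 0 = 1 / (γ - u 0) := by simp [hz, hE, hk, expo_zero]
    simp only [this, one_div_one_div]
    ring

/-- The reflection `x ↦ -x`. -/
theorem reflect (h : IsNoSwirlSolution c u) :
    IsNoSwirlSolution ![c 1, c 0, c 2] fun x => -u (-x) := by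
  refine of_hasDerivAt fun x hx => ?_
  have := (h.hasDerivAt (neg_mem_Dom hx)).comp x (hasDerivAt_neg x)
  refine this.neg.congr_deriv ?_
  simp [P]
  ring

/-- A solution that is not the smallest one tends to the larger root at `1`. -/
theorem tendsto_one (hu : IsNoSwirlSolution c u) (hv : IsNoSwirlSolution c v) (h : u 0 < v 0)
    (hc : -1 < c 1) : Tendsto v (𝓝[<] (1 : ℝ)) (𝓝 (-2 + 2 * √(1 + c 1))) := by
  set s := √(1 + c 1) with hs
  have s0 : 0 < s := Real.sqrt_pos.2 (by linarith)
  have s2 : s ^ 2 = 1 + c 1 := Real.sq_sqrt (by linarith)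
  -- (1-x²)v' at a point where v = b tends, as x → 1, to a quadratic in b with the roots -2 ± 2s; it
  -- is positive between them.
  have hR : ∀ b : ℝ, Tendsto (fun x => P c x - 2 * x * b - 1 / 2 * b ^ 2) (𝓝[<] (1 : ℝ))
      (𝓝 (-(1 / 2) * (b + 2 - 2 * s) * (b + 2 + 2 * s))) := fun b => by
    have : Continuous fun x => P c x - 2 * x * b - 1 / 2 * b ^ 2 := by
      have := continuous_P c
      fun_prop
    have := (this.tendsto 1).mono_left (nhdsWithin_le_nhds (s := Iio 1))
    convert this using 2
    simp only [P]
    linear_combination (2 : ℝ) * s2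
  have start : ∀ {p : ℝ → Prop}, (∀ᶠ x in 𝓝[<] (1 : ℝ), p x) →
      ∃ x₀ ∈ Ico (0 : ℝ) 1, ∀ x ∈ Ico x₀ 1, p x := fun {p} hp => by
    obtain ⟨y, hy, h1⟩ := (mem_nhdsLT_iff_exists_Ioo_subset' (show (0 : ℝ) < 1 by norm_num)).1 hp
    have hy : y < 1 := hy
    refine ⟨(max y 0 + 1) / 2, ⟨by positivity, ?_⟩, fun x hx => h1 ⟨?_, hx.2⟩⟩
    · linarith [max_lt hy one_pos]
    · linarith [hx.1, le_max_left y 0, max_lt hy one_pos]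
  have dv := fun {x₀ : ℝ} (h₀ : x₀ ∈ Ico (0 : ℝ) 1) (x : ℝ) (hx : x ∈ Ico x₀ 1) =>
    hv.hasDerivAt (Ico_subset_Dom ⟨h₀.1.trans hx.1, hx.2⟩)
  have dpos := fun {x₀ : ℝ} (h₀ : x₀ ∈ Ico (0 : ℝ) 1) (x : ℝ) (hx : x ∈ Ico x₀ 1) =>
    one_sub_sq_pos (Ico_subset_Dom ⟨h₀.1.trans hx.1, hx.2⟩)
  -- the upper bound
  have upper : ∀ η > 0, ∀ᶠ x in 𝓝[<] (1 : ℝ), v x ≤ -2 + 2 * s + η := by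
    intro η hη
    have hneg : -(1 / 2) * ((-2 + 2 * s + η) + 2 - 2 * s) * ((-2 + 2 * s + η) + 2 + 2 * s) <
        -(η * s) := by nlinarith
    have e1 := (hR (-2 + 2 * s + η)).eventually (gt_mem_nhds hneg)
    -- For x > 1 - s the right hand side is decreasing in v above the level -2 + 2s + η, so its
    -- negative bound at this level holds for all larger v.
    have e2 : ∀ᶠ x in 𝓝[<] (1 : ℝ), 1 - s < x :=
      mem_of_superset (Ioo_mem_nhdsLT (show 1 - s < 1 by linarith)) fun x hx => hx.1
    obtain ⟨x₀, h₀, h1⟩ := start (e1.and e2)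
    refine eventually_le_of_deriv_le h₀ (mul_pos hη s0) (dv h₀) fun x hx hb => ?_
    rw [mul_div_cancel₀ _ (dpos h₀ x hx).ne']
    obtain ⟨h2, h3⟩ := h1 x hx
    nlinarith [mul_nonneg (sub_nonneg.2 hb) (show 0 ≤ v x + (-2 + 2 * s + η) + 4 * x by linarith)]
  -- the lower root is not approached
  have mid : ∃ x₀ ∈ Ico (0 : ℝ) 1, ∀ x ∈ Ico x₀ 1, -2 - s ≤ v x := by
    -- The level -2 - s lies between the two roots, where the limit is 3s²/2. It is therefore a
    -- barrier from below: once v is above it, v stays above it.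
    have hpos : s ^ 2 < -(1 / 2) * ((-2 - s) + 2 - 2 * s) * ((-2 - s) + 2 + 2 * s) := by nlinarith
    obtain ⟨x₀, h₀, h1⟩ := start ((hR (-2 - s)).eventually (lt_mem_nhds hpos))
    by_cases hex : ∃ x₁ ∈ Ico x₀ 1, -2 - s ≤ v x₁
    · obtain ⟨x₁, hx₁, h2⟩ := hex
      refine ⟨x₁, ⟨h₀.1.trans hx₁.1, hx₁.2⟩, fun x hx => ?_⟩
      have sub : ∀ y ∈ Ico x₁ 1, y ∈ Ico x₀ 1 := fun y hy => ⟨hx₁.1.trans hy.1, hy.2⟩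
      have := le_of_deriv_neg_at (f := fun x => -v x) (b := 2 + s)
        (fun y hy => (dv h₀ y (sub y hy)).neg) (by linarith) (fun y hy hyb => ?_) hx
      · linarith
      · have h3 : v y = -2 - s := by linarith
        rw [neg_lt_zero, h3]
        exact div_pos (lt_trans (by positivity) (h1 y (sub y hy))) (dpos h₀ y (sub y hy))
    -- Here the smaller solution u is used. If v stayed below -2 - s, then 2x + v ≤ 0, and y =
    -- 1/(v-u) > 0 would satisfy (1-x²)y' = (2x+v)y - 1/2 ≤ -1/2, so that y would become
    -- nonpositive.
    · push Not at hex
      exfalso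
      have hw : ∀ x ∈ Ico x₀ 1, 0 < v x - u x := fun x hx =>
        sub_pos.2 (hu.lt hv h (Ico_subset_Dom ⟨h₀.1.trans hx.1, hx.2⟩))
      have e1 := eventually_le_of_deriv_le (f := fun x => 1 / (v x - u x)) (b := 0)
        (x₀ := x₀) h₀ (show (0 : ℝ) < 1 / 2 by norm_num)
        (fun x hx => (hasDerivAt_const x (1 : ℝ)).div ((dv h₀ x hx).sub
          (hu.hasDerivAt (Ico_subset_Dom ⟨h₀.1.trans hx.1, hx.2⟩))) (hw x hx).ne')
        fun x hx _ => ?_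
      · obtain ⟨x, hx⟩ := (e1.and (Ioo_mem_nhdsLT h₀.2)).exists
        exact absurd hx.1 (not_le.2 (one_div_pos.2 (hw x ⟨hx.2.1.le, hx.2.2⟩)))
      · have h1 := hw x hx
        have h2 := (dpos h₀ x hx).ne'
        have h3 := hex x hx
        have h4 : (2 * x + v x) ≤ 0 := by linarith [hx.2]
        have h5 : (1 - x ^ 2) * ((0 * (v x - u x) - 1 * ((P c x - 2 * x * v x - 1 / 2 * v x ^ 2) /
            (1 - x ^ 2) - (P c x - 2 * x * u x - 1 / 2 * u x ^ 2) / (1 - x ^ 2))) /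
            (v x - u x) ^ 2) = (2 * x + v x) / (v x - u x) - 1 / 2 := by
          field_simp
          ring
        rw [h5]
        have := div_nonpos_of_nonpos_of_nonneg h4 h1.le
        linarith
  -- the lower bound
  have lower : ∀ η > 0, η < s → ∀ᶠ x in 𝓝[<] (1 : ℝ), -2 + 2 * s - η ≤ v x := by
    intro η hη hηs
    obtain ⟨x₁, h₁, hm⟩ := mid
    have p1 : η * s < -(1 / 2) * ((-2 + 2 * s - η) + 2 - 2 * s) * ((-2 + 2 * s - η) + 2 + 2 * s) := by
      nlinarith
    have p2 : η * s < -(1 / 2) * ((-2 - s) + 2 - 2 * s) * ((-2 - s) + 2 + 2 * s) := by nlinarith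
    obtain ⟨x₂, h₂, h3⟩ := start (((hR _).eventually (lt_mem_nhds p1)).and
      ((hR _).eventually (lt_mem_nhds p2)))
    have h₀ : max x₁ x₂ ∈ Ico (0 : ℝ) 1 := ⟨h₁.1.trans (le_max_left _ _), max_lt h₁.2 h₂.2⟩
    have := eventually_le_of_deriv_le (f := fun x => -v x) (b := -(-2 + 2 * s - η)) h₀
      (mul_pos hη s0) (fun x hx => (dv h₀ x hx).neg) fun x hx hb => ?_
    · filter_upwards [this] with x hx using by linarith
    · have e := dpos h₀ x hx
      rw [mul_neg, mul_div_cancel₀ _ e.ne', neg_le_neg_iff]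
      have hm' := hm x ⟨(le_max_left _ _).trans hx.1, hx.2⟩
      obtain ⟨h4, h5⟩ := h3 x ⟨(le_max_right _ _).trans hx.1, hx.2⟩
      have hb' : v x ≤ -2 + 2 * s - η := by linarith
      have hlen : 0 < 3 * s - η := by linarith
      -- The right hand side is concave in v, so on [-2-s, -2+2s-η] it exceeds ηs because it does so
      -- at both ends. The inequality is multiplied by the length 3s - η of this interval.
      refine le_of_mul_le_mul_right ?_ hlen
      nlinarith [mul_nonneg (mul_nonneg (sub_nonneg.2 hm') (sub_nonneg.2 hb')) hlen.le,
        mul_nonneg (sub_nonneg.2 hm') (sub_nonneg.2 h4.le),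
        mul_nonneg (sub_nonneg.2 hb') (sub_nonneg.2 h5.le)]
  rw [tendsto_order]
  refine ⟨fun a ha => ?_, fun a ha => ?_⟩
  · have hd : 0 < min (-2 + 2 * s - a) s := lt_min (by linarith) s0
    filter_upwards [lower (min (-2 + 2 * s - a) s / 2) (by linarith)
      (by linarith [min_le_right (-2 + 2 * s - a) s])] with x hx
    linarith [min_le_left (-2 + 2 * s - a) s]
  · filter_upwards [upper ((a - (-2 + 2 * s)) / 2) (by linarith)] with x hx
    linarith

theorem tendsto_neg_one (hu : IsNoSwirlSolution c u) (hv : IsNoSwirlSolution c v) (h : v 0 < u 0)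
    (hc : -1 < c 0) : Tendsto v (𝓝[>] (-1 : ℝ)) (𝓝 (2 - 2 * √(1 + c 0))) := by
  have h1 := tendsto_one hu.reflect hv.reflect (by simpa using h) (by simpa using hc)
  have h2 : Tendsto (fun x : ℝ => -x) (𝓝[>] (-1 : ℝ)) (𝓝[<] (1 : ℝ)) := by
    simpa using tendsto_neg_nhdsGT (a := (-1 : ℝ))
  have := (h1.comp h2).neg
  simp only [Matrix.cons_val_one, Matrix.cons_val_zero] at this
  refine (this.congr fun x => by simp).trans (le_of_eq ?_)
  congr 1
  ring

end IsNoSwirlSolution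

/-! ### The solutions without swirl in normal form -/

/-- The values at `∓1` of the solutions without swirl. -/
noncomputable def bdry (c : Fin 3 → ℝ) : ℝ × ℝ := (2 - 2 * √(1 + c 0), -2 + 2 * √(1 + c 1))

/-- The data of the solution that belongs to `(c, γ)` and `β`. -/
noncomputable def datum (p : Param) (β : EuclideanSpace ℝ (Fin 4)) : Dat :=
  -- The terms of f without β come from `datum_poly`. With β₁ + β₀²/2 added, the first equation at x
  -- = 0 gives the perturbation the derivative β₁ - γβ₀ there, the same as that of β₀V¹ + β₁V².
  (bdry p.1, p.1 2 + ((bdry p.1).2 - (bdry p.1).1) / 2 +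
    1 / 2 * (((bdry p.1).2 - (bdry p.1).1) / 2) ^ 2 + β 1 + 1 / 2 * β 0 ^ 2,
    p.2 - aff (bdry p.1) 0 + β 0, β 3, β 2)

/-- The default values of `sInf` and `sSup` do no harm: for an empty set both are 0, which excludes
γ⁻ < γ < γ⁺, and an unbounded set has elements beyond γ in any case. -/
theorem exists_lower_upper {p : Param} (hp : p ∈ I11) :
    ∃ u v : ℝ → ℝ, IsNoSwirlSolution p.1 u ∧ IsNoSwirlSolution p.1 v ∧ u 0 < p.2 ∧ p.2 < v 0 := by
  obtain ⟨-, -, -, h1, h2⟩ := hp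
  have hne : (gammaSet p.1).Nonempty := by
    by_contra hn
    rw [not_nonempty_iff_eq_empty] at hn
    simp only [gammaMinus, gammaPlus, hn, Real.sInf_empty, Real.sSup_empty] at h1 h2
    linarith
  have hl : ∃ a ∈ gammaSet p.1, a < p.2 := by
    by_cases hb : BddBelow (gammaSet p.1)
    · exact exists_lt_of_csInf_lt hne h1
    · exact not_bddBelow_iff.1 hb p.2
  have hr : ∃ a ∈ gammaSet p.1, p.2 < a := by
    by_cases hb : BddAbove (gammaSet p.1)
    · exact exists_lt_of_lt_csSup hne h2
    · exact not_bddAbove_iff.1 hb p.2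
  obtain ⟨_, ⟨u, hu, rfl⟩, hu'⟩ := hl
  obtain ⟨_, ⟨v, hv, rfl⟩, hv'⟩ := hr
  exact ⟨u, v, hu, hv, hu', hv'⟩

theorem Ubar_spec {p : Param} (hp : p ∈ I11) :
    IsNoSwirlSolution p.1 (Ubar p) ∧ Ubar p 0 = p.2 := by
  obtain ⟨u, v, hu, hv, h1, h2⟩ := exists_lower_upper hp
  have h := hu.exists_between hv h1 h2
  rw [Ubar, dif_pos h]
  exact h.choose_spec

/-- The limit at 1 needs a smaller solution and the limit at -1 a larger one; both exist because γ
lies strictly between γ⁻ and γ⁺. -/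
theorem tendsto_Ubar {p : Param} (hp : p ∈ I11) :
    Tendsto (Ubar p) (𝓝[>] (-1 : ℝ)) (𝓝 (bdry p.1).1) ∧
      Tendsto (Ubar p) (𝓝[<] (1 : ℝ)) (𝓝 (bdry p.1).2) := by
  obtain ⟨u, v, hu, hv, h1, h2⟩ := exists_lower_upper hp
  obtain ⟨h, h0⟩ := Ubar_spec hp
  exact ⟨hv.tendsto_neg_one h (by rwa [h0]) hp.1, hu.tendsto_one h (by rwa [h0]) hp.2.1⟩

/-- Since c₁, c₂ > -1, the end values satisfy Ū(-1) < 2 and Ū(1) > -2, so only the first branches of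
the conditions on ε occur. -/
theorem AdmissibleExponent.bdry_lt {K : Set Param} {ε : ℝ} (hε : AdmissibleExponent K ε)
    (hK : K ⊆ I11) {p : Param} (hp : p ∈ K) :
    (bdry p.1).1 < 4 * ε ∧ -(bdry p.1).2 < 4 * ε := by
  obtain ⟨h1, h2⟩ := tendsto_Ubar (hK hp)
  have e1 : UbarLeft p = (bdry p.1).1 := h1.limUnder_eq
  have e2 : UbarRight p = (bdry p.1).2 := h2.limUnder_eq
  obtain ⟨h3, h4⟩ := hε.2.2 p hp
  have s0 : 0 < √(1 + p.1 0) := Real.sqrt_pos.2 (by linarith [(hK hp).1])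
  have s1 : 0 < √(1 + p.1 1) := Real.sqrt_pos.2 (by linarith [(hK hp).2.1])
  rw [e1, if_pos (by simp only [bdry]; linarith)] at h3
  rw [e2, if_pos (by simp only [bdry]; linarith)] at h4
  constructor <;> linarith

/-- The end values are roots of the equation (1) restricted to x = ∓1, so this quadratic polynomial
vanishes at ±1 and is a multiple of 1 - x². -/
theorem datum_poly {c : Fin 3 → ℝ} (h0 : -1 < c 0) (h1 : -1 < c 1) (x : ℝ) :
    P c x - (1 - x ^ 2) * (((bdry c).2 - (bdry c).1) / 2) - 2 * x * aff (bdry c) x -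
      1 / 2 * aff (bdry c) x ^ 2 = (c 2 + ((bdry c).2 - (bdry c).1) / 2 +
    1 / 2 * (((bdry c).2 - (bdry c).1) / 2) ^ 2) * (1 - x ^ 2) := by
  have s0 : √(1 + c 0) ^ 2 = 1 + c 0 := Real.sq_sqrt (by linarith)
  have s1 : √(1 + c 1) ^ 2 = 1 + c 1 := Real.sq_sqrt (by linarith)
  simp only [P, bdry, aff]
  linear_combination (x - 1) * s0 - (1 + x) * s1

theorem hasDerivAt_aff (m : ℝ × ℝ) (x : ℝ) : HasDerivAt (aff m) ((m.2 - m.1) / 2) x := by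
  have h1 := ((hasDerivAt_id x).const_sub 1).const_mul (m.1 / 2)
  have h2 := ((hasDerivAt_id x).const_add 1).const_mul (m.2 / 2)
  refine ((h1.add h2).congr_deriv (by ring)).congr_of_eventuallyEq (Eventually.of_forall fun y => ?_)
  simp only [aff, Pi.add_apply, id]
  ring

/-- The solution without swirl, in normal form. -/
theorem exists_isSol_datum_zero {ε : ℝ} (hε : 0 < ε ∧ ε < 1 / 2) {p : Param} (hp : p ∈ I11)
    (hl : (bdry p.1).1 < 4 * ε) (hr : -(bdry p.1).2 < 4 * ε) :
    ∃ w : M1 ε, IsSol (datum p 0) w (0 : M2 ε) ∧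
      EqOn (Ubar p) (fun x => aff (bdry p.1) x + w.fn x) Dom := by
  obtain ⟨hU, hU0⟩ := Ubar_spec hp
  obtain ⟨t1, t2⟩ := tendsto_Ubar hp
  have cU := hU.continuousOn
  have ca := (continuous_aff (bdry p.1)).continuousOn (s := Dom)
  have a1 := ((continuous_aff (bdry p.1)).tendsto (-1)).mono_left
    (nhdsWithin_le_nhds (s := Ioi (-1)))
  have a2 := ((continuous_aff (bdry p.1)).tendsto 1).mono_left (nhdsWithin_le_nhds (s := Iio 1))
  rw [aff_neg_one] at a1
  rw [aff_one] at a2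
  -- Since U² - aff² = (U + aff)(U - aff), the difference U - aff solves a linear equation with the
  -- coefficient (U + aff)/2. This coefficient has the same end values as U, so the linear theory
  -- places the difference in M₁.
  obtain ⟨C, hC⟩ := BC.exists_of_contDiffOn (k := 2)
    (f := fun x => 1 / 2 * (Ubar p x + aff (bdry p.1) x)) (by
      have := hU.contDiffOn_two
      unfold aff
      exact contDiffOn_const.mul (this.add (by fun_prop)))
  have hA : Good ε fun x => 1 / 2 * (Ubar p x + aff (bdry p.1) x) := by
    refine Good.of_tendsto hε (by fun_prop) (s := (bdry p.1).1) (t := (bdry p.1).2) ?_ ?_ hl hr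
      ⟨C, hC⟩
    · convert (t1.add a1).const_mul (1 / 2 : ℝ) using 2; ring
    · convert (t2.add a2).const_mul (1 / 2 : ℝ) using 2; ring
  obtain ⟨K, -, hK⟩ := hA.exists_M1Data hε
  set f := p.1 2 + ((bdry p.1).2 - (bdry p.1).1) / 2 +
    1 / 2 * (((bdry p.1).2 - (bdry p.1).1) / 2) ^ 2 with hf
  have hd : ∀ x ∈ Dom, HasDerivAt (fun x => Ubar p x - aff (bdry p.1) x)
      ((P p.1 x - 2 * x * Ubar p x - 1 / 2 * Ubar p x ^ 2) / (1 - x ^ 2) -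
        ((bdry p.1).2 - (bdry p.1).1) / 2) x := fun x hx =>
    (hU.hasDerivAt hx).sub (hasDerivAt_aff _ x)
  have hsol := eq_solθ (u := fun x => Ubar p x - aff (bdry p.1) x) (g := fun x => f * (1 - x ^ 2))
    hA.cont (by fun_prop) (fun x hx => (hd x hx).differentiableAt.differentiableWithinAt)
    fun x hx => by
      rw [(hd x hx).deriv]
      have := datum_poly hp.1 hp.2.1 x
      have h1 := (one_sub_sq_pos hx).ne'
      rw [← hf] at this
      field_simp
      linear_combination 2 * this
  have hsrc : Srcθ ε (fun x => f * (1 - x ^ 2)) (|f| * 3) := by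
    have h := Srcθ_one_sub_sq hε.1
    refine ⟨by fun_prop, fun x hx => ?_, ?_⟩
    · rw [abs_mul, mul_assoc]; gcongr; exact h.bound x hx
    · refine ((BC_quadratic f 0 (-f)).congr fun x _ => by ring).mono ?_
      rw [abs_zero, abs_neg]; linarith
  have hfn := M1.mk_fn hε.2 (hK (Ubar p 0 - aff (bdry p.1) 0) _ _ hsrc)
  set w := M1.mk hε.2 (hK (Ubar p 0 - aff (bdry p.1) 0) _ _ hsrc)
  have hw : EqOn w.fn (fun x => Ubar p x - aff (bdry p.1) x) Dom := fun x hx => by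
    rw [hfn hx]; exact (hsol hx).symm
  refine ⟨w, ⟨fun x hx => ?_, fun x _ => ?_, ?_, ?_, ?_⟩, fun x hx => ?_⟩
  · rw [M2.fn_zero, Psi0_zero_left, deriv_congr_on isOpen_Ioo hw hx, (hd x hx).deriv, hw hx]
    have := datum_poly hp.1 hp.2.1 x
    have h1 := (one_sub_sq_pos hx).ne'
    rw [← hf] at this
    simp only [datum, PiLp.zero_apply]
    rw [← hf]
    field_simp
    linear_combination 2 * this
  · simp [M2.fn_zero, Pi.zero_def]
  · simp only [hw zero_mem_Dom, hU0]; simp [datum]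
  · simp [M2.fn_zero, datum]
  · simp [M2.fn_zero, datum, Pi.zero_def]
  · simp only [hw hx]; ring

theorem solθ_zero_zero (A : ℝ → ℝ) (x : ℝ) : solθ A 0 0 x = 0 := by simp [solθ]

theorem solφ_zero_zero (A : ℝ → ℝ) (x : ℝ) : solφ A 0 0 0 x = 0 := by simp [solφ, solφ']

/-- The difference of the two solutions satisfies a homogeneous linear equation with the coefficient
aff + (w + w')/2 and initial value 0. No smallness is needed. -/
theorem IsSol.unique_noSwirl {ε : ℝ} {q : Dat} {w w' : M1 ε} (h : IsSol q w (0 : M2 ε))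
    (h' : IsSol q w' (0 : M2 ε)) : w = w' := by
  refine M1.ext_on fun x hx => ?_
  have hd : ∀ x ∈ Dom, HasDerivAt (fun x => w.fn x - w'.fn x)
      (deriv w.fn x - deriv w'.fn x) x := fun x hx => (w.hasDerivAt hx).sub (w'.hasDerivAt hx)
  have ca := (continuous_aff q.1).continuousOn (s := Dom)
  have c1 := w.continuousOn
  have c2 := w'.continuousOn
  have := eq_solθ (A := fun x => aff q.1 x + 1 / 2 * (w.fn x + w'.fn x)) (g := 0)
    (by fun_prop) continuousOn_const
    (fun x hx => (hd x hx).differentiableAt.differentiableWithinAt)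
    (fun y hy => by
      rw [(hd y hy).deriv]
      have e1 := h.eqθ y hy
      have e2 := h'.eqθ y hy
      simp only [Pi.zero_apply]
      linear_combination e1 - e2) hx
  simp only [h.w_zero, h'.w_zero, sub_self, solθ_zero_zero] at this
  linarith

/-- The second equation is linear and homogeneous in v, so vanishing initial values force v = 0. -/
theorem IsSol.eq_zero {ε : ℝ} {q : Dat} {w : M1 ε} {v : M2 ε} (h : IsSol q w v)
    (h0 : q.2.2.2 = 0) : v = 0 := by
  refine M2.ext_on fun x hx => ?_
  have := eq_solφ (A := fun x => aff q.1 x + w.fn x) (h := 0)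
    ((continuous_aff q.1).continuousOn.add w.continuousOn) continuousOn_const v.contDiffOn
    (fun x hx => h.eqφ x hx) hx
  rw [h.v_zero, h.v_deriv_zero, h0] at this
  rw [this, M2.fn_zero]
  exact solφ_zero_zero _ x

/-! ### From local to global families of solutions -/

/-- Local solution families that are locally unique fit together along a compact set. -/
theorem exists_glued_family {Z E Y : Type*} [NormedAddCommGroup Z] [NormedSpace ℝ Z]
    [NormedAddCommGroup E] [NormedSpace ℝ E] [NormedAddCommGroup Y] [NormedSpace ℝ Y]
    {Spec : Z → E → Y → Prop} {R : Z → (E →L[ℝ] Y) → Prop} {K : Set Z} (hK : IsCompact K)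
    (hloc : ∀ p₀ ∈ K, ∃ u : Z × E → Y, u (p₀, 0) = 0 ∧ ContDiffAt ℝ ω u (p₀, 0) ∧
      (∀ᶠ z in 𝓝 (p₀, (0 : E)), Spec z.1 z.2 (u z)) ∧
      (∀ᶠ z in 𝓝 (p₀, (0 : E), (0 : Y)), Spec z.1 z.2.1 z.2.2 → z.2.2 = u (z.1, z.2.1)) ∧
      ∃ D, R p₀ D ∧ HasFDerivAt (fun β => u (p₀, β)) D 0) :
    ∃ Ω : Set Z, IsOpen Ω ∧ K ⊆ Ω ∧ ∃ δ > 0, ∃ r > 0, ∃ S : Z × E → Y,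
      ContDiffOn ℝ ∞ S (Ω ×ˢ Metric.ball 0 δ) ∧
      (∀ p ∈ Ω, ∀ β : E, ‖β‖ < δ → Spec p β (S (p, β))) ∧
      (∀ p ∈ Ω, ∀ β : E, ‖β‖ < δ → ∀ y : Y, ‖y‖ < r → Spec p β y → y = S (p, β)) ∧
      ∀ p ∈ K, S (p, 0) = 0 ∧ ∃ D, R p D ∧ HasFDerivAt (fun β => S (p, β)) D 0 := by
  classical
  -- Uniqueness is expressed by comparing two candidates, without reference to a local family, so
  -- that the tube lemma gives one radius r for all of K.
  let W₁ : Set (Z × E × Y × Y) := {z | Spec z.1 z.2.1 z.2.2.1 → Spec z.1 z.2.1 z.2.2.2 →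
    z.2.2.1 = z.2.2.2}
  obtain ⟨U₁, V₁, hU₁, hV₁, hKU₁, h0V₁, hUV₁⟩ := generalized_tube_lemma hK
    (isCompact_singleton (x := (0 : E × Y × Y))) (isOpen_interior (s := W₁)) (by
      rintro ⟨p, z⟩ ⟨hp, hz⟩
      rw [mem_singleton_iff] at hz
      subst hz
      obtain ⟨u, -, -, -, hu, -⟩ := hloc p hp
      rw [mem_interior_iff_mem_nhds]
      have t1 : Tendsto (fun z : Z × E × Y × Y => (z.1, z.2.1, z.2.2.1)) (𝓝 (p, 0))
          (𝓝 (p, (0 : E), (0 : Y))) :=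
        Continuous.tendsto (f := fun z : Z × E × Y × Y => (z.1, z.2.1, z.2.2.1)) (by fun_prop) _
      have t2 : Tendsto (fun z : Z × E × Y × Y => (z.1, z.2.1, z.2.2.2)) (𝓝 (p, 0))
          (𝓝 (p, (0 : E), (0 : Y))) :=
        Continuous.tendsto (f := fun z : Z × E × Y × Y => (z.1, z.2.1, z.2.2.2)) (by fun_prop) _
      filter_upwards [t1.eventually hu, t2.eventually hu] with z h1 h2 h3 h4
      exact (h1 h3).trans (h2 h4).symm)
  obtain ⟨r, hr, hrV⟩ := Metric.isOpen_iff.1 hV₁ 0 (h0V₁ rfl)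
  have uniq : ∀ p ∈ U₁, ∀ β : E, ‖β‖ < r → ∀ y y' : Y, ‖y‖ < r → ‖y'‖ < r → Spec p β y →
      Spec p β y' → y = y' := fun p hp β hβ y y' hy hy' =>
    interior_subset (hUV₁ (mk_mem_prod hp (hrV (a := (β, y, y'))
      (by simp [Prod.norm_def, hβ, hy, hy']))))
  -- The points near which some analytic family of solutions of norm less than r exists.
  let W₂ : Set (Z × E) := {z | ∃ u : Z × E → Y, ContDiffAt ℝ ω u z ∧
    ∀ᶠ z' in 𝓝 z, Spec z'.1 z'.2 (u z') ∧ ‖u z'‖ < r}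
  have small : ∀ {p₀ : Z} {u : Z × E → Y}, u (p₀, 0) = 0 → ContDiffAt ℝ ω u (p₀, 0) →
      ∀ᶠ z in 𝓝 (p₀, (0 : E)), ‖u z‖ < r := fun {p₀ u} h0 hu => by
    have := hu.continuousAt.norm
    rw [ContinuousAt, h0, norm_zero] at this
    exact this.eventually (gt_mem_nhds hr)
  obtain ⟨U₂, V₂, hU₂, hV₂, hKU₂, h0V₂, hUV₂⟩ := generalized_tube_lemma hK
    (isCompact_singleton (x := (0 : E))) (isOpen_interior (s := W₂)) (by
      rintro ⟨p, z⟩ ⟨hp, hz⟩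
      rw [mem_singleton_iff] at hz
      subst hz
      obtain ⟨u, h0, hu, hs, -, -⟩ := hloc p hp
      rw [mem_interior_iff_mem_nhds]
      filter_upwards [hu.eventually (by simp), (hs.and (small h0 hu)).eventually_nhds] with z h1 h2
      exact ⟨u, h1, h2⟩)
  obtain ⟨δ, hδ, hδV⟩ := Metric.isOpen_iff.1 hV₂ 0 (h0V₂ rfl)
  -- A choice of the solution of norm less than r. By uniqueness it coincides near each point with
  -- an analytic local family and inherits its smoothness.
  let S : Z × E → Y := fun z => if h : ∃ y, Spec z.1 z.2 y ∧ ‖y‖ < r then h.choose else 0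
  have hS : ∀ z : Z × E, (∃ y, Spec z.1 z.2 y ∧ ‖y‖ < r) → Spec z.1 z.2 (S z) ∧ ‖S z‖ < r :=
    fun z h => by simp only [S, dif_pos h]; exact h.choose_spec
  have hW₂ : ∀ p ∈ U₁ ∩ U₂, ∀ β : E, ‖β‖ < min r δ → (p, β) ∈ W₂ := fun p hp β hβ =>
    interior_subset (hUV₂ (mk_mem_prod hp.2 (hδV (by simpa using hβ.trans_le (min_le_right _ _)))))
  have hex : ∀ p ∈ U₁ ∩ U₂, ∀ β : E, ‖β‖ < min r δ → ∃ y, Spec p β y ∧ ‖y‖ < r :=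
    fun p hp β hβ => by
      obtain ⟨u, -, h⟩ := hW₂ p hp β hβ
      exact ⟨u (p, β), h.self_of_nhds⟩
  have hun : ∀ p ∈ U₁ ∩ U₂, ∀ β : E, ‖β‖ < min r δ → ∀ y : Y, ‖y‖ < r → Spec p β y →
      y = S (p, β) := fun p hp β hβ y hy hs => by
    obtain ⟨h1, h2⟩ := hS (p, β) (hex p hp β hβ)
    exact uniq p hp.1 β (hβ.trans_le (min_le_left _ _)) _ _ hy h2 hs h1
  have hopen : IsOpen ((U₁ ∩ U₂) ×ˢ Metric.ball (0 : E) (min r δ)) :=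
    (hU₁.inter hU₂).prod Metric.isOpen_ball
  have hev : ∀ z ∈ (U₁ ∩ U₂) ×ˢ Metric.ball (0 : E) (min r δ), ∀ u : Z × E → Y,
      (∀ᶠ z' in 𝓝 z, Spec z'.1 z'.2 (u z') ∧ ‖u z'‖ < r) → S =ᶠ[𝓝 z] u := fun z hz u hu => by
    filter_upwards [hu, hopen.mem_nhds hz] with z' h1 h2
    exact (hun z'.1 h2.1 z'.2 (by simpa using h2.2) (u z') h1.2 h1.1).symm
  refine ⟨U₁ ∩ U₂, hU₁.inter hU₂, subset_inter hKU₁ hKU₂, min r δ, lt_min hr hδ, r, hr, S,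
    fun z hz => ?_, fun p hp β hβ => (hS (p, β) (hex p hp β hβ)).1, hun, fun p hp => ?_⟩
  · obtain ⟨u, h1, h2⟩ := hW₂ z.1 hz.1 z.2 (by simpa using hz.2)
    exact ((h1.congr_of_eventuallyEq (hev z hz u h2)).of_le le_top).contDiffWithinAt
  · obtain ⟨u, h0, hu, hs, -, D, hD, hd⟩ := hloc p hp
    have he := hev (p, 0) ⟨⟨hKU₁ hp, hKU₂ hp⟩, Metric.mem_ball_self (lt_min hr hδ)⟩ u
      (hs.and (small h0 hu))
    refine ⟨he.self_of_nhds.trans h0, D, hD, hd.congr_of_eventuallyEq ?_⟩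
    have : Tendsto (fun β : E => (p, β)) (𝓝 0) (𝓝 (p, 0)) :=
      Continuous.tendsto (by fun_prop) _
    exact this.eventually he

/-- `y` is the difference of the solution with the data of `(p, β)` and the solution without swirl
with the data of `(p, 0)`. -/
def IsPerturbation {ε : ℝ} (p : Param) (β : EuclideanSpace ℝ (Fin 4)) (y : M1 ε × M2 ε) : Prop :=
  ∃ w : M1 ε, IsSol (datum p 0) w (0 : M2 ε) ∧ IsSol (datum p β) (w + y.1) y.2

/-- All dependence on the parameters passes through the data, and the square roots in the end values
are analytic where 1 + c₁ and 1 + c₂ are positive. -/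
theorem contDiffAt_datum {p : Param} (h0 : -1 < p.1 0) (h1 : -1 < p.1 1)
    (β : EuclideanSpace ℝ (Fin 4)) :
    ContDiffAt ℝ ω (fun z : Param × EuclideanSpace ℝ (Fin 4) => datum z.1 z.2) (p, β) := by
  have a : ∀ i : Fin 3, ContDiffAt ℝ ω
      (fun z : Param × EuclideanSpace ℝ (Fin 4) => z.1.1 i) (p, β) := fun i => by fun_prop
  have b : ∀ i : Fin 4, ContDiffAt ℝ ω
      (fun z : Param × EuclideanSpace ℝ (Fin 4) => z.2 i) (p, β) := fun i => by fun_prop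
  have s0 : ContDiffAt ℝ ω
      (fun z : Param × EuclideanSpace ℝ (Fin 4) => √(1 + z.1.1 0)) (p, β) :=
    (contDiffAt_const.add (a 0)).sqrt (by simp; linarith)
  have s1 : ContDiffAt ℝ ω
      (fun z : Param × EuclideanSpace ℝ (Fin 4) => √(1 + z.1.1 1)) (p, β) :=
    (contDiffAt_const.add (a 1)).sqrt (by simp; linarith)
  simp only [datum, bdry, aff]
  fun_prop

/-- The derivative of the data with respect to `β` at `0`. -/
noncomputable def datumDeriv : EuclideanSpace ℝ (Fin 4) →L[ℝ] Dat :=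
  (0 : EuclideanSpace ℝ (Fin 4) →L[ℝ] ℝ × ℝ).prod ((EuclideanSpace.proj 1).prod
    ((EuclideanSpace.proj 0).prod ((EuclideanSpace.proj 3).prod (EuclideanSpace.proj 2))))

theorem hasFDerivAt_datum (p : Param) : HasFDerivAt (datum p) datumDeriv 0 := by
  have b : ∀ i : Fin 4, HasFDerivAt (fun β : EuclideanSpace ℝ (Fin 4) => β i)
      (EuclideanSpace.proj (𝕜 := ℝ) i : EuclideanSpace ℝ (Fin 4) →L[ℝ] ℝ) 0 := fun i =>
    (EuclideanSpace.proj (𝕜 := ℝ) i : EuclideanSpace ℝ (Fin 4) →L[ℝ] ℝ).hasFDerivAt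
  refine ((hasFDerivAt_const (bdry p.1) 0).prodMk ((((b 1).const_add _).add
    (((b 0).pow 2).const_mul (1 / 2 : ℝ))).prodMk (((b 0).const_add _).prodMk
    ((b 3).prodMk (b 2))))).congr_fderiv ?_
  refine ContinuousLinearMap.ext fun β => ?_
  simp [datumDeriv]

/-- Both the perturbed solution and the one without swirl are taken from the same analytic family S
of `exists_local`. Hence their difference is analytic in (p, β), also for p near p₀ where nothing is
known about `Ubar p`. -/
theorem exists_local_perturbation {ε : ℝ} (hε : 0 < ε ∧ ε < 1 / 2) {p₀ : Param} {w₀ : M1 ε}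
    (hp0 : -1 < p₀.1 0) (hp1 : -1 < p₀.1 1) (h₀ : IsSol (datum p₀ 0) w₀ (0 : M2 ε))
    (hl : (bdry p₀.1).1 < 4 * ε) (hr : -(bdry p₀.1).2 < 4 * ε) :
    ∃ u : Param × EuclideanSpace ℝ (Fin 4) → M1 ε × M2 ε, u (p₀, 0) = 0 ∧
      ContDiffAt ℝ ω u (p₀, 0) ∧
      (∀ᶠ z in 𝓝 (p₀, (0 : EuclideanSpace ℝ (Fin 4))), IsPerturbation z.1 z.2 (u z)) ∧
      (∀ᶠ z in 𝓝 (p₀, (0 : EuclideanSpace ℝ (Fin 4)), (0 : M1 ε × M2 ε)),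
        IsPerturbation z.1 z.2.1 z.2.2 → z.2.2 = u (z.1, z.2.1)) ∧
      ∃ D : EuclideanSpace ℝ (Fin 4) →L[ℝ] M1 ε × M2 ε,
        (∀ β, EqOn (D β).1.fn (solθ (fun x => aff (bdry p₀.1) x + w₀.fn x) (β 0)
            fun x => β 1 * (1 - x ^ 2)) Dom ∧
          EqOn (D β).2.fn (solφ (fun x => aff (bdry p₀.1) x + w₀.fn x) (β 3) (β 2) 0) Dom) ∧
        HasFDerivAt (fun β => u (p₀, β)) D 0 := by
  obtain ⟨S, D, hS0, hSω, hSd, hS1, hS2, hD⟩ := exists_local hε h₀ hl hr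
  let q : Param × EuclideanSpace ℝ (Fin 4) → Dat := fun z => datum z.1 z.2
  let qz : Param × EuclideanSpace ℝ (Fin 4) → Dat := fun z => datum z.1 0
  have hq : ContDiffAt ℝ ω q (p₀, 0) := contDiffAt_datum hp0 hp1 0
  have hq' : ContDiffAt ℝ ω qz (p₀, 0) :=
    ContDiffAt.comp (p₀, (0 : EuclideanSpace ℝ (Fin 4))) (g := q)
      (f := fun z => (z.1, (0 : EuclideanSpace ℝ (Fin 4)))) hq (by fun_prop)
  have hSq : ContDiffAt ℝ ω (fun z => S (q z)) (p₀, 0) := ContDiffAt.comp _ hSω hq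
  have hSq' : ContDiffAt ℝ ω (fun z => S (qz z)) (p₀, 0) := ContDiffAt.comp _ hSω hq'
  -- For β = 0 the data of v vanish, so the solution that S provides has no swirl.
  have base : ∀ᶠ z in 𝓝 (p₀, (0 : EuclideanSpace ℝ (Fin 4))),
      IsSol (datum z.1 0) (S (qz z)).1 (0 : M2 ε) := by
    filter_upwards [hq'.continuousAt.eventually hS1] with z hz
    have e : (S (qz z)).2 = 0 := hz.eq_zero (by simp [qz, datum])
    rwa [e] at hz
  refine ⟨fun z => ((S (q z)).1 - (S (qz z)).1, (S (q z)).2), ?_, ?_, ?_, ?_,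
    D.comp datumDeriv, fun β => ?_, ?_⟩
  · simp only [q, qz, hS0]; simp
  · exact ((contDiffAt_fst.comp _ hSq).sub (contDiffAt_fst.comp _ hSq')).prodMk
      (contDiffAt_snd.comp _ hSq)
  · filter_upwards [base, hq.continuousAt.eventually hS1] with z h1 h2
    exact ⟨_, h1, by simpa using h2⟩
  · let F : Param × EuclideanSpace ℝ (Fin 4) × (M1 ε × M2 ε) → Dat × (M1 ε × M2 ε) := fun z =>
      (q (z.1, z.2.1), ((S (qz (z.1, z.2.1))).1 + z.2.2.1, z.2.2.2))
    have hπ : Tendsto (fun z : Param × EuclideanSpace ℝ (Fin 4) × (M1 ε × M2 ε) => (z.1, z.2.1))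
        (𝓝 (p₀, 0, 0)) (𝓝 (p₀, 0)) := Continuous.tendsto
      (f := fun z : Param × EuclideanSpace ℝ (Fin 4) × (M1 ε × M2 ε) => (z.1, z.2.1))
      (by fun_prop) (p₀, 0, 0)
    have hF : Tendsto F (𝓝 (p₀, 0, 0)) (𝓝 (datum p₀ 0, (w₀, 0))) := by
      have c1 : Tendsto q (𝓝 (p₀, 0)) (𝓝 (datum p₀ 0)) := hq.continuousAt
      have c2 : Tendsto (fun z => (S (qz z)).1) (𝓝 (p₀, (0 : EuclideanSpace ℝ (Fin 4)))) (𝓝 w₀) := by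
        have := hSq'.continuousAt.fst
        rw [ContinuousAt] at this
        simpa only [qz, hS0] using this
      have c3 : Tendsto (fun z : Param × EuclideanSpace ℝ (Fin 4) × (M1 ε × M2 ε) => z.2.2.1)
        (𝓝 (p₀, 0, 0)) (𝓝 0) := Continuous.tendsto
          (f := fun z : Param × EuclideanSpace ℝ (Fin 4) × (M1 ε × M2 ε) => z.2.2.1)
          (by fun_prop) (p₀, 0, 0)
      have c4 : Tendsto (fun z : Param × EuclideanSpace ℝ (Fin 4) × (M1 ε × M2 ε) => z.2.2.2)
        (𝓝 (p₀, 0, 0)) (𝓝 0) := Continuous.tendsto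
          (f := fun z : Param × EuclideanSpace ℝ (Fin 4) × (M1 ε × M2 ε) => z.2.2.2)
          (by fun_prop) (p₀, 0, 0)
      have := (c1.comp hπ).prodMk_nhds (((c2.comp hπ).add c3).prodMk_nhds c4)
      simpa using this
    filter_upwards [hF.eventually hS2, hπ.eventually base] with z h1 h2 h3
    obtain ⟨w, hw, hw'⟩ := h3
    -- The base solution hidden in `IsPerturbation` is the one provided by S, so the local
    -- uniqueness of `exists_local` applies to the sum.
    obtain rfl := hw.unique_noSwirl h2
    have := h1 hw'
    simp only [F, q] at this
    simp only [q, ← this]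
    simp
  · exact hD (β 1) (β 0) (β 3) (β 2)
  · have h1 : HasFDerivAt (fun β => S (datum p₀ β)) (D.comp datumDeriv) 0 :=
      HasFDerivAt.comp 0 hSd (hasFDerivAt_datum p₀)
    refine (h1.sub_const ((S (datum p₀ 0)).1, (0 : M2 ε))).congr_of_eventuallyEq
      (Eventually.of_forall fun β => ?_)
    ext1 <;> simp [q, qz]

/-! ### The kernel of the linearized operator -/

theorem expo_congr {A A' : ℝ → ℝ} (h : EqOn A A' Dom) : EqOn (expo A) (expo A') Dom :=
  fun _ hx => intervalIntegral.integral_congr fun s hs => by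
    simp only [h (uIcc_zero_subset_Dom hx hs)]

theorem solθ_congr_coeff {A A' : ℝ → ℝ} (h : EqOn A A' Dom) (k : ℝ) (g : ℝ → ℝ) :
    EqOn (solθ A k g) (solθ A' k g) Dom := fun x hx => by
  simp only [solθ, expo_congr h hx]
  congr 3
  exact intervalIntegral.integral_congr fun s hs => by
    simp only [expo_congr h (uIcc_zero_subset_Dom hx hs)]

theorem solφ'_congr_coeff {A A' : ℝ → ℝ} (h : EqOn A A' Dom) (k : ℝ) (g : ℝ → ℝ) :
    EqOn (solφ' A k g) (solφ' A' k g) Dom := fun x hx => by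
  simp only [solφ', expo_congr h hx]
  congr 2
  exact intervalIntegral.integral_congr fun s hs => by
    simp only [expo_congr h (uIcc_zero_subset_Dom hx hs)]

theorem solφ_congr_coeff {A A' : ℝ → ℝ} (h : EqOn A A' Dom) (k₀ k₁ : ℝ) (g : ℝ → ℝ) :
    EqOn (solφ A k₀ k₁ g) (solφ A' k₀ k₁ g) Dom := fun x hx => by
  simp only [solφ]
  congr 1
  exact intervalIntegral.integral_congr fun s hs =>
    solφ'_congr_coeff h k₁ g (uIcc_zero_subset_Dom hx hs)

/-- Both sides solve the same homogeneous linear equation with value 1 at 0. This relates the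
integrating factor of the theorem to that of `solθ`. -/
theorem exp_neg_aFun {p : Param} (hU : ContinuousOn (Ubar p) Dom) {x : ℝ} (hx : x ∈ Dom) :
    Real.exp (-aFun p x) = (1 - x ^ 2) * Real.exp (-expo (Ubar p) x) := by
  have hd : ∀ y ∈ Dom, HasDerivAt (fun x => Real.exp (-aFun p x))
      (Real.exp (-aFun p y) * -((2 * y + Ubar p y) / (1 - y ^ 2))) y := fun y hy =>
    (hasDerivAt_expo (A := fun s => 2 * s + Ubar p s) (by fun_prop) hy).neg.exp
  have := eq_solθ (g := 0) hU continuousOn_const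
    (fun y hy => (hd y hy).differentiableAt.differentiableWithinAt) (fun y hy => by
      rw [(hd y hy).deriv]
      have := (one_sub_sq_pos hy).ne'
      simp only [Pi.zero_apply]
      field_simp
      ring) hx
  simpa [solθ, aFun] using this

theorem sum_kerθ {p : Param} (hU : ContinuousOn (Ubar p) Dom) (β : EuclideanSpace ℝ (Fin 4))
    {x : ℝ} (hx : x ∈ Dom) :
    ∑ i, β i * kerθ p i x = solθ (Ubar p) (β 0) (fun x => β 1 * (1 - x ^ 2)) x := by
  have h1 : (∫ s in (0 : ℝ)..x, Real.exp (aFun p s)) =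
      ∫ s in (0 : ℝ)..x, Real.exp (expo (Ubar p) s) * ((1 - s ^ 2) / (1 - s ^ 2) ^ 2) :=
    intervalIntegral.integral_congr fun s hs => by
      have hs := uIcc_zero_subset_Dom hx hs
      have h2 := (one_sub_sq_pos hs).ne'
      have h3 := exp_neg_aFun hU hs
      rw [Real.exp_neg, Real.exp_neg] at h3
      rw [← inv_inv (Real.exp (aFun p s)), h3]
      field_simp
  have h2 : (∫ s in (0 : ℝ)..x, Real.exp (expo (Ubar p) s) *
      (β 1 * (1 - s ^ 2) / (1 - s ^ 2) ^ 2)) = β 1 *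
      ∫ s in (0 : ℝ)..x, Real.exp (expo (Ubar p) s) * ((1 - s ^ 2) / (1 - s ^ 2) ^ 2) := by
    rw [← intervalIntegral.integral_const_mul]
    congr 1
    funext s
    ring
  simp only [Fin.sum_univ_four, kerθ, solθ, h2]
  simp only [Matrix.cons_val_zero, Matrix.cons_val_one, Matrix.cons_val, h1, exp_neg_aFun hU hx]
  ring

theorem sum_kerφ (p : Param) (β : EuclideanSpace ℝ (Fin 4)) (x : ℝ) :
    ∑ i, β i * kerφ p i x = solφ (Ubar p) (β 3) (β 2) 0 x := by
  have h1 : (∫ s in (0 : ℝ)..x, solφ' (Ubar p) (β 2) 0 s) =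
      β 2 * ∫ s in (0 : ℝ)..x, Real.exp (-bFun p s) := by
    rw [← intervalIntegral.integral_const_mul]
    congr 1
    funext s
    simp [solφ', bFun, expo, mul_comm]
  simp only [Fin.sum_univ_four, kerφ, solφ, h1]
  simp
  ring

/-! ### Normal form and reduced system -/

theorem psi_zero (f g : ℝ → ℝ) : psi f g 0 = 0 := by simp [psi]

section correspondence

variable {ε : ℝ} {p : Param} {β : EuclideanSpace ℝ (Fin 4)} {w₀ w : M1 ε} {v : M2 ε}
  {f g : ℝ → ℝ}

theorem hasDerivAt_of_eqOn_Ubar_add (hU : EqOn (Ubar p) (fun x => aff (bdry p.1) x + w₀.fn x) Dom)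
    (hf : EqOn f w.fn Dom) {x : ℝ} (hx : x ∈ Dom) : HasDerivAt (fun x => Ubar p x + f x)
      (((bdry p.1).2 - (bdry p.1).1) / 2 + deriv w₀.fn x + deriv w.fn x) x :=
  hasDerivAt_congr_on isOpen_Ioo (fun y hy => by simp only [hU hy, hf hy, Pi.add_apply]) hx
    (((hasDerivAt_aff (bdry p.1) x).add (w₀.hasDerivAt hx)).add (w.hasDerivAt hx))

/-- Undoing the correction of ψ adds a(1-x)/2 + b(1+x)/2 + d(1-x²) to the right hand side, with a =
ψ(-1) and b = ψ(1). The first two terms are the changes of c₁ and c₂, and d is the change of c₃. -/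
theorem solvesReduced_of_isSol (h0 : -1 < p.1 0) (h1 : -1 < p.1 1)
    (hNS : IsNoSwirlSolution p.1 (Ubar p))
    (hU : EqOn (Ubar p) (fun x => aff (bdry p.1) x + w₀.fn x) Dom)
    (hs : IsSol (datum p β) (w₀ + w) v) (hf : EqOn f w.fn Dom) (hg : EqOn g v.fn Dom) :
    SolvesReduced ![p.1 0 + 1 / 2 * psi g g (-1), p.1 1 + 1 / 2 * psi g g 1,
        p.1 2 - 1 / 2 * iteratedDeriv 2 (phi p f) 0]
      (fun x => Ubar p x + f x) g := by
  have hψ : ∀ x ∈ Icc (-1 : ℝ) 1, psi g g x = psi v.fn v.fn x := fun x hx => psi_congr hg hg hx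
  have hψ1 := hψ 1 (by constructor <;> norm_num)
  have hψ2 := hψ (-1) (by constructor <;> norm_num)
  set a := psi v.fn v.fn (-1) with ha
  set b := psi v.fn v.fn 1 with hb
  set d := β 1 + 1 / 2 * β 0 ^ 2 - (a + b) / 2 with hd
  have hder := fun x hx => hasDerivAt_of_eqOn_Ubar_add (x := x) hU hf hx
  have key : ∀ x ∈ Dom, (1 - x ^ 2) * deriv (fun x => Ubar p x + f x) x +
      2 * x * (Ubar p x + f x) + 1 / 2 * (Ubar p x + f x) ^ 2 + psi v.fn v.fn x =
      P p.1 x + (a * (1 - x) / 2 + b * (1 + x) / 2 + d * (1 - x ^ 2)) := fun x hx => by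
    have e1 := hs.eqθ x hx
    have e2 := datum_poly h0 h1 x
    rw [M1.deriv_add _ _ hx] at e1
    simp only [Psi0, M1.fn_add, Pi.add_apply, datum, ← ha, ← hb] at e1
    rw [(hder x hx).deriv, hU hx, hf hx]
    simp only [hd]
    linear_combination e1 - e2
  have hphi : EqOn (phi p f)
      (fun x => a * (1 - x) / 2 + b * (1 + x) / 2 + d * (1 - x ^ 2) - psi v.fn v.fn x) Dom := by
    intro x hx
    have e1 := key x hx
    have e2 := hNS.2 x hx
    have e3 : deriv (fun x => Ubar p x + f x) x = deriv (Ubar p) x + deriv f x := by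
      refine deriv_fun_add (hNS.hasDerivAt hx).differentiableAt ?_
      exact (hasDerivAt_congr_on isOpen_Ioo hf.symm hx (w.hasDerivAt hx)).differentiableAt
    rw [e3] at e1
    simp only [phi]
    linear_combination e1 - e2
  -- Since ψ''(0) = 0, only the term d(1-x²) contributes to the second derivative of φ at 0.
  have hphi2 : iteratedDeriv 2 (phi p f) 0 = -2 * d := by
    have T := v.tripleSrc v
    rw [iteratedDeriv_congr_on isOpen_Ioo hphi 2 zero_mem_Dom]
    refine (iteratedDeriv_succ_eqOn (k := 1) isOpen_Ioo
      (g := fun x => -a / 2 + b / 2 - 2 * d * x - ∫ t in (0 : ℝ)..x, ∫ s in (0 : ℝ)..t,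
        2 * v.fn s * deriv v.fn s / (1 - s ^ 2))
      (g' := fun x => -2 * d - ∫ s in (0 : ℝ)..x, 2 * v.fn s * deriv v.fn s / (1 - s ^ 2))
      (fun y hy => ?_) (fun y hy => ?_) 0 zero_mem_Dom).trans (by simp)
    · rw [iteratedDeriv_one]
      have h1 := ((hasDerivAt_id y).const_sub 1).const_mul (a / 2)
      have h2 := ((hasDerivAt_id y).const_add 1).const_mul (b / 2)
      have h3 := (((hasDerivAt_id y).pow 2).const_sub 1).const_mul d
      have h4 := ((h1.add h2).add h3).sub (T.hasDerivAt hy)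
      refine ((h4.congr_deriv ?_).congr_of_eventuallyEq (Eventually.of_forall fun z => ?_)).deriv
      · simp; ring
      · simp [psi_eq_triple]; ring
    · have h1 := ((hasDerivAt_id y).const_mul (2 * d)).const_sub (-a / 2 + b / 2)
      refine ((h1.sub (T.hasDerivAt2 hy)).congr_deriv (by ring)).congr_of_eventuallyEq
        (Eventually.of_forall fun z => ?_)
      simp
  have hwc : ContDiffOn ℝ 1 f Dom := w.contDiffOn.congr hf
  have hvc : ContDiffOn ℝ 2 g Dom := v.contDiffOn.congr hg
  refine ⟨hNS.1.add hwc, hvc, fun x hx => ⟨?_, ?_⟩⟩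
  · rw [hphi2, hψ1, hψ2, hψ x (Ioo_subset_Icc_self hx)]
    simp only
    rw [key x hx]
    simp only [P, Matrix.cons_val_zero, Matrix.cons_val_one, Matrix.cons_val]
    ring
  · have e := hs.eqφ x hx
    rw [iteratedDeriv_congr_on isOpen_Ioo hg 2 hx, deriv_congr_on isOpen_Ioo hg hx]
    simp only [M1.fn_add, Pi.add_apply, datum] at e
    simp only [hU hx, hf hx]
    linear_combination e

theorem eq_zero_of_abs_le_weight {N : ℝ → ℝ} (hN : Continuous N) {C r : ℝ} (hr : 0 < r)
    (hb : ∀ x ∈ Dom, |N x| ≤ C * weight r x) : N 1 = 0 ∧ N (-1) = 0 := by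
  have hw : Continuous (weight r) := by
    unfold weight
    exact Continuous.rpow_const (by fun_prop) fun _ => Or.inr hr.le
  have key : ∀ x ∈ Icc (-1 : ℝ) 1, |N x| ≤ C * weight r x := by
    have hc : closure Dom = Icc (-1 : ℝ) 1 := closure_Ioo (by norm_num)
    rw [← hc]
    exact fun x hx => le_on_closure (s := Dom) hb hN.abs.continuousOn
      (continuous_const.mul hw).continuousOn hx
  have h0 : (0 : ℝ) ^ r = 0 := Real.zero_rpow hr.ne'
  have e1 := key 1 (by constructor <;> norm_num)
  have e2 := key (-1) (by constructor <;> norm_num)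
  simp only [weight, one_pow, even_two.neg_pow, sub_self, h0, mul_zero] at e1 e2
  exact ⟨abs_eq_zero.1 (le_antisymm e1 (abs_nonneg _)), abs_eq_zero.1 (le_antisymm e2 (abs_nonneg _))⟩

/-- The constants ĉ are arbitrary, but all other terms of the normal form are of order
(1-x²)^{1-2ε}. So the polynomial N that collects the constants vanishes at ±1 and equals N(0)(1-x²),
and N(0) is determined by the first equation at x = 0. -/
theorem isSol_of_solvesReduced (hε : 0 < ε ∧ ε < 1 / 2)
    (hU : EqOn (Ubar p) (fun x => aff (bdry p.1) x + w₀.fn x) Dom)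
    (hs₀ : IsSol (datum p 0) w₀ (0 : M2 ε)) {chat : Fin 3 → ℝ}
    (hs : SolvesReduced chat (fun x => Ubar p x + w.fn x) fun x => v.fn x) :
    IsSol (datum p !₂[w.fn 0, deriv w.fn 0 + p.2 * w.fn 0, deriv v.fn 0, v.fn 0]) (w₀ + w) v := by
  obtain ⟨-, -, hs⟩ := hs
  set a := psi v.fn v.fn (-1) with ha
  set b := psi v.fn v.fn 1 with hb
  have hder := fun x hx => hasDerivAt_of_eqOn_Ubar_add (x := x) hU (eqOn_refl w.fn Dom) hx
  set N : ℝ → ℝ := fun x => P chat x - (1 - x ^ 2) * (((bdry p.1).2 - (bdry p.1).1) / 2) -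
    2 * x * aff (bdry p.1) x - 1 / 2 * aff (bdry p.1) x ^ 2 - a * (1 - x) / 2 - b * (1 + x) / 2 +
    (b + a) / 2 * (1 - x ^ 2) with hN
  have key : ∀ x ∈ Dom, (1 - x ^ 2) * deriv (w₀ + w).fn x +
      (2 * x + aff (bdry p.1) x) * (w₀ + w).fn x + 1 / 2 * (w₀ + w).fn x ^ 2 +
      Psi0 v.fn v.fn x = N x := fun x hx => by
    have e := (hs x hx).1
    simp only [(hder x hx).deriv, hU hx] at e
    change _ + psi v.fn v.fn x = _ at e
    rw [M1.deriv_add _ _ hx]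
    simp only [hN, Psi0, ← ha, ← hb, M1.fn_add, Pi.add_apply]
    linear_combination e
  obtain ⟨c, hc⟩ := exists_Srcθ_Psi0 hε
  have hbd : ∀ x ∈ Dom, |N x| ≤ (‖w₀ + w‖ + (2 + ‖bdry p.1‖) * ‖w₀ + w‖ +
      1 / 2 * (‖w₀ + w‖ * ‖w₀ + w‖) + c * ‖v‖ * ‖v‖) * weight (1 - 2 * ε) x := fun x hx => by
    rw [← key x hx]
    have hw := weight_pos (1 - 2 * ε) hx
    have p0 := one_sub_sq_pos hx
    have b1 : |(1 - x ^ 2) * deriv (w₀ + w).fn x| ≤ ‖w₀ + w‖ * weight (1 - 2 * ε) x := by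
      rw [abs_mul, abs_of_pos p0, show 1 - 2 * ε = 1 + -(2 * ε) by ring,
        ← one_sub_sq_mul_weight _ hx, mul_left_comm]
      gcongr
      exact (w₀ + w).abs_deriv_le hx
    have b2 : |(2 * x + aff (bdry p.1) x) * (w₀ + w).fn x| ≤
        (2 + ‖bdry p.1‖) * (‖w₀ + w‖ * weight (1 - 2 * ε) x) := by
      rw [abs_mul]
      gcongr
      · refine (abs_add_le _ _).trans (add_le_add ?_ (abs_aff_le _ hx))
        rw [abs_le]; constructor <;> linarith [hx.1, hx.2]
      · exact (w₀ + w).abs_le hx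
    have b3 : |1 / 2 * (w₀ + w).fn x ^ 2| ≤
        1 / 2 * (‖w₀ + w‖ * (‖w₀ + w‖ * weight (1 - 2 * ε) x)) := by
      rw [abs_mul, abs_of_pos (by norm_num : (0 : ℝ) < 1 / 2), sq, abs_mul]
      gcongr
      exacts [(w₀ + w).abs_le_norm hε.2 hx, (w₀ + w).abs_le hx]
    have b4 := (hc v v).bound x hx
    refine (abs_add_le _ _).trans ((add_le_add ((abs_add_le _ _).trans (add_le_add
      ((abs_add_le _ _).trans (add_le_add b1 b2)) b3)) b4).trans (le_of_eq (by ring)))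
  have hNc : Continuous N := by
    have := continuous_P chat
    have := continuous_aff (bdry p.1)
    fun_prop
  obtain ⟨n1, n2⟩ := eq_zero_of_abs_le_weight hNc (by linarith [hε.2]) hbd
  -- Lagrange interpolation of the quadratic polynomial N at -1, 0 and 1.
  have hquad : ∀ x, N x = N 0 * (1 - x ^ 2) := fun x => by
    have : N x = N 0 * (1 - x ^ 2) + N 1 * (x + x ^ 2) / 2 + N (-1) * (x ^ 2 - x) / 2 := by
      simp only [hN, P, aff]; ring
    rw [this, n1, n2]; ring
  have hP0 : ∀ v : M2 ε, Psi0 v.fn v.fn 0 = 0 := fun v => by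
    simp only [Psi0, psi_zero]; ring
  have k0 := key 0 zero_mem_Dom
  have e0 := hs₀.eqθ 0 zero_mem_Dom
  rw [hP0, M1.deriv_add _ _ zero_mem_Dom] at k0
  rw [hP0] at e0
  have ew := hs₀.w_zero
  simp only [datum, PiLp.zero_apply] at ew e0
  simp only [M1.fn_add, Pi.add_apply] at k0
  refine ⟨fun x hx => ?_, fun x hx => ?_, ?_, ?_, ?_⟩
  · change (1 - x ^ 2) * deriv (w₀ + w).fn x +
      (2 * x + aff (bdry p.1) x) * (w₀ + w).fn x + 1 / 2 * (w₀ + w).fn x ^ 2 +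
      Psi0 v.fn v.fn x = _
    rw [key x hx, hquad x]
    congr 1
    simp only [datum, Matrix.cons_val_zero, Matrix.cons_val_one]
    linear_combination -k0 + e0 + w.fn 0 * ew
  · have e := (hs x hx).2
    simp only [hU hx] at e
    simp only [datum, M1.fn_add, Pi.add_apply]
    linear_combination e
  · simp only [datum, M1.fn_add, Pi.add_apply, ew]
    simp
  · simp [datum]
  · simp [datum]

/-- The initial derivative of w is read off from the difference of the two first equations at x = 0,
where Ψ₀ vanishes and aff + w₀ has the value γ. -/
theorem IsSol.initial (hs₀ : IsSol (datum p 0) w₀ (0 : M2 ε))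
    (hs : IsSol (datum p β) (w₀ + w) v) :
    w.fn 0 = β 0 ∧ deriv w.fn 0 = β 1 - p.2 * β 0 ∧ deriv v.fn 0 = β 2 ∧ v.fn 0 = β 3 := by
  have ew := hs₀.w_zero
  have e1 := hs.w_zero
  simp only [datum, PiLp.zero_apply, M1.fn_add, Pi.add_apply] at ew e1
  have e2 : w.fn 0 = β 0 := by linarith
  have hP0 : ∀ v : M2 ε, Psi0 v.fn v.fn 0 = 0 := fun v => by
    simp only [Psi0, psi_zero]; ring
  have k0 := hs.eqθ 0 zero_mem_Dom
  have e0 := hs₀.eqθ 0 zero_mem_Dom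
  rw [hP0, M1.deriv_add _ _ zero_mem_Dom] at k0
  rw [hP0] at e0
  simp only [datum, PiLp.zero_apply, M1.fn_add, Pi.add_apply, e2] at k0 e0
  refine ⟨e2, ?_, hs.v_deriv_zero, hs.v_zero⟩
  linear_combination k0 - e0 - β 0 * ew

end correspondence

/-! ### The projection onto `X₁` -/

theorem M1.abs_apply_zero_le {ε : ℝ} (u : M1 ε) : |u.fn 0| ≤ ‖u‖ := by
  simpa [weight_at_zero] using u.abs_le zero_mem_Dom

theorem M1.abs_deriv_zero_le {ε : ℝ} (u : M1 ε) : |deriv u.fn 0| ≤ ‖u‖ := by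
  simpa [weight_at_zero] using u.abs_deriv_le zero_mem_Dom

theorem M2.abs_apply_zero_le {ε : ℝ} (u : M2 ε) : |u.fn 0| ≤ ‖u‖ := by
  simpa [weight_at_zero] using u.abs_le zero_mem_Dom

theorem M2.abs_deriv_zero_le {ε : ℝ} (u : M2 ε) : |deriv u.fn 0| ≤ ‖u‖ := by
  simpa [weight_at_zero] using u.abs_deriv_le zero_mem_Dom

/-- The value at `0` of an element of `M₁`. -/
noncomputable def M1.evalZero (ε : ℝ) : M1 ε →L[ℝ] ℝ :=
  LinearMap.mkContinuous
    { toFun := fun u => u.fn 0, map_add' := fun _ _ => rfl, map_smul' := fun _ _ => rfl } 1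
    fun u => by rw [one_mul]; exact u.abs_apply_zero_le

/-- The derivative at `0` of an element of `M₁`. -/
noncomputable def M1.derivZero (ε : ℝ) : M1 ε →L[ℝ] ℝ :=
  LinearMap.mkContinuous
    { toFun := fun u => deriv u.fn 0
      map_add' := fun u v => M1.deriv_add u v zero_mem_Dom
      map_smul' := fun a u => by
        rw [M1.fn_smul, deriv_const_smul a u.differentiableAt]; rfl } 1
    fun u => by rw [one_mul]; exact u.abs_deriv_zero_le

/-- The value at `0` of an element of `M₂`. -/
noncomputable def M2.evalZero (ε : ℝ) : M2 ε →L[ℝ] ℝ :=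
  LinearMap.mkContinuous
    { toFun := fun u => u.fn 0, map_add' := fun _ _ => rfl, map_smul' := fun _ _ => rfl } 1
    fun u => by rw [one_mul]; exact u.abs_apply_zero_le

/-- The derivative at `0` of an element of `M₂`. -/
noncomputable def M2.derivZero (ε : ℝ) : M2 ε →L[ℝ] ℝ :=
  LinearMap.mkContinuous
    { toFun := fun u => deriv u.fn 0
      map_add' := fun u v => M2.deriv_add u v zero_mem_Dom
      map_smul' := fun a u => by simpa using M2.deriv_smul a u zero_mem_Dom } 1
    fun u => by rw [one_mul]; exact u.abs_deriv_zero_le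

open ContinuousLinearMap in
-- X₁ is the kernel of the four continuous functionals, and the kernel of a continuous map with
-- finite dimensional range has a closed complement. The projection makes V take values in X₁ also
-- for p outside K.
theorem X1_closedComplemented (ε : ℝ) : (X1 ε).ClosedComplemented := by
  let e := WithLp.prodContinuousLinearEquiv 1 ℝ (M1 ε) (M2 ε)
  let T : X ε →L[ℝ] (ℝ × ℝ) × ℝ × ℝ :=
    ((((M1.evalZero ε).prod (M1.derivZero ε)).comp (fst ℝ _ _)).prod
      (((M2.derivZero ε).prod (M2.evalZero ε)).comp (snd ℝ _ _))).comp e.toContinuousLinearMap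
  have hT : T.ker = X1 ε := by
    ext u
    have : T u = ((X.θ u 0, deriv (X.θ u) 0), deriv (X.φ u) 0, X.φ u 0) := rfl
    rw [LinearMap.mem_ker]
    change T u = 0 ↔ _
    rw [this]
    simp only [Prod.mk_eq_zero, and_assoc]
    rfl
  rw [← hT]
  exact ker_closedComplemented_of_finiteDimensional_range T

theorem norm_le_of_abs_le {β : EuclideanSpace ℝ (Fin 4)} {B : ℝ} (hB : 0 ≤ B)
    (h : ∀ i, |β i| ≤ B) : ‖β‖ ≤ 2 * B := by
  refine abs_le_of_sq_le_sq' ?_ (by positivity) |>.2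
  rw [EuclideanSpace.norm_sq_eq, Fin.sum_univ_four]
  have := fun i => pow_le_pow_left₀ (abs_nonneg (β i)) (h i) 2
  simp only [Real.norm_eq_abs]
  linarith [this 0, this 1, this 2, this 3]

end SwirlNS

/-! ### The theorem. -/

theorem theorem3p1 (K : Set Param) (hK : IsCompact K) (hKI : K ⊆ I11)
    (ε : ℝ) (hε : AdmissibleExponent K ε) :
    ∃ δ : ℝ, 0 < δ ∧ ∃ V : Param × EuclideanSpace ℝ (Fin 4) → X1 ε,
      (∃ Ω : Set Param, IsOpen Ω ∧ K ⊆ Ω ∧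
        ContDiffOn ℝ ∞ V (Ω ×ˢ Metric.ball (0 : EuclideanSpace ℝ (Fin 4)) δ)) ∧
      (∀ p ∈ K, V (p, 0) = 0 ∧
        HasFDerivAt (fun β => V (p, β))
          (0 : EuclideanSpace ℝ (Fin 4) →L[ℝ] X1 ε) 0) ∧
      (∀ p ∈ K, ∀ β : EuclideanSpace ℝ (Fin 4), ‖β‖ < δ →
        SolvesReduced
          ![p.1 0 + 1 / 2 * psi (perturbφ p β (V (p, β)).1) (perturbφ p β (V (p, β)).1) (-1),
            p.1 1 + 1 / 2 * psi (perturbφ p β (V (p, β)).1) (perturbφ p β (V (p, β)).1) 1,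
            p.1 2 - 1 / 2 * iteratedDeriv 2 (phi p (perturbθ p β (V (p, β)).1)) 0]
          (fun x => Ubar p x + perturbθ p β (V (p, β)).1 x)
          (fun x => perturbφ p β (V (p, β)).1 x)) ∧
      ∃ δ' : ℝ, 0 < δ' ∧ ∀ p ∈ K, ∀ Ut : X ε, ‖Ut‖ < δ' →
        ∀ chat : Fin 3 → ℝ,
          SolvesReduced chat (fun x => Ubar p x + X.θ Ut x) (fun x => X.φ Ut x) →
          ∃ β : EuclideanSpace ℝ (Fin 4), ‖β‖ < δ ∧
            ∀ x ∈ Ioo (-1 : ℝ) 1,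
              X.θ Ut x = perturbθ p β (V (p, β)).1 x ∧
              X.φ Ut x = perturbφ p β (V (p, β)).1 x := by
  have hε' : 0 < ε ∧ ε < 1 / 2 := ⟨hε.1, hε.2.1⟩
  have hbase : ∀ p ∈ K, ∃ w : M1 ε, IsSol (datum p 0) w (0 : M2 ε) ∧
      EqOn (Ubar p) (fun x => aff (bdry p.1) x + w.fn x) Dom := fun p hp =>
    exists_isSol_datum_zero hε' (hKI hp) (hε.bdry_lt hKI hp).1 (hε.bdry_lt hKI hp).2
  obtain ⟨Ω, hΩ, hKΩ, δ, hδ, r, hr, S, hSsmooth, hSspec, hSuniq, hSK⟩ := exists_glued_family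
    (Spec := fun p β y => IsPerturbation (ε := ε) p β y)
    (R := fun p D => ∀ β, EqOn (D β).1.fn (fun x => ∑ i, β i * kerθ p i x) Dom ∧
      EqOn (D β).2.fn (fun x => ∑ i, β i * kerφ p i x) Dom) hK (fun p hp => by
      obtain ⟨w, hw, hU⟩ := hbase p hp
      obtain ⟨hl, hr⟩ := hε.bdry_lt hKI hp
      obtain ⟨u, h1, h2, h3, h4, D, hD, h5⟩ :=
        exists_local_perturbation hε' (hKI hp).1 (hKI hp).2.1 hw hl hr
      refine ⟨u, h1, h2, h3, h4, D, fun β => ⟨fun x hx => ?_, fun x hx => ?_⟩, h5⟩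
      · rw [(hD β).1 hx, ← solθ_congr_coeff hU _ _ hx]
        exact (sum_kerθ (Ubar_spec (hKI hp)).1.continuousOn β hx).symm
      · rw [(hD β).2 hx, ← solφ_congr_coeff hU _ _ _ hx]
        exact (sum_kerφ p β x).symm)
  obtain ⟨Φ, hΦ⟩ := X1_closedComplemented ε
  let e := WithLp.prodContinuousLinearEquiv 1 ℝ (M1 ε) (M2 ε)
  let L : M1 ε × M2 ε →L[ℝ] X1 ε := Φ.comp e.symm.toContinuousLinearMap
  -- The derivative of S is subtracted rather than ∑ βᵢVⁱ, because it is smooth in p on all of Ω; on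
  -- K the two agree. The projection in L acts as the identity on K, where the difference already
  -- lies in X₁.
  let V : Param × EuclideanSpace ℝ (Fin 4) → X1 ε := fun z =>
    L (S z - fderiv ℝ S (z.1, 0) (0, z.2))
  have hopen : IsOpen (Ω ×ˢ Metric.ball (0 : EuclideanSpace ℝ (Fin 4)) δ) :=
    hΩ.prod Metric.isOpen_ball
  have hmem : ∀ p ∈ Ω, (p, (0 : EuclideanSpace ℝ (Fin 4))) ∈ Ω ×ˢ Metric.ball 0 δ :=
    fun p hp => ⟨hp, Metric.mem_ball_self hδ⟩
  -- the derivative in `β` along `K`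
  have hD : ∀ p ∈ K, S (p, 0) = 0 ∧ ∃ D : EuclideanSpace ℝ (Fin 4) →L[ℝ] M1 ε × M2 ε,
      (∀ β, V (p, β) = L (S (p, β) - D β)) ∧ HasFDerivAt (fun β => S (p, β)) D 0 ∧
      ∀ β, EqOn (D β).1.fn (fun x => ∑ i, β i * kerθ p i x) Dom ∧
        EqOn (D β).2.fn (fun x => ∑ i, β i * kerφ p i x) Dom := fun p hp => by
    obtain ⟨h0, D, hD1, hD2⟩ := hSK p hp
    refine ⟨h0, D, fun β => ?_, hD2, hD1⟩
    have hdiff : DifferentiableAt ℝ S (p, 0) :=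
      (hSsmooth.contDiffAt (hopen.mem_nhds (hmem p (hKΩ hp)))).differentiableAt (by simp)
    have h1 := HasFDerivAt.comp (0 : EuclideanSpace ℝ (Fin 4)) (g := S) (f := fun β => (p, β))
      hdiff.hasFDerivAt (hasFDerivAt_prodMk_right p 0)
    have h2 := h1.unique hD2
    simp only [V, ← h2]
    simp
  -- the perturbation in terms of `S`
  have hpert : ∀ p ∈ K, ∀ β : EuclideanSpace ℝ (Fin 4), ‖β‖ < δ →
      EqOn (perturbθ p β (V (p, β)).1) (S (p, β)).1.fn Dom ∧
      EqOn (perturbφ p β (V (p, β)).1) (S (p, β)).2.fn Dom := fun p hp β hβ => by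
    obtain ⟨h0, D, hV, -, hDker⟩ := hD p hp
    obtain ⟨w, hw, hsol⟩ := hSspec p (hKΩ hp) β hβ
    obtain ⟨k1, k2⟩ := hDker β
    obtain ⟨i1, i2, i3, i4⟩ := hw.initial hsol
    have cU := (Ubar_spec (hKI hp)).1.continuousOn
    have g1 : EqOn (D β).1.fn (solθ (Ubar p) (β 0) fun x => β 1 * (1 - x ^ 2)) Dom :=
      fun x hx => (k1 hx).trans (sum_kerθ cU β hx)
    have g2 : EqOn (D β).2.fn (solφ (Ubar p) (β 3) (β 2) 0) Dom :=
      fun x hx => (k2 hx).trans (sum_kerφ p β x)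
    -- S(p,β) and its linear part have the same values and first derivatives at 0, namely β₀ and β₁
    -- - γβ₀ for the first component, β₃ and β₂ for the second.
    have hX1 : e.symm (S (p, β) - D β) ∈ X1 ε := by
      have s1 : ((S (p, β)).1 - (D β).1).fn = (S (p, β)).1.fn - (D β).1.fn := M1.fn_sub _ _
      have s2 : ((S (p, β)).2 - (D β).2).fn = (S (p, β)).2.fn - (D β).2.fn := M2.fn_sub _ _
      change ((S (p, β)).1 - (D β).1).fn 0 = 0 ∧ deriv ((S (p, β)).1 - (D β).1).fn 0 = 0 ∧
        deriv ((S (p, β)).2 - (D β).2).fn 0 = 0 ∧ ((S (p, β)).2 - (D β).2).fn 0 = 0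
      rw [s1, s2, deriv_sub (M1.differentiableAt _) (M1.differentiableAt _),
        deriv_sub (M2.differentiableAt _) (M2.differentiableAt _), Pi.sub_apply, Pi.sub_apply,
        i1, i2, i3, i4, deriv_congr_on isOpen_Ioo g1 zero_mem_Dom,
        deriv_congr_on isOpen_Ioo g2 zero_mem_Dom, g1 zero_mem_Dom, g2 zero_mem_Dom,
        (hasDerivAt_solθ cU (by fun_prop) zero_mem_Dom).deriv,
        deriv_solφ_zero (h := 0) cU continuousOn_const, solθ_zero, solφ_zero, (Ubar_spec (hKI hp)).2]
      refine ⟨by ring, by norm_num, by ring, by ring⟩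
    have hVe : (V (p, β)).1 = e.symm (S (p, β) - D β) := by
      rw [hV β]
      exact congrArg Subtype.val (hΦ ⟨_, hX1⟩)
    have f1 : X.θ (V (p, β)).1 = (S (p, β)).1.fn - (D β).1.fn := by
      rw [hVe]; exact M1.fn_sub _ _
    have f2 : X.φ (V (p, β)).1 = (S (p, β)).2.fn - (D β).2.fn := by
      rw [hVe]; exact M2.fn_sub _ _
    refine ⟨fun x hx => ?_, fun x hx => ?_⟩
    · rw [perturbθ, f1, Pi.sub_apply, k1 hx]; ring
    · rw [perturbφ, f2, Pi.sub_apply, k2 hx]; ring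
  obtain ⟨G, hG⟩ : ∃ G, ∀ p ∈ K, |p.2| ≤ G := by
    obtain ⟨G, hG⟩ := hK.exists_bound_of_continuousOn (f := fun p : Param => p.2) (by fun_prop)
    exact ⟨G, hG⟩
  -- The bound r admits the uniqueness of the glued family. Each coordinate of β is at most
  -- (1+|G|)‖Ũ‖ in absolute value, where G bounds γ on K, and four coordinates cost a factor 2 in
  -- the Euclidean norm; this gives the second bound.
  refine ⟨δ, hδ, V, ⟨Ω, hΩ, hKΩ, ?_⟩, fun p hp => ?_, fun p hp β hβ => ?_,
    min r (δ / (2 * (1 + |G|))), by positivity, fun p hp Ut hUt chat hsol => ?_⟩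
  · have hf : ContDiffOn ℝ ∞ (fderiv ℝ S) (Ω ×ˢ Metric.ball 0 δ) :=
      hSsmooth.fderiv_of_isOpen hopen (by simp)
    have hf' : ContDiffOn ℝ ∞ (fun z : Param × EuclideanSpace ℝ (Fin 4) => fderiv ℝ S (z.1, 0))
        (Ω ×ˢ Metric.ball 0 δ) :=
      hf.comp (f := fun z : Param × EuclideanSpace ℝ (Fin 4) => (z.1, 0)) (by fun_prop)
        fun z hz => hmem z.1 hz.1
    exact L.contDiff.comp_contDiffOn (hSsmooth.sub (hf'.clm_apply (by fun_prop)))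
  · obtain ⟨h0, D, hV, hd, -⟩ := hD p hp
    refine ⟨by rw [hV, h0]; simp, ?_⟩
    have := L.hasFDerivAt.comp (0 : EuclideanSpace ℝ (Fin 4)) (hd.sub D.hasFDerivAt)
    rw [sub_self, ContinuousLinearMap.comp_zero] at this
    exact this.congr_of_eventuallyEq (Eventually.of_forall fun β => hV β)
  · obtain ⟨w, hw, hU⟩ := hbase p hp
    obtain ⟨w', hw', hsol⟩ := hSspec p (hKΩ hp) β hβ
    -- Only for p in K is the base solution known to come from `Ubar p`; uniqueness identifies it
    -- with the one in `IsPerturbation`.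
    obtain rfl := hw.unique_noSwirl hw'
    exact solvesReduced_of_isSol (hKI hp).1 (hKI hp).2.1 (Ubar_spec (hKI hp)).1 hU hsol
      (hpert p hp β hβ).1 (hpert p hp β hβ).2
  · obtain ⟨w, hw, hU⟩ := hbase p hp
    have h1 := isSol_of_solvesReduced hε' hU hw hsol
    have hn : ‖Ut‖ = ‖Ut.fst‖ + ‖Ut.snd‖ := WithLp.prod_norm_eq_of_L1 Ut
    have n1 := norm_nonneg Ut.fst
    have n2 := norm_nonneg Ut.snd
    have b1 : |Ut.fst.fn 0| ≤ ‖Ut.fst‖ :=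
      Ut.fst.abs_apply_zero_le
    have b2 : |deriv Ut.fst.fn 0| ≤ ‖Ut.fst‖ :=
      Ut.fst.abs_deriv_zero_le
    have b3 : |Ut.snd.fn 0| ≤ ‖Ut.snd‖ :=
      Ut.snd.abs_apply_zero_le
    have b4 : |deriv Ut.snd.fn 0| ≤ ‖Ut.snd‖ :=
      Ut.snd.abs_deriv_zero_le
    have hG' : |p.2| ≤ |G| := (hG p hp).trans (le_abs_self G)
    have nG := abs_nonneg G
    have hU0 := norm_nonneg Ut
    have hmul : 0 ≤ |G| * ‖Ut‖ := mul_nonneg nG hU0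
    -- The only possible parameter, by `IsSol.initial`: β₀ = w(0), β₁ = w'(0) + γw(0), β₂ = v'(0),
    -- β₃ = v(0).
    set β : EuclideanSpace ℝ (Fin 4) :=
      !₂[Ut.fst.fn 0, deriv Ut.fst.fn 0 + p.2 * Ut.fst.fn 0, deriv Ut.snd.fn 0, Ut.snd.fn 0] with hβdef
    have hβ : ‖β‖ < δ := by
      refine (norm_le_of_abs_le (B := (1 + |G|) * ‖Ut‖) (by positivity) fun i => ?_).trans_lt ?_
      · fin_cases i
        · change |Ut.fst.fn 0| ≤ _
          linarith
        · change |deriv Ut.fst.fn 0 + p.2 * Ut.fst.fn 0| ≤ _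
          have : |p.2 * Ut.fst.fn 0| ≤ |G| * ‖Ut‖ := by
            rw [abs_mul]; gcongr; linarith
          linarith [abs_add_le (deriv Ut.fst.fn 0) (p.2 * Ut.fst.fn 0)]
        · change |deriv Ut.snd.fn 0| ≤ _
          linarith
        · change |Ut.snd.fn 0| ≤ _
          linarith
      · have := hUt.trans_le (min_le_right _ _)
        rw [lt_div_iff₀ (by positivity)] at this
        linarith
    have hyr : ‖((Ut.fst, Ut.snd) : M1 ε × M2 ε)‖ < r := by
      have := hUt.trans_le (min_le_left _ _)
      rw [Prod.norm_def]
      exact max_lt (by simp only; linarith) (by simp only; linarith)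
    have h2 := hSuniq p (hKΩ hp) β hβ (Ut.fst, Ut.snd) hyr ⟨w, hw, h1⟩
    refine ⟨β, hβ, fun x hx => ⟨?_, ?_⟩⟩
    · rw [(hpert p hp β hβ).1 hx, ← h2]; rfl
    · rw [(hpert p hp β hβ).2 hx, ← h2]; rfl
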